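/- Let $k$ be an algebraically closed field of characteristic zero and let $A$ be a semisimple Hopf algebra over $k$. Write $\operatorname{Rep} A$ for the monoidal category of finite-dimensional left $A$-modules. Let $G$ be a finite abelian group, $\chi : G \times G \to k^{\times}$ a nondegenerate symmetric bicharacter, and $r \in k$ an element with $r^2 = |G|$. The Tambara--Yamagami category $\mathcal C(G, \chi, r)$ is the $k$-linear semisimple monoidal category with simple objects the elements of $G$ together with one further object $m$, with tensor products $$g \otimes h = gh, \qquad g \otimes m = m \otimes g = m, \qquad m \otimes m = \bigoplus_{g \in G} g \qquad (g, h \in G),$$ unit object $1 \in G$ (with identity unit constraints), and associativity constraints $(x \otimes y) \otimes z \to x \otimes (y \otimes z)$ given by the scalar $\chi(g,h)$ on $(g \otimes m) \otimes h = m$, by $\bigoplus_{d \in G} \chi(g, d)\,\mathrm{id}_d$ on $(m \otimes g) \otimes m = \bigoplus_{d} d$, by the matrix $\bigl(r^{-1} \chi(e,f)^{-1}\bigr)_{e,f \in G}$ on $(m \otimes m) \otimes m = \bigoplus_{e} m \to \bigoplus_{f} m = m \otimes (m \otimes m)$, and by identities on all other triples of simple objects. Suppose that there are data $(G, \chi,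 r)$ as above such that $\operatorname{Rep} A$ is equivalent, as a monoidal category, to $\mathcal C(G, \chi, r)$. Then: 1. $A$ fits into a central exact sequence of Hopf algebras $$k \to k^{\mathbb Z_2} \xrightarrow{\ i\ } A \xrightarrow{\ p\ } kG \to k.$$ That is, $i$ and $p$ are Hopf algebra maps, $i$ is injective, $p$ is surjective, $\ker p = A\, i(k^{\mathbb Z_2})^{+}$, where $i(k^{\mathbb Z_2})^{+} = i(\ker \varepsilon)$, the image of $i$ is both the algebra of right and the algebra of left coinvariants, $i(k^{\mathbb Z_2}) = \{a \in A : (\mathrm{id} \otimes p)\Delta(a) = a \otimes 1\} = \{a \in A : (p \otimes \mathrm{id})\Delta(a) = 1 \otimes a\}$, and $i(k^{\mathbb Z_2})$ is contained in the center of $A$. 2. $A$ is group theoretical. That is, there exist a finite group $\Sigma$, a normalized $3$-cocycle $\omega : \Sigma^3 \to k^{\times}$, a subgroup $F \subseteq \Sigma$ and a normalized $2$-cochain $\alpha : F \times F \to k^{\times}$ with $$\alpha(x,y)\,\alpha(xy,z) = \omega(x,y,z)\,\alpha(y,z)\,\alpha(x,yz) \qquad (x,y,z \in F),$$ such that $\operatorname{Rep}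 A$ is equivalent, as a $k$-linear monoidal category, to the category $\mathcal C(\Sigma, \omega, F, \alpha)$ of $k_\alpha F$-bimodules in $\operatorname{Vec}^{\Sigma}_{\omega}$. Here $\operatorname{Vec}^{\Sigma}_{\omega}$ is the category of finite-dimensional $\Sigma$-graded vector spaces with associativity constraint $(u \otimes v) \otimes w \mapsto \omega(a, b, c)\, u \otimes (v \otimes w)$ for homogeneous $u, v, w$ of degrees $a, b, c$; $k_\alpha F$ is the algebra in it with basis $F$ and product $x \cdot y = \alpha(x,y)\, xy$, where $x \in F$ has degree $x$; and the tensor product of bimodules is taken over $k_\alpha F$. -/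

import Mathlib

universe u v w

open CategoryTheory MonoidalCategory TensorProduct Limits


/-- A finite-dimensional representation (left module) of a `k`-algebra `A`. -/
structure HopfRep (k : Type u) [Field k] (A : Type v) [Ring A] [Algebra k A] where
  V : Type u
  [addCommGroup : AddCommGroup V]
  [module : Module k V]
  [finite : Module.Finite k V]
  ρ : A →ₐ[k] Module.End k V

namespace HopfRep

attribute [instance] addCommGroup module finite

section Category

variable {k : Type u} [Field k] {A : Type v} [Ring A] [Algebra k A]

/-- Morphisms of representations: `A`-equivariant linear maps. -/
@[ext]
structure Hom (X Y : HopfRep.{u, v} k A) where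
  toLin : X.V →ₗ[k] Y.V
  equivariant : ∀ a x, toLin (X.ρ a x) = Y.ρ a (toLin x)

instance : Category (HopfRep.{u, v} k A) where
  Hom X Y := Hom X Y
  id X := ⟨LinearMap.id, fun _ _ => rfl⟩
  comp f g := ⟨g.toLin ∘ₗ f.toLin, fun a x => by simp [f.equivariant, g.equivariant]⟩

@[ext] theorem hom_ext {X Y : HopfRep.{u, v} k A} {f g : X ⟶ Y} (h : f.toLin = g.toLin) : f = g :=
  Hom.ext h

@[simp] theorem id_toLin (X : HopfRep.{u, v} k A) : (𝟙 X : X ⟶ X).toLin = LinearMap.id := rfl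
@[simp] theorem comp_toLin {X Y Z : HopfRep.{u, v} k A} (f : X ⟶ Y) (g : Y ⟶ Z) :
    (f ≫ g).toLin = g.toLin ∘ₗ f.toLin := rfl

instance (X Y : HopfRep.{u, v} k A) : AddCommGroup (X ⟶ Y) :=
  let S : Submodule k (X.V →ₗ[k] Y.V) :=
    { carrier := {f | ∀ a x, f (X.ρ a x) = Y.ρ a (f x)}
      add_mem' := fun hf hg a x => by simp [hf a x, hg a x]
      zero_mem' := fun a x => by simp
      smul_mem' := fun c f hf a x => by simp [hf a x] }
  let e : (X ⟶ Y) ≃ S := ⟨fun f => ⟨f.toLin, f.equivariant⟩, fun f => ⟨f.1, f.2⟩,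
    fun _ => rfl, fun _ => rfl⟩
  e.addCommGroup

instance (X Y : HopfRep.{u, v} k A) : Module k (X ⟶ Y) where
  smul c f := ⟨c • f.toLin, fun a x => by simp [f.equivariant]⟩
  one_smul f := by apply hom_ext; exact one_smul _ _
  mul_smul a b f := by apply hom_ext; exact mul_smul _ _ _
  smul_zero a := by apply hom_ext; exact smul_zero _
  smul_add a f g := by apply hom_ext; exact smul_add _ _ _
  add_smul a b f := by apply hom_ext; exact add_smul _ _ _
  zero_smul f := by apply hom_ext; exact zero_smul _ _

@[simp] theorem add_toLin {X Y : HopfRep.{u, v} k A} (f g : X ⟶ Y) :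
    (f + g).toLin = f.toLin + g.toLin := rfl
@[simp] theorem smul_toLin {X Y : HopfRep.{u, v} k A} (c : k) (f : X ⟶ Y) :
    (c • f).toLin = c • f.toLin := rfl

instance : Preadditive (HopfRep.{u, v} k A) where
  add_comp _ _ _ f f' g := by apply hom_ext; simp [LinearMap.comp_add]
  comp_add _ _ _ f g g' := by apply hom_ext; simp [LinearMap.add_comp]

instance : Linear k (HopfRep.{u, v} k A) where
  smul_comp _ _ _ r f g := by apply hom_ext; simp [LinearMap.comp_smul]
  comp_smul _ _ _ f r g := by apply hom_ext; simp [LinearMap.smul_comp]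

/-- An equivariant linear isomorphism is an isomorphism of representations. -/
def mkIso {X Y : HopfRep.{u, v} k A} (e : X.V ≃ₗ[k] Y.V)
    (h : ∀ a x, e (X.ρ a x) = Y.ρ a (e x)) : X ≅ Y where
  hom := ⟨e.toLinearMap, h⟩
  inv := ⟨e.symm.toLinearMap, fun a y => by
    apply e.injective
    have := h a (e.symm y)
    simp at this
    simp [this]⟩
  hom_inv_id := by ext; simp
  inv_hom_id := by ext; simp

@[simp] theorem mkIso_hom_toLin {X Y : HopfRep.{u, v} k A} (e : X.V ≃ₗ[k] Y.V)
    (h : ∀ a x, e (X.ρ a x) = Y.ρ a (e x)) : (mkIso e h).hom.toLin = e.toLinearMap := rfl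

end Category

section Unbundled

variable {k : Type u} [Field k] {A : Type v} [Ring A]

section

variable {B C D : Type*} [Ring B] [Algebra k B] [Ring C] [Algebra k C] [Ring D] [Algebra k D]
  {U V W : Type*} [AddCommGroup U] [Module k U] [AddCommGroup V] [Module k V]
  [AddCommGroup W] [Module k W]

/-- The action of `B ⊗ C` on `V ⊗ W`, for a `B`-module `V` and a `C`-module `W`. -/
noncomputable def act₂ (f : B →ₐ[k] Module.End k V) (g : C →ₐ[k] Module.End k W) :
    B ⊗[k] C →ₐ[k] Module.End k (V ⊗[k] W) :=
  Module.endTensorEndAlgHom.comp (Algebra.TensorProduct.map f g)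

@[simp] theorem act₂_tmul (f : B →ₐ[k] Module.End k V) (g : C →ₐ[k] Module.End k W)
    (b : B) (c : C) (v : V) (w : W) :
    act₂ f g (b ⊗ₜ c) (v ⊗ₜ w) = f b v ⊗ₜ g c w := rfl

theorem assoc_act₂ (f : B →ₐ[k] Module.End k U) (g : C →ₐ[k] Module.End k V)
    (h : D →ₐ[k] Module.End k W) (b : (B ⊗[k] C) ⊗[k] D) (t : (U ⊗[k] V) ⊗[k] W) :
    TensorProduct.assoc k U V W (act₂ (act₂ f g) h b t) =
      act₂ f (act₂ g h) (TensorProduct.assoc k B C D b) (TensorProduct.assoc k U V W t) := by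
  induction b with
  | zero => simp
  | add b c hb hc => simp [hb, hc]
  | tmul b c =>
    induction b with
    | zero => simp
    | add b b' hb hb' => simp [hb, hb', TensorProduct.add_tmul]
    | tmul b b' =>
      induction t with
      | zero => simp
      | add s t hs ht => simp only [map_add, hs, ht]
      | tmul x z =>
        induction x with
        | zero => simp
        | add s t hs ht => simp only [map_add, TensorProduct.add_tmul, hs, ht]
        | tmul x y => simp

end

variable [HopfAlgebra k A] {U V W : Type*} [AddCommGroup U] [Module k U] [AddCommGroup V]
  [Module k V] [AddCommGroup W] [Module k W]

/-- The diagonal action of a Hopf algebra on `V ⊗ W`: the element `a` acts by `Δ(a)`. -/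
noncomputable def diag (f : A →ₐ[k] Module.End k V) (g : A →ₐ[k] Module.End k W) :
    A →ₐ[k] Module.End k (V ⊗[k] W) :=
  (act₂ f g).comp (Bialgebra.comulAlgHom k A)

theorem diag_apply (f : A →ₐ[k] Module.End k V) (g : A →ₐ[k] Module.End k W) (a : A) :
    diag f g a = act₂ f g (Coalgebra.comul (R := k) a) := rfl

/-- The trivial action of a Hopf algebra on `k`, by the counit. -/
noncomputable def triv (k : Type u) [Field k] (A : Type v) [Ring A] [HopfAlgebra k A] :
    A →ₐ[k] Module.End k k :=
  (Algebra.lmul k k).comp (Bialgebra.counitAlgHom k A)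

@[simp] theorem triv_apply (a : A) (t : k) :
    triv k A a t = Coalgebra.counit (R := k) a * t := rfl

theorem act₂_diag_left (f : A →ₐ[k] Module.End k U) (g : A →ₐ[k] Module.End k V)
    (h : A →ₐ[k] Module.End k W) (b : A ⊗[k] A) :
    act₂ (diag f g) h b = act₂ (act₂ f g) h ((Coalgebra.comul (R := k)).rTensor A b) := by
  induction b with
  | zero => simp
  | add b c hb hc => simp only [map_add, hb, hc]
  | tmul b c => exact TensorProduct.ext' fun x z => rfl

theorem act₂_diag_right (f : A →ₐ[k] Module.End k U) (g : A →ₐ[k] Module.End k V)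
    (h : A →ₐ[k] Module.End k W) (b : A ⊗[k] A) :
    act₂ f (diag g h) b = act₂ f (act₂ g h) ((Coalgebra.comul (R := k)).lTensor A b) := by
  induction b with
  | zero => simp
  | add b c hb hc => simp only [map_add, hb, hc]
  | tmul b c => exact TensorProduct.ext' fun x z => rfl

theorem assoc_diag (f : A →ₐ[k] Module.End k U) (g : A →ₐ[k] Module.End k V)
    (h : A →ₐ[k] Module.End k W) (a : A) (t : (U ⊗[k] V) ⊗[k] W) :
    TensorProduct.assoc k U V W (diag (diag f g) h a t) =
      diag f (diag g h) a (TensorProduct.assoc k U V W t) := by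
  rw [diag_apply, diag_apply f, act₂_diag_left, act₂_diag_right, assoc_act₂,
    Coalgebra.coassoc_apply]

theorem lid_diag (f : A →ₐ[k] Module.End k V) (a : A) (t : k ⊗[k] V) :
    TensorProduct.lid k V (diag (triv k A) f a t) = f a (TensorProduct.lid k V t) := by
  have key : ∀ b : A ⊗[k] A, TensorProduct.lid k V (act₂ (triv k A) f b t) =
      f (TensorProduct.lid k A ((Coalgebra.counit (R := k)).rTensor A b))
        (TensorProduct.lid k V t) := by
    intro b
    induction b with
    | zero => simp
    | add b c hb hc => simp only [map_add, LinearMap.add_apply, hb, hc]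
    | tmul b c =>
      induction t with
      | zero => simp
      | add s t hs ht => simp only [map_add, hs, ht]
      | tmul x z =>
        simp only [LinearMap.rTensor_tmul, LinearMap.lTensor_tmul, act₂_tmul, triv_apply,
          TensorProduct.lid_tmul, TensorProduct.rid_tmul, map_smul, LinearMap.smul_apply, mul_smul]
        try rw [smul_comm]
  rw [diag_apply, key, Coalgebra.rTensor_counit_comul]
  simp

theorem rid_diag (f : A →ₐ[k] Module.End k V) (a : A) (t : V ⊗[k] k) :
    TensorProduct.rid k V (diag f (triv k A) a t) = f a (TensorProduct.rid k V t) := by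
  have key : ∀ b : A ⊗[k] A, TensorProduct.rid k V (act₂ f (triv k A) b t) =
      f (TensorProduct.rid k A ((Coalgebra.counit (R := k)).lTensor A b))
        (TensorProduct.rid k V t) := by
    intro b
    induction b with
    | zero => simp
    | add b c hb hc => simp only [map_add, LinearMap.add_apply, hb, hc]
    | tmul b c =>
      induction t with
      | zero => simp
      | add s t hs ht => simp only [map_add, hs, ht]
      | tmul x z =>
        simp only [LinearMap.rTensor_tmul, LinearMap.lTensor_tmul, act₂_tmul, triv_apply,
          TensorProduct.lid_tmul, TensorProduct.rid_tmul, map_smul, LinearMap.smul_apply, mul_smul]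
        try rw [smul_comm]
  rw [diag_apply, key, Coalgebra.lTensor_counit_comul]
  simp

end Unbundled

section Monoidal

variable {k : Type u} [Field k] {A : Type v} [Ring A] [HopfAlgebra k A]

/-- The tensor product of representations of a Hopf algebra: `a` acts on `V ⊗ W` by `Δ(a)`. -/
noncomputable def tensor (X Y : HopfRep.{u, v} k A) : HopfRep.{u, v} k A where
  V := X.V ⊗[k] Y.V
  ρ := diag X.ρ Y.ρ

/-- The trivial representation, given by the counit. -/
noncomputable def unit : HopfRep.{u, v} k A where
  V := k
  ρ := triv k A

theorem map_equivariant {X X' Y Y' : HopfRep.{u, v} k A} (f : X ⟶ X') (g : Y ⟶ Y')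
    (b : A ⊗[k] A) (t : X.V ⊗[k] Y.V) :
    TensorProduct.map f.toLin g.toLin (act₂ X.ρ Y.ρ b t) =
      act₂ X'.ρ Y'.ρ b (TensorProduct.map f.toLin g.toLin t) := by
  induction b with
  | zero => simp
  | add b c hb hc => simp [hb, hc]
  | tmul b c =>
    induction t with
    | zero => simp
    | add s t hs ht => simp only [map_add, hs, ht]
    | tmul x y => simp [f.equivariant, g.equivariant]

/-- The tensor product of morphisms of representations. -/
noncomputable def tensorMap {X X' Y Y' : HopfRep.{u, v} k A} (f : X ⟶ X') (g : Y ⟶ Y') :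
    tensor X Y ⟶ tensor X' Y' :=
  ⟨TensorProduct.map f.toLin g.toLin, fun _ t => map_equivariant f g _ t⟩

noncomputable instance : MonoidalCategoryStruct (HopfRep.{u, v} k A) where
  tensorObj := tensor
  tensorHom f g := tensorMap f g
  whiskerLeft X _ _ f := tensorMap (𝟙 X) f
  whiskerRight f Y := tensorMap f (𝟙 Y)
  tensorUnit := unit
  associator X Y Z := mkIso (X := tensor (tensor X Y) Z) (Y := tensor X (tensor Y Z))
    (TensorProduct.assoc k X.V Y.V Z.V) (assoc_diag X.ρ Y.ρ Z.ρ)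
  leftUnitor X := mkIso (X := tensor unit X) (Y := X) (TensorProduct.lid k X.V) (lid_diag X.ρ)
  rightUnitor X := mkIso (X := tensor X unit) (Y := X) (TensorProduct.rid k X.V) (rid_diag X.ρ)

@[simp] theorem tensorHom_toLin {X X' Y Y' : HopfRep.{u, v} k A} (f : X ⟶ X') (g : Y ⟶ Y') :
    (f ⊗ₘ g).toLin = TensorProduct.map f.toLin g.toLin := rfl
@[simp] theorem whiskerLeft_toLin (X : HopfRep.{u, v} k A) {Y Y' : HopfRep.{u, v} k A}
    (f : Y ⟶ Y') : (X ◁ f).toLin = TensorProduct.map LinearMap.id f.toLin := rfl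
@[simp] theorem whiskerRight_toLin {X X' : HopfRep.{u, v} k A} (f : X ⟶ X')
    (Y : HopfRep.{u, v} k A) : (f ▷ Y).toLin = TensorProduct.map f.toLin LinearMap.id := rfl
@[simp] theorem associator_toLin (X Y Z : HopfRep.{u, v} k A) :
    (α_ X Y Z).hom.toLin = (TensorProduct.assoc k X.V Y.V Z.V).toLinearMap := rfl
@[simp] theorem leftUnitor_toLin (X : HopfRep.{u, v} k A) :
    (λ_ X).hom.toLin = (TensorProduct.lid k X.V).toLinearMap := rfl
@[simp] theorem rightUnitor_toLin (X : HopfRep.{u, v} k A) :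
    (ρ_ X).hom.toLin = (TensorProduct.rid k X.V).toLinearMap := rfl

/-- The monoidal category `Rep A` of finite-dimensional representations of a Hopf algebra. -/
noncomputable instance : MonoidalCategory (HopfRep.{u, v} k A) where
  tensorHom_def f g := by
    apply hom_ext
    exact TensorProduct.ext' fun x y => rfl
  id_tensorHom_id X Y := by
    apply hom_ext
    exact TensorProduct.ext' fun x y => rfl
  tensorHom_comp_tensorHom f f' g g' := by
    apply hom_ext
    exact TensorProduct.ext' fun x y => rfl
  whiskerLeft_id X Y := by
    apply hom_ext
    exact TensorProduct.ext' fun x y => rfl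
  id_whiskerRight X Y := by
    apply hom_ext
    exact TensorProduct.ext' fun x y => rfl
  associator_naturality f g h := by
    apply hom_ext
    exact TensorProduct.ext_threefold fun x y z => rfl
  leftUnitor_naturality {X Y} f := by
    apply hom_ext
    refine TensorProduct.ext' fun (x : k) y => ?_
    exact (f.toLin.map_smul x y).symm
  rightUnitor_naturality {X Y} f := by
    apply hom_ext
    refine TensorProduct.ext' fun y (x : k) => ?_
    exact (f.toLin.map_smul x y).symm
  pentagon W X Y Z := by
    apply hom_ext
    exact TensorProduct.ext_fourfold fun x y z w => rfl
  triangle X Y := by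
    apply hom_ext
    refine TensorProduct.ext_threefold fun x (y : k) z => ?_
    exact (TensorProduct.smul_tmul y x z).symm

end Monoidal

end HopfRep

/-- The algebra `k^Γ` of functions on a finite group `Γ`. -/
def FunctionAlgebra (k : Type u) (Γ : Type v) : Type (max u v) := Γ → k

namespace FunctionAlgebra

variable (k : Type u) [Field k] (Γ : Type v)

noncomputable instance : CommRing (FunctionAlgebra k Γ) := inferInstanceAs (CommRing (Γ → k))
noncomputable instance : Algebra k (FunctionAlgebra k Γ) := inferInstanceAs (Algebra k (Γ → k))

variable {k Γ}

theorem mul_eval (f f' : FunctionAlgebra k Γ) (g : Γ) : (f * f') g = f g * f' g := rfl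
theorem add_eval (f f' : FunctionAlgebra k Γ) (g : Γ) : (f + f') g = f g + f' g := rfl
theorem one_eval (g : Γ) : (1 : FunctionAlgebra k Γ) g = 1 := rfl
theorem smul_eval (c : k) (f : FunctionAlgebra k Γ) (g : Γ) : (c • f) g = c * f g := rfl

open Classical in
/-- The function `δ_g`. -/
noncomputable def delta (g : Γ) : FunctionAlgebra k Γ := fun h => if h = g then 1 else 0

theorem delta_eval [DecidableEq Γ] (g h : Γ) :
    (delta g : FunctionAlgebra k Γ) h = if h = g then 1 else 0 := by
  unfold delta; congr

theorem mul_delta (f : FunctionAlgebra k Γ) (g : Γ) : f * delta g = f g • delta g := by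
  classical
  funext h
  rw [mul_eval, smul_eval, delta_eval]
  split_ifs with e <;> simp [e]

section

variable [Fintype Γ]

theorem sum_eval {ι : Type*} (s : Finset ι) (f : ι → FunctionAlgebra k Γ) (g : Γ) :
    (∑ i ∈ s, f i) g = ∑ i ∈ s, f i g := Finset.sum_apply g s f

theorem eq_sum (f : FunctionAlgebra k Γ) : f = ∑ g, f g • delta g := by
  classical
  funext h
  rw [sum_eval, Finset.sum_eq_single h]
  · simp [smul_eval, delta_eval]
  · intro g _ hg
    simp [smul_eval, delta_eval, hg.symm]
  · simp

theorem sum_delta : ∑ g, (delta g : FunctionAlgebra k Γ) = 1 := by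
  rw [eq_sum 1]; simp [one_eval]

theorem linearMap_ext {M : Type*} [AddCommMonoid M] [Module k M]
    {f g : FunctionAlgebra k Γ →ₗ[k] M} (h : ∀ x, f (delta x) = g (delta x)) : f = g := by
  ext x
  rw [eq_sum x]
  simp [h]

end

variable [Group Γ] [Fintype Γ]

/-- The comultiplication `Δ(f) = ∑_{s,t} f(st) δ_s ⊗ δ_t`. -/
noncomputable def comulHom : FunctionAlgebra k Γ →ₐ[k] FunctionAlgebra k Γ ⊗[k] FunctionAlgebra k Γ :=
  AlgHom.ofLinearMap
    { toFun := fun f => ∑ s : Γ, ∑ t : Γ, f (s * t) • (delta s ⊗ₜ[k] delta t)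
      map_add' := fun f g => by simp [add_eval, add_smul, Finset.sum_add_distrib]
      map_smul' := fun c f => by simp [smul_eval, mul_smul, Finset.smul_sum] }
    (by
      simp only [LinearMap.coe_mk, AddHom.coe_mk, one_eval, one_smul]
      simp_rw [← TensorProduct.tmul_sum, ← TensorProduct.sum_tmul, sum_delta]
      rfl)
    (fun f g => by
      classical
      simp only [LinearMap.coe_mk, AddHom.coe_mk, Finset.mul_sum, Finset.sum_mul]
      simp_rw [smul_mul_smul_comm, Algebra.TensorProduct.tmul_mul_tmul, mul_delta, delta_eval]
      simp [ite_smul, mul_eval, TensorProduct.ite_tmul, TensorProduct.tmul_ite, smul_ite])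

theorem comulHom_apply (f : FunctionAlgebra k Γ) :
    comulHom f = ∑ s : Γ, ∑ t : Γ, f (s * t) • (delta s ⊗ₜ[k] delta t) := rfl

/-- The counit `f ↦ f(1)`. -/
noncomputable def counitHom : FunctionAlgebra k Γ →ₐ[k] k :=
  AlgHom.ofLinearMap
    { toFun := fun f => f 1, map_add' := fun _ _ => rfl, map_smul' := fun _ _ => rfl } rfl
    fun _ _ => rfl

theorem counitHom_apply (f : FunctionAlgebra k Γ) : counitHom f = f 1 := rfl

theorem comulHom_delta (g : Γ) :
    comulHom (delta g : FunctionAlgebra k Γ) = ∑ s : Γ, delta s ⊗ₜ[k] delta (s⁻¹ * g) := by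
  classical
  rw [comulHom_apply]
  refine Finset.sum_congr rfl fun s _ => ?_
  simp [delta_eval, ite_smul, ← eq_inv_mul_iff_mul_eq]

/-- The bialgebra structure of `k^Γ`. -/
noncomputable instance : Bialgebra k (FunctionAlgebra k Γ) :=
  Bialgebra.ofAlgHom comulHom counitHom
    (by
      apply AlgHom.toLinearMap_injective
      apply linearMap_ext
      intro g
      simp only [AlgHom.toLinearMap_apply, AlgHom.comp_apply, comulHom_delta, map_sum,
        Algebra.TensorProduct.map_tmul, AlgHom.coe_id, id, TensorProduct.sum_tmul,
        TensorProduct.tmul_sum]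
      simp only [AlgEquiv.coe_toAlgHom, Algebra.TensorProduct.assoc_tmul]
      rw [Finset.sum_comm]
      refine Finset.sum_congr rfl fun s _ => ?_
      refine Fintype.sum_equiv (Equiv.mulLeft s⁻¹) _ _ fun t => ?_
      simp [mul_assoc])
    (by
      classical
      apply AlgHom.toLinearMap_injective
      apply linearMap_ext
      intro g
      simp only [AlgHom.toLinearMap_apply, AlgHom.comp_apply, comulHom_delta, map_sum,
        Algebra.TensorProduct.map_tmul, AlgHom.coe_id, id, counitHom_apply, delta_eval,
        TensorProduct.ite_tmul]
      simp)
    (by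
      classical
      apply AlgHom.toLinearMap_injective
      apply linearMap_ext
      intro g
      simp only [AlgHom.toLinearMap_apply, AlgHom.comp_apply, comulHom_delta, map_sum,
        Algebra.TensorProduct.map_tmul, AlgHom.coe_id, id, counitHom_apply, delta_eval,
        TensorProduct.tmul_ite, eq_inv_mul_iff_mul_eq]
      simp)

theorem comul_eq (f : FunctionAlgebra k Γ) : Coalgebra.comul (R := k) f = comulHom f := rfl
theorem counit_eq (f : FunctionAlgebra k Γ) : Coalgebra.counit (R := k) f = f 1 := rfl

/-- The antipode `f ↦ (g ↦ f(g⁻¹))`. -/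
noncomputable def antipodeMap : FunctionAlgebra k Γ →ₗ[k] FunctionAlgebra k Γ where
  toFun := fun f g => f g⁻¹
  map_add' := fun _ _ => rfl
  map_smul' := fun _ _ => rfl

theorem antipodeMap_delta (g : Γ) :
    antipodeMap (delta g : FunctionAlgebra k Γ) = delta g⁻¹ := by
  classical
  funext h
  change (delta g : FunctionAlgebra k Γ) h⁻¹ = _
  simp [delta_eval, inv_eq_iff_eq_inv]

theorem delta_one_smul_one [DecidableEq Γ] (g : Γ) :
    algebraMap k (FunctionAlgebra k Γ) ((delta g : FunctionAlgebra k Γ) 1) =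
      if g = 1 then 1 else 0 := by
  rw [delta_eval]
  by_cases h : g = 1
  · simp [h]
  · simp [h, Ne.symm h]

/-- The Hopf algebra `k^Γ`. -/
noncomputable instance : HopfAlgebra k (FunctionAlgebra k Γ) where
  antipode := antipodeMap
  mul_antipode_rTensor_comul := by
    classical
    apply linearMap_ext
    intro g
    have h1 : ∀ s : Γ, s⁻¹ * g = s⁻¹ ↔ g = 1 := fun s => by simp
    simp only [LinearMap.comp_apply, comul_eq, comulHom_delta, map_sum, LinearMap.rTensor_tmul,
      LinearMap.mul'_apply, counit_eq, Algebra.linearMap_apply, delta_one_smul_one,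
      antipodeMap_delta, mul_delta]
    simp_rw [delta_eval, h1]
    split_ifs
    · simp only [one_smul]
      rw [← sum_delta]
      exact Fintype.sum_equiv (Equiv.inv Γ) _ _ fun s => by simp_all
    · simp
  mul_antipode_lTensor_comul := by
    classical
    apply linearMap_ext
    intro g
    have h1 : ∀ s : Γ, g⁻¹ * s = s ↔ g = 1 := fun s => by simp
    simp only [LinearMap.comp_apply, comul_eq, comulHom_delta, map_sum, LinearMap.lTensor_tmul,
      LinearMap.mul'_apply, counit_eq, Algebra.linearMap_apply, delta_one_smul_one,
      antipodeMap_delta, mul_delta, mul_inv_rev, inv_inv]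
    simp_rw [delta_eval, h1]
    split_ifs with h
    · subst h
      simp only [one_smul]
      rw [← sum_delta]
      exact Finset.sum_congr rfl fun s _ => by simp
    · simp

end FunctionAlgebra

/-- Multiplicity-free fusion data over a field: a set `S` of simple objects with a unit, a relation
`N a b c` saying that `c` occurs (once) in `a ⊗ b`, and associativity symbols `F a b c d e f`, the
entry of the associator `(a ⊗ b) ⊗ c → a ⊗ (b ⊗ c)` at the summand `d` between the channel
`d ⊆ e ⊗ c`, `e ⊆ a ⊗ b` and the channel `d ⊆ a ⊗ f`, `f ⊆ b ⊗ c`. -/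
structure FusionSymbols (k : Type u) [Field k] (S : Type w) [Fintype S] where
  one : S
  N : S → S → S → Prop
  F : S → S → S → S → S → S → k
  Finv : S → S → S → S → S → S → k
  one_left : ∀ a b, N one a b ↔ b = a
  one_right : ∀ a b, N a one b ↔ b = a
  F_one : ∀ a b d, N a b d → F a one b d a b = 1
  F_Finv : ∀ a b c d e e', N a b e → N e c d → N a b e' → N e' c d →
    open Classical in
    (∑ f, if N b c f ∧ N a f d then F a b c d e f * Finv a b c d e' f else 0) =
      if e = e' then 1 else 0
  Finv_F : ∀ a b c d f f', N b c f → N a f d → N b c f' → N a f' d →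
    open Classical in
    (∑ e, if N a b e ∧ N e c d then Finv a b c d e f * F a b c d e f' else 0) =
      if f = f' then 1 else 0
  pentagon : ∀ w x y z e p q f s, N w x e → N e y p → N p z q → N y z f → N x f s → N w s q →
    open Classical in
    (∑ t, if N x y t ∧ N w t p ∧ N t z s then
      F w x y p e t * F w t z q p s * F x y z s t f else 0) =
      if N e f q then F e y z q p f * F w x f q e s else 0

/-- The category of finite direct sums of simple objects from `S`: an object is a finite family
of labels in `S`. -/
structure FusionCat {k : Type u} [Field k] {S : Type w} [Fintype S]
    (d : FusionSymbols k S) where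
  ι : Type w
  [fintype : Fintype ι]
  label : ι → S

namespace FusionCat

attribute [instance] fintype

variable {k : Type u} [Field k] {S : Type w} [Fintype S] {d : FusionSymbols k S}

open Classical in
/-- `Hom(s, s)` is `k` and `Hom(s, s')` is `0` for simple objects `s ≠ s'`: a morphism of direct
sums is a matrix whose entries between different simple objects vanish. -/
@[ext]
structure Hom (X Y : FusionCat d) where
  mat : X.ι → Y.ι → k
  supp : ∀ i j, X.label i ≠ Y.label j → mat i j = 0

open Classical in
noncomputable instance : Category (FusionCat d) where
  Hom X Y := Hom X Y
  id X := ⟨fun i j => if i = j then 1 else 0, fun i j h => by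
    rw [if_neg]; rintro rfl; exact h rfl⟩
  comp {X Y Z} f g := ⟨fun i j => ∑ l, f.mat i l * g.mat l j, fun i j h => by
    refine Finset.sum_eq_zero fun l _ => ?_
    by_cases h1 : X.label i = Y.label l
    · rw [g.supp l j (h1 ▸ h), mul_zero]
    · rw [f.supp i l h1, zero_mul]⟩
  id_comp f := by apply Hom.ext; funext i j; simp
  comp_id f := by apply Hom.ext; funext i j; simp
  assoc f g h := by
    apply Hom.ext; funext i j
    simp only [Finset.sum_mul, Finset.mul_sum, mul_assoc]
    exact Finset.sum_comm

theorem hom_ext {X Y : FusionCat d} {f g : X ⟶ Y} (h : ∀ i j, f.mat i j = g.mat i j) : f = g :=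
  Hom.ext (funext fun i => funext fun j => h i j)

open Classical in
@[simp] theorem id_mat (X : FusionCat d) (i j : X.ι) :
    (𝟙 X : X ⟶ X).mat i j = if i = j then 1 else 0 := rfl

@[simp] theorem comp_mat {X Y Z : FusionCat d} (f : X ⟶ Y) (g : Y ⟶ Z) (i : X.ι) (j : Z.ι) :
    (f ≫ g).mat i j = ∑ l, f.mat i l * g.mat l j := rfl

/-- The summands of the tensor product of two direct sums: one summand `out` for every pair of
summands `fst` and `snd` and every simple object `out` in `fst ⊗ snd`. -/
@[ext]
structure Chan (X Y : FusionCat d) where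
  fst : X.ι
  snd : Y.ι
  out : S
  adm : d.N (X.label fst) (Y.label snd) out

open Classical in
/-- The summands of a tensor product as a subtype. -/
def Chan.equiv (X Y : FusionCat d) :
    Chan X Y ≃ {p : X.ι × Y.ι × S // d.N (X.label p.1) (Y.label p.2.1) p.2.2} where
  toFun p := ⟨(p.fst, p.snd, p.out), p.adm⟩
  invFun p := ⟨p.1.1, p.1.2.1, p.1.2.2, p.2⟩
  left_inv _ := rfl
  right_inv _ := rfl

open Classical in
noncomputable instance (X Y : FusionCat d) : Fintype (Chan X Y) :=
  Fintype.ofEquiv _ (Chan.equiv X Y).symm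

/-- The tensor product of direct sums. -/
@[reducible]
noncomputable def tensor (X Y : FusionCat d) : FusionCat d where
  ι := Chan X Y
  label p := p.out

/-- The unit object. -/
@[reducible]
def unit (d : FusionSymbols k S) : FusionCat d where
  ι := PUnit
  label _ := d.one

open Classical in
theorem sum_collapse {U T M : Type*} [Fintype U] [Fintype T] [AddCommMonoid M] (P : T → Prop)
    [DecidablePred P] (mk : ∀ t, P t → U) (proj : U → T) (hproj : ∀ t h, proj (mk t h) = t) (φ : U → M)
    (hφ : ∀ u, φ u ≠ 0 → ∃ h : P (proj u), mk (proj u) h = u) :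
    ∑ u, φ u = ∑ t, if h : P t then φ (mk t h) else 0 := by
  rw [← Finset.sum_fiberwise Finset.univ proj φ]
  refine Finset.sum_congr rfl fun t _ => ?_
  split_ifs with h
  · rw [Finset.sum_eq_single (mk t h)]
    · intro u hu hne
      by_contra h0
      obtain ⟨h1, h2⟩ := hφ u h0
      simp only [Finset.mem_filter, Finset.mem_univ, true_and] at hu
      subst hu
      exact hne h2.symm
    · intro h0
      simp [hproj] at h0
  · refine Finset.sum_eq_zero fun u hu => ?_
    by_contra h0
    obtain ⟨h1, h2⟩ := hφ u h0
    simp only [Finset.mem_filter, Finset.mem_univ, true_and] at hu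
    exact h (hu ▸ h1)

open Classical in
theorem sum_chan {X Y : FusionCat d} {M : Type*} [AddCommMonoid M] (φ : Chan X Y → M) :
    ∑ p, φ p = ∑ i, ∑ j, ∑ c, if h : d.N (X.label i) (Y.label j) c then φ ⟨i, j, c, h⟩ else 0 := by
  rw [Fintype.sum_equiv (Chan.equiv X Y) φ (fun p => φ ((Chan.equiv X Y).symm p)) (fun _ => rfl)]
  simp_rw [← Fintype.sum_prod_type']
  exact sum_collapse (U := {p : X.ι × Y.ι × S // d.N (X.label p.1) (Y.label p.2.1) p.2.2})
    (fun p : X.ι × Y.ι × S => d.N (X.label p.1) (Y.label p.2.1) p.2.2)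
    (fun p h => ⟨p, h⟩) Subtype.val (fun _ _ => rfl) (fun p => φ ((Chan.equiv X Y).symm p))
    fun u _ => ⟨u.2, rfl⟩

open Classical in
/-- The tensor product of morphisms. -/
noncomputable def tensorMap {X X' Y Y' : FusionCat d} (f : X ⟶ X') (g : Y ⟶ Y') :
    tensor X Y ⟶ tensor X' Y' :=
  ⟨fun p q => if p.out = q.out then f.mat p.fst q.fst * g.mat p.snd q.snd else 0,
    fun _ _ h => if_neg h⟩

open Classical in
theorem tensorMap_mat {X X' Y Y' : FusionCat d} (f : X ⟶ X') (g : Y ⟶ Y') (p : Chan X Y)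
    (q : Chan X' Y') : (tensorMap f g).mat p q =
      if p.out = q.out then f.mat p.fst q.fst * g.mat p.snd q.snd else 0 := rfl

theorem tensorMap_id (X Y : FusionCat d) : tensorMap (𝟙 X) (𝟙 Y) = 𝟙 (tensor X Y) := by
  apply hom_ext
  rintro ⟨i, j, c, h⟩ ⟨i', j', c', h'⟩
  simp only [tensorMap_mat, id_mat, Chan.mk.injEq]
  by_cases h1 : i = i' <;> by_cases h2 : j = j' <;> by_cases h3 : c = c' <;> simp [h1, h2, h3]

theorem tensorMap_comp {X X' X'' Y Y' Y'' : FusionCat d} (f : X ⟶ X') (f' : X' ⟶ X'')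
    (g : Y ⟶ Y') (g' : Y' ⟶ Y'') :
    tensorMap f g ≫ tensorMap f' g' = tensorMap (f ≫ f') (g ≫ g') := by
  classical
  apply hom_ext
  intro p q
  rw [comp_mat, tensorMap_mat, sum_chan]
  simp only [tensorMap_mat, comp_mat]
  have key : ∀ i j, (∑ c, if d.N (X'.label i) (Y'.label j) c then
      (if p.out = c then f.mat p.fst i * g.mat p.snd j else 0) *
        (if c = q.out then f'.mat i q.fst * g'.mat j q.snd else 0) else 0) =
      if p.out = q.out then f.mat p.fst i * g.mat p.snd j * (f'.mat i q.fst * g'.mat j q.snd)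
        else 0 := by
    intro i j
    rw [Finset.sum_eq_single p.out]
    · by_cases hN : d.N (X'.label i) (Y'.label j) p.out
      · simp [hN]
      · rw [if_neg hN]
        have : f.mat p.fst i * g.mat p.snd j = 0 := by
          by_cases h1 : X.label p.fst = X'.label i
          · by_cases h2 : Y.label p.snd = Y'.label j
            · exact absurd (h1 ▸ h2 ▸ p.adm) hN
            · rw [g.supp _ _ h2, mul_zero]
          · rw [f.supp _ _ h1, zero_mul]
        simp [this]
    · intro c _ hc
      simp [Ne.symm hc]
    · simp
  simp only [dite_eq_ite, key]
  split_ifs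
  · rw [Finset.sum_mul_sum]
    refine Finset.sum_congr rfl fun i _ => Finset.sum_congr rfl fun j _ => by ring
  · simp

open Classical in
/-- The associativity constraint as a matrix with the entries `F`. -/
noncomputable def assocHom (X Y Z : FusionCat d) :
    tensor (tensor X Y) Z ⟶ tensor X (tensor Y Z) :=
  ⟨fun p q =>
    if p.fst.fst = q.fst ∧ p.fst.snd = q.snd.fst ∧ p.snd = q.snd.snd ∧ p.out = q.out then
      d.F (X.label q.fst) (Y.label q.snd.fst) (Z.label q.snd.snd) q.out p.fst.out q.snd.out
    else 0, fun _ _ h => if_neg fun h' => h h'.2.2.2⟩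

open Classical in
/-- The inverse of the associativity constraint. -/
noncomputable def assocInv (X Y Z : FusionCat d) :
    tensor X (tensor Y Z) ⟶ tensor (tensor X Y) Z :=
  ⟨fun q p =>
    if p.fst.fst = q.fst ∧ p.fst.snd = q.snd.fst ∧ p.snd = q.snd.snd ∧ p.out = q.out then
      d.Finv (X.label q.fst) (Y.label q.snd.fst) (Z.label q.snd.snd) q.out p.fst.out q.snd.out
    else 0, fun _ _ h => if_neg fun h' => h h'.2.2.2.symm⟩

open Classical in
theorem assocHom_mat (X Y Z : FusionCat d) (p : Chan (tensor X Y) Z) (q : Chan X (tensor Y Z)) :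
    (assocHom X Y Z).mat p q =
    if p.fst.fst = q.fst ∧ p.fst.snd = q.snd.fst ∧ p.snd = q.snd.snd ∧ p.out = q.out then
      d.F (X.label q.fst) (Y.label q.snd.fst) (Z.label q.snd.snd) q.out p.fst.out q.snd.out
    else 0 := rfl

open Classical in
theorem assocInv_mat (X Y Z : FusionCat d) (p : Chan (tensor X Y) Z) (q : Chan X (tensor Y Z)) :
    (assocInv X Y Z).mat q p =
    if p.fst.fst = q.fst ∧ p.fst.snd = q.snd.fst ∧ p.snd = q.snd.snd ∧ p.out = q.out then
      d.Finv (X.label q.fst) (Y.label q.snd.fst) (Z.label q.snd.snd) q.out p.fst.out q.snd.out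
    else 0 := rfl

open Classical in
theorem sum_left {X Y Z : FusionCat d} {M : Type*} [AddCommMonoid M] (i : X.ι) (j : Y.ι) (l : Z.ι)
    (x : S) (φ : Chan (tensor X Y) Z → M)
    (hφ : ∀ p, φ p ≠ 0 → p.fst.fst = i ∧ p.fst.snd = j ∧ p.snd = l ∧ p.out = x) :
    ∑ p, φ p = ∑ e, if h : d.N (X.label i) (Y.label j) e ∧ d.N e (Z.label l) x then
      φ ⟨⟨i, j, e, h.1⟩, l, x, h.2⟩ else 0 := by
  refine sum_collapse (fun e => d.N (X.label i) (Y.label j) e ∧ d.N e (Z.label l) x)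
    (fun e h => ⟨⟨i, j, e, h.1⟩, l, x, h.2⟩) (fun p => p.fst.out) (fun _ _ => rfl) φ ?_
  rintro ⟨⟨i', j', e, h1⟩, l', x', h2⟩ h
  obtain ⟨rfl, rfl, rfl, rfl⟩ := hφ _ h
  exact ⟨⟨h1, h2⟩, rfl⟩

open Classical in
theorem sum_right {X Y Z : FusionCat d} {M : Type*} [AddCommMonoid M] (i : X.ι) (j : Y.ι)
    (l : Z.ι) (x : S) (φ : Chan X (tensor Y Z) → M)
    (hφ : ∀ p, φ p ≠ 0 → i = p.fst ∧ j = p.snd.fst ∧ l = p.snd.snd ∧ x = p.out) :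
    ∑ p, φ p = ∑ f, if h : d.N (Y.label j) (Z.label l) f ∧ d.N (X.label i) f x then
      φ ⟨i, ⟨j, l, f, h.1⟩, x, h.2⟩ else 0 := by
  refine sum_collapse (fun f => d.N (Y.label j) (Z.label l) f ∧ d.N (X.label i) f x)
    (fun f h => ⟨i, ⟨j, l, f, h.1⟩, x, h.2⟩) (fun p => p.snd.out) (fun _ _ => rfl) φ ?_
  rintro ⟨i', ⟨j', l', f, h1⟩, x', h2⟩ h
  obtain ⟨rfl, rfl, rfl, rfl⟩ := hφ _ h
  exact ⟨⟨h1, h2⟩, rfl⟩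

open Classical in
theorem sum_mid {W X Y Z : FusionCat d} {M : Type*} [AddCommMonoid M] (i : W.ι) (j : X.ι)
    (m : Y.ι) (l : Z.ι) (y x : S) (φ : Chan (tensor W (tensor X Y)) Z → M)
    (hφ : ∀ p, φ p ≠ 0 → i = p.fst.fst ∧ j = p.fst.snd.fst ∧ m = p.fst.snd.snd ∧ y = p.fst.out ∧
      l = p.snd ∧ x = p.out) :
    ∑ p, φ p = ∑ t, if h : d.N (X.label j) (Y.label m) t ∧ d.N (W.label i) t y ∧
        d.N y (Z.label l) x then
      φ ⟨⟨i, ⟨j, m, t, h.1⟩, y, h.2.1⟩, l, x, h.2.2⟩ else 0 := by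
  refine sum_collapse (fun t => d.N (X.label j) (Y.label m) t ∧ d.N (W.label i) t y ∧
        d.N y (Z.label l) x)
    (fun t h => ⟨⟨i, ⟨j, m, t, h.1⟩, y, h.2.1⟩, l, x, h.2.2⟩) (fun p => p.fst.snd.out)
    (fun _ _ => rfl) φ ?_
  rintro ⟨⟨i', ⟨j', m', t, h1⟩, y', h2⟩, l', x', h3⟩ h
  obtain ⟨rfl, rfl, rfl, rfl, rfl, rfl⟩ := hφ _ h
  exact ⟨⟨h1, h2, h3⟩, rfl⟩

theorem hom_inv (X Y Z : FusionCat d) : assocHom X Y Z ≫ assocInv X Y Z = 𝟙 _ := by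
  classical
  apply hom_ext
  rintro ⟨⟨i, j, e, h1⟩, l, x, h2⟩ ⟨⟨i', j', e', h1'⟩, l', x', h2'⟩
  rw [comp_mat, sum_right i j l x]
  · simp only [assocHom_mat, assocInv_mat, id_mat, Chan.mk.injEq]
    by_cases hi : i' = i ∧ j' = j ∧ l' = l ∧ x' = x
    · obtain ⟨rfl, rfl, rfl, rfl⟩ := hi
      simpa using d.F_Finv _ _ _ _ e e' h1 h2 h1' h2'
    · rw [if_neg (by rintro ⟨⟨rfl, rfl, rfl⟩, rfl, rfl⟩; exact hi ⟨rfl, rfl, rfl, rfl⟩)]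
      simp [hi]
  · intro q hq
    have := left_ne_zero_of_mul hq
    rw [assocHom_mat] at this
    by_contra h0
    exact this (if_neg h0)

theorem inv_hom (X Y Z : FusionCat d) : assocInv X Y Z ≫ assocHom X Y Z = 𝟙 _ := by
  classical
  apply hom_ext
  rintro ⟨i, ⟨j, l, f, h1⟩, x, h2⟩ ⟨i', ⟨j', l', f', h1'⟩, x', h2'⟩
  rw [comp_mat, sum_left i j l x]
  · simp only [assocHom_mat, assocInv_mat, id_mat, Chan.mk.injEq]
    by_cases hi : i = i' ∧ j = j' ∧ l = l' ∧ x = x'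
    · obtain ⟨rfl, rfl, rfl, rfl⟩ := hi
      simpa using d.Finv_F _ _ _ _ f f' h1 h2 h1' h2'
    · rw [if_neg (by rintro ⟨rfl, ⟨rfl, rfl, rfl⟩, rfl⟩; exact hi ⟨rfl, rfl, rfl, rfl⟩)]
      simp [hi]
  · intro q hq
    have := left_ne_zero_of_mul hq
    rw [assocInv_mat] at this
    by_contra h0
    exact this (if_neg h0)

/-- The associativity constraint. -/
noncomputable def assoc (X Y Z : FusionCat d) :
    tensor (tensor X Y) Z ≅ tensor X (tensor Y Z) where
  hom := assocHom X Y Z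
  inv := assocInv X Y Z
  hom_inv_id := hom_inv X Y Z
  inv_hom_id := inv_hom X Y Z

theorem assoc_natural {X X' Y Y' Z Z' : FusionCat d} (f : X ⟶ X') (g : Y ⟶ Y') (h : Z ⟶ Z') :
    tensorMap (tensorMap f g) h ≫ assocHom X' Y' Z' =
      assocHom X Y Z ≫ tensorMap f (tensorMap g h) := by
  classical
  apply hom_ext
  rintro ⟨⟨i, j, e, h1⟩, l, x, h2⟩ ⟨i', ⟨j', l', e', h1'⟩, x', h2'⟩
  rw [comp_mat, comp_mat, sum_left i' j' l' x', sum_right i j l x]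
  · simp only [assocHom_mat, tensorMap_mat]
    by_cases hx : x = x'
    · subst hx
      by_cases hf : X.label i = X'.label i'
      · by_cases hg : Y.label j = Y'.label j'
        · by_cases hh : Z.label l = Z'.label l'
          · rw [Finset.sum_eq_single e, Finset.sum_eq_single e']
            · have h3 := h1
              have h4 := h2
              have h3' := h1'
              have h4' := h2'
              simp only [hf, hg, hh] at h3 h4
              simp only [← hf, ← hg, ← hh] at h3' h4'
              rw [dif_pos ⟨h3, h4⟩, dif_pos ⟨h3', h4'⟩]
              simp [hf, hg, hh]
              ring
            · intro b _ hb
              simp [hb]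
            · simp
            · intro b _ hb
              simp [hb.symm]
            · simp
          · simp [h.supp l l' hh]
        · simp [g.supp j j' hg]
      · simp [f.supp i i' hf]
    · simp [hx]
  · intro q hq
    have := left_ne_zero_of_mul hq
    rw [assocHom_mat] at this
    by_contra h0
    exact this (if_neg h0)
  · intro q hq
    have := right_ne_zero_of_mul hq
    rw [assocHom_mat] at this
    by_contra h0
    exact this (if_neg h0)

open Classical in
theorem assoc_whisker_mat (W X Y Z : FusionCat d) (u : Chan (tensor W (tensor X Y)) Z)
    (q : Chan W (tensor X (tensor Y Z))) :
    (assocHom W (tensor X Y) Z ≫ tensorMap (𝟙 W) (assocHom X Y Z)).mat u q =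
      if u.fst.fst = q.fst ∧ u.fst.snd.fst = q.snd.fst ∧ u.fst.snd.snd = q.snd.snd.fst ∧
          u.snd = q.snd.snd.snd ∧ u.out = q.out ∧
          d.N u.fst.snd.out (Z.label u.snd) q.snd.out then
        d.F (W.label q.fst) u.fst.snd.out (Z.label q.snd.snd.snd) q.out u.fst.out q.snd.out *
        d.F (X.label q.snd.fst) (Y.label q.snd.snd.fst) (Z.label q.snd.snd.snd) q.snd.out
          u.fst.snd.out q.snd.snd.out
      else 0 := by
  obtain ⟨⟨i, ⟨j, m, t, h1⟩, y, h2⟩, l, x, h3⟩ := u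
  obtain ⟨i', ⟨j', ⟨m', l', f, h1'⟩, s, h2'⟩, x', h3'⟩ := q
  rw [comp_mat, sum_right (Y := tensor X Y) i ⟨j, m, t, h1⟩ l x]
  · simp only [assocHom_mat, tensorMap_mat, id_mat]
    rw [Finset.sum_eq_single s]
    · by_cases hi : i = i' ∧ j = j' ∧ m = m' ∧ l = l' ∧ x = x'
      · obtain ⟨rfl, rfl, rfl, rfl, rfl⟩ := hi
        simp [h3']
      · have hi1 : ¬ (i = i' ∧ j = j' ∧ m = m' ∧ l = l' ∧ x = x' ∧ d.N t (Z.label l) s) :=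
          fun h => hi ⟨h.1, h.2.1, h.2.2.1, h.2.2.2.1, h.2.2.2.2.1⟩
        simp only [hi1, if_false]
        split_ifs <;> simp_all
    · intro b _ hb
      simp [hb]
    · simp
  · intro v hv
    have := left_ne_zero_of_mul hv
    rw [assocHom_mat] at this
    by_contra h0
    exact this (if_neg h0)

theorem assoc_pentagon (W X Y Z : FusionCat d) :
    tensorMap (assocHom W X Y) (𝟙 Z) ≫ assocHom W (tensor X Y) Z ≫
      tensorMap (𝟙 W) (assocHom X Y Z) =
    assocHom (tensor W X) Y Z ≫ assocHom W X (tensor Y Z) := by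
  classical
  apply hom_ext
  rintro ⟨⟨⟨i, j, e, h1⟩, m, y, h2⟩, l, x, h3⟩ ⟨i', ⟨j', ⟨m', l', f, h1'⟩, s, h2'⟩, x', h3'⟩
  rw [comp_mat, comp_mat, sum_mid i j m l y x,
    sum_right (X := tensor W X) ⟨i, j, e, h1⟩ m l x]
  · simp only [assoc_whisker_mat, assocHom_mat, tensorMap_mat, id_mat]
    by_cases hi : i = i' ∧ j = j' ∧ m = m' ∧ l = l' ∧ x = x'
    · obtain ⟨rfl, rfl, rfl, rfl, rfl⟩ := hi
      symm
      rw [Finset.sum_eq_single (a := f)]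
      · have := d.pentagon _ _ _ _ e y x f s h1 h2 h3 h1' h2' h3'
        simp only [h3, h1', and_true, true_and] at this ⊢
        simp only [dite_eq_ite]
        simp only [if_true] at this ⊢
        refine Eq.trans ?_ (this.symm.trans ?_)
        · by_cases hN : d.N e f x <;> simp [hN]
        refine Finset.sum_congr rfl fun t _ => ?_
        by_cases hN : d.N (X.label j) (Y.label m) t ∧ d.N (W.label i) t y
        · by_cases hN' : d.N t (Z.label l) s
          · simp [hN, hN', mul_assoc]
          · simp [hN, hN']
        · rw [if_neg hN, if_neg (fun h => hN ⟨h.1, h.2.1⟩)]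
      · intro b _ hb
        simp [hb]
      · simp
    · have hi1 : ∀ b, ¬ (i = i' ∧ j = j' ∧ m = m' ∧ l = l' ∧ x = x' ∧ d.N b (Z.label l) s) :=
        fun b h => hi ⟨h.1, h.2.1, h.2.2.1, h.2.2.2.1, h.2.2.2.2.1⟩
      simp only [hi1, if_false, mul_zero, dite_eq_ite, ite_self, Finset.sum_const_zero]
      symm
      refine Finset.sum_eq_zero fun b _ => ?_
      split_ifs with h0 h5 h4
      · obtain ⟨h6, h7, h8, h9⟩ := h4
        rw [Chan.mk.injEq] at h8
        exact absurd ⟨h6, h7, h8.1, h8.2.1, h9⟩ hi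
      · simp
      · simp
      · simp
      · rfl
  · intro v hv
    have := left_ne_zero_of_mul hv
    rw [assocHom_mat] at this
    by_contra h0
    exact this (if_neg h0)
  · intro v hv
    have := left_ne_zero_of_mul hv
    rw [tensorMap_mat] at this
    by_contra h0
    apply this
    simp only [assocHom_mat, id_mat]
    split_ifs <;> simp_all

open Classical in
/-- The left unit constraint. -/
noncomputable def lunit (X : FusionCat d) : tensor (unit d) X ≅ X where
  hom := ⟨fun p j => if p.snd = j then 1 else 0, fun p j h => by
    rw [if_neg]; rintro rfl; exact h ((d.one_left _ _).1 p.adm)⟩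
  inv := ⟨fun j p => if p.snd = j then 1 else 0, fun j p h => by
    rw [if_neg]; rintro rfl; exact h ((d.one_left _ _).1 p.adm).symm⟩
  hom_inv_id := by
    apply hom_ext
    rintro ⟨u, i, c, h⟩ ⟨u', i', c', h'⟩
    have h1 := (d.one_left _ _).1 h
    have h2 := (d.one_left _ _).1 h'
    rw [comp_mat, id_mat]
    simp only [Chan.mk.injEq]
    subst h1 h2
    by_cases hi : i = i' <;> simp [hi]
  inv_hom_id := by
    apply hom_ext
    intro i j
    rw [comp_mat, sum_chan]
    by_cases hi : i = j <;> simp [d.one_left, hi, eq_comm]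

open Classical in
/-- The right unit constraint. -/
noncomputable def runit (X : FusionCat d) : tensor X (unit d) ≅ X where
  hom := ⟨fun p j => if p.fst = j then 1 else 0, fun p j h => by
    rw [if_neg]; rintro rfl; exact h ((d.one_right _ _).1 p.adm)⟩
  inv := ⟨fun j p => if p.fst = j then 1 else 0, fun j p h => by
    rw [if_neg]; rintro rfl; exact h ((d.one_right _ _).1 p.adm).symm⟩
  hom_inv_id := by
    apply hom_ext
    rintro ⟨i, u, c, h⟩ ⟨i', u', c', h'⟩
    have h1 := (d.one_right _ _).1 h
    have h2 := (d.one_right _ _).1 h'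
    rw [comp_mat, id_mat]
    simp only [Chan.mk.injEq]
    subst h1 h2
    by_cases hi : i = i' <;> simp [hi]
  inv_hom_id := by
    apply hom_ext
    intro i j
    rw [comp_mat, sum_chan]
    by_cases hi : i = j <;> simp [d.one_right, hi, eq_comm]

theorem lunit_natural {X Y : FusionCat d} (f : X ⟶ Y) :
    tensorMap (𝟙 (unit d)) f ≫ (lunit Y).hom = (lunit X).hom ≫ f := by
  classical
  apply hom_ext
  rintro ⟨u, i, c, h⟩ j
  have h1 := (d.one_left _ _).1 h
  subst h1
  rw [comp_mat, comp_mat, sum_chan]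
  simp [tensorMap_mat, lunit, d.one_left]
  intro hij
  exact (f.supp _ _ hij).symm

theorem runit_natural {X Y : FusionCat d} (f : X ⟶ Y) :
    tensorMap f (𝟙 (unit d)) ≫ (runit Y).hom = (runit X).hom ≫ f := by
  classical
  apply hom_ext
  rintro ⟨i, u, c, h⟩ j
  have h1 := (d.one_right _ _).1 h
  subst h1
  rw [comp_mat, comp_mat, sum_chan]
  simp [tensorMap_mat, runit, d.one_right]
  intro hij
  exact (f.supp _ _ hij).symm

theorem unit_triangle (X Y : FusionCat d) :
    assocHom X (unit d) Y ≫ tensorMap (𝟙 X) (lunit Y).hom = tensorMap (runit X).hom (𝟙 Y) := by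
  classical
  apply hom_ext
  rintro ⟨⟨i, u, e, h1⟩, l, x, h2⟩ ⟨i', l', x', h3⟩
  have h4 := (d.one_right _ _).1 h1
  subst h4
  rw [comp_mat, sum_right i u l x]
  · simp only [tensorMap_mat, runit, lunit, d.one_left, assocHom_mat, id_mat]
    rw [Finset.sum_eq_single (Y.label l)]
    · have h5 : d.N (X.label i) (Y.label l) x := h2
      rw [dif_pos ⟨rfl, h5⟩]
      simp only [d.F_one _ _ _ h5, true_and, and_true, if_true, mul_one, one_mul]
    · intro b _ hb
      simp [hb]
    · simp
  · intro v hv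
    have := left_ne_zero_of_mul hv
    rw [assocHom_mat] at this
    by_contra h0
    exact this (if_neg h0)

noncomputable instance : MonoidalCategoryStruct (FusionCat d) where
  tensorObj := tensor
  tensorHom f g := tensorMap f g
  whiskerLeft X _ _ f := tensorMap (𝟙 X) f
  whiskerRight f Y := tensorMap f (𝟙 Y)
  tensorUnit := unit d
  associator := assoc
  leftUnitor := lunit
  rightUnitor := runit

/-- The monoidal category defined by the fusion symbols. -/
noncomputable instance : MonoidalCategory (FusionCat d) where
  tensorHom_def {X₁ Y₁ X₂ Y₂} f g :=
    ((tensorMap_comp f (𝟙 Y₁) (𝟙 X₂) g).trans (by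
      rw [Category.comp_id, Category.id_comp]; rfl)).symm
  id_tensorHom_id := tensorMap_id
  tensorHom_comp_tensorHom f f' g g' := tensorMap_comp f g f' g'
  whiskerLeft_id := tensorMap_id
  id_whiskerRight := tensorMap_id
  associator_naturality := assoc_natural
  leftUnitor_naturality := lunit_natural
  rightUnitor_naturality := runit_natural
  pentagon := assoc_pentagon
  triangle := unit_triangle

end FusionCat

/-- The data `(G, χ, r)` of Tambara and Yamagami: a nondegenerate symmetric bicharacter `χ` of the
finite abelian group `G`, and a square root `r` of the order of `G`. -/
structure TambaraYamagamiData (k : Type u) [Field k] (G : Type w) [CommGroup G] [Fintype G] where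
  χ : G →* G →* kˣ
  symm : ∀ a b, χ a b = χ b a
  nondegenerate : ∀ a, (∀ b, χ a b = 1) → a = 1
  r : k
  r_sq : r ^ 2 = (Fintype.card G : k)

/-- The simple objects of a Tambara–Yamagami category: the elements of `G`, and one more, `m`. -/
inductive TYSimple (G : Type w) : Type w where
  | grp : G → TYSimple G
  | m : TYSimple G

namespace TYSimple

variable {G : Type w}

/-- Simple objects as `Option G`, with `none` for `m`. -/
def equivOption (G : Type w) : Option G ≃ TYSimple G where
  toFun := fun x => match x with
    | some g => grp g
    | none => m
  invFun := fun x => match x with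
    | grp g => some g
    | m => none
  left_inv := by rintro (_ | g) <;> rfl
  right_inv := by rintro (g | _) <;> rfl

instance [Fintype G] : Fintype (TYSimple G) := Fintype.ofEquiv _ (equivOption G)

theorem sum_eq [Fintype G] {M : Type*} [AddCommMonoid M] (f : TYSimple G → M) :
    ∑ x, f x = (∑ g, f (grp g)) + f m := by
  rw [← Fintype.sum_equiv (equivOption G) (fun x => f (equivOption G x)) f (fun _ => rfl),
    Fintype.sum_option, add_comm]
  rfl

/-- The fusion rules `g ⊗ h = gh`, `g ⊗ m = m ⊗ g = m`, `m ⊗ m = ⊕_{g ∈ G} g`: the statement that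
the third simple object is a summand of the tensor product of the first two. -/
def Fusion [Mul G] : TYSimple G → TYSimple G → TYSimple G → Prop
  | grp g, grp h, grp l => l = g * h
  | grp _, m, m => True
  | m, grp _, m => True
  | m, m, grp _ => True
  | _, _, _ => False

end TYSimple

namespace TambaraYamagamiData

open TYSimple

variable {k : Type u} [Field k] {G : Type w} [CommGroup G] [Fintype G]
  (D : TambaraYamagamiData k G)

/-- The associativity constraint of `C(G, χ, r)`. It is `χ(g, h)` on `(g ⊗ m) ⊗ h`; on
`(m ⊗ g) ⊗ m = ⊕_d d` it is `⊕_d χ(g, d)`; on `(m ⊗ m) ⊗ m = ⊕_e m → ⊕_f m = m ⊗ (m ⊗ m)` it is the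
matrix `(r⁻¹ χ(e, f)⁻¹)`; all other constraints between simple objects are identities. -/
def F : TYSimple G → TYSimple G → TYSimple G → TYSimple G → TYSimple G → TYSimple G → k
  | grp g, m, grp h, _, _, _ => D.χ g h
  | m, grp g, m, grp d, _, _ => D.χ g d
  | m, m, m, _, grp e, grp f => D.r⁻¹ * ((D.χ e f)⁻¹ : kˣ)
  | _, _, _, _, _, _ => 1

/-- The entries of the inverse of the associativity constraint. -/
def Finv : TYSimple G → TYSimple G → TYSimple G → TYSimple G → TYSimple G → TYSimple G → k
  | grp g, m, grp h, _, _, _ => ((D.χ g h)⁻¹ : kˣ)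
  | m, grp g, m, grp d, _, _ => ((D.χ g d)⁻¹ : kˣ)
  | m, m, m, _, grp e, grp f => D.r⁻¹ * D.χ e f
  | _, _, _, _, _, _ => 1

theorem r_ne_zero [CharZero k] : D.r ≠ 0 := by
  intro h
  have := D.r_sq
  rw [h, zero_pow two_ne_zero] at this
  exact Fintype.card_ne_zero (α := G) (by exact_mod_cast this.symm)

open Classical in
/-- Orthogonality of characters. -/
theorem sum_χ (a : G) : ∑ b, ((D.χ a b : kˣ) : k) = if a = 1 then (Fintype.card G : k) else 0 := by
  split_ifs with h
  · subst h; simp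
  · obtain ⟨c, hc⟩ : ∃ c, D.χ a c ≠ 1 := by
      by_contra h'
      push Not at h'
      exact h (D.nondegenerate a h')
    have h1 : ((D.χ a c : kˣ) : k) * ∑ b, ((D.χ a b : kˣ) : k) = ∑ b, ((D.χ a b : kˣ) : k) := by
      rw [Finset.mul_sum]
      exact Fintype.sum_equiv (Equiv.mulLeft c) _ _ fun b => by simp
    have h2 : (((D.χ a c : kˣ) : k) - 1) * ∑ b, ((D.χ a b : kˣ) : k) = 0 := by
      rw [sub_mul, h1, one_mul, sub_self]
    refine (mul_eq_zero.1 h2).resolve_left fun h3 => hc ?_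
    exact Units.ext (by simpa [sub_eq_zero] using h3)

theorem fusion_pentagon [CharZero k] (w x y z e p q f s : TYSimple G) (h1 : Fusion w x e)
    (h2 : Fusion e y p) (h3 : Fusion p z q) (h4 : Fusion y z f) (h5 : Fusion x f s)
    (h6 : Fusion w s q) :
    open Classical in
    (∑ t, if Fusion x y t ∧ Fusion w t p ∧ Fusion t z s then
      D.F w x y p e t * D.F w t z q p s * D.F x y z s t f else 0) =
      if Fusion e f q then D.F e y z q p f * D.F w x f q e s else 0 := by
  classical
  rw [sum_eq]
  rcases w with w | _ <;> rcases x with x | _ <;> rcases y with y | _ <;> rcases z with z | _ <;>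
  rcases e with e | _ <;> (try exact h1.elim) <;>
  rcases p with p | _ <;> (try exact h2.elim) <;>
  rcases f with f | _ <;> (try exact h4.elim) <;>
  rcases q with q | _ <;> (try exact h3.elim) <;>
  rcases s with s | _ <;> (try exact h5.elim) <;> (try exact h6.elim) <;>
  simp only [Fusion, F] at * <;> subst_vars <;> simp
  · rw [if_pos (by simp [mul_assoc])]
    norm_cast
    refine Finset.card_eq_one.2 ⟨x * y, ?_⟩
    ext t
    simp only [Finset.mem_filter, Finset.mem_univ, true_and, Finset.mem_singleton]
    exact ⟨fun h => h.1, by rintro rfl; simp [mul_assoc]⟩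
  · refine Finset.card_eq_one.2 ⟨x * y, ?_⟩
    ext t
    simp only [Finset.mem_filter, Finset.mem_univ, true_and, Finset.mem_singleton]
    exact ⟨fun h => h.1, by rintro rfl; simp [mul_assoc]⟩
  · rw [mul_assoc]
  · rw [D.symm]
  · refine Finset.card_eq_one.2 ⟨w⁻¹ * p, ?_⟩
    ext t
    simp only [Finset.mem_filter, Finset.mem_univ, true_and, Finset.mem_singleton]
    constructor
    · rintro ⟨rfl, -⟩
      simp
    · rintro rfl
      refine ⟨by simp, ?_⟩
      rw [mul_assoc, h6]
      simp
  · rw [Finset.sum_eq_single (w⁻¹ * p)]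
    · simp
      ring
    · intro b _ hb
      rw [if_neg]
      rintro rfl
      simp at hb
    · simp
  · refine Finset.card_eq_one.2 ⟨x * y, ?_⟩
    ext t
    simp only [Finset.mem_filter, Finset.mem_univ, true_and, Finset.mem_singleton]
    exact ⟨fun h => h.1, by rintro rfl; simp [mul_assoc]⟩
  · ring
  · rw [D.symm x p]
    field_simp
  · rw [mul_assoc]
  · field_simp
  · rw [Finset.sum_eq_single (s * z⁻¹)]
    · simp
      ring
    · intro b _ hb
      rw [if_neg]
      rintro rfl
      simp at hb
    · simp
  · have h7 : ∀ t, D.r⁻¹ * ((D.χ e t : kˣ) : k)⁻¹ * ((D.χ t q : kˣ) : k) *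
        (D.r⁻¹ * ((D.χ t f : kˣ) : k)⁻¹) =
          (D.r ^ 2)⁻¹ * ((D.χ (e⁻¹ * f⁻¹ * q) t : kˣ) : k) := by
      intro t
      rw [D.symm t q, D.symm t f]
      simp
      ring
    have h8 : (e⁻¹ * f⁻¹ * q = 1) ↔ q = e * f := by
      rw [← mul_inv, inv_mul_eq_one, eq_comm]
    have h9 : D.r ^ 2 ≠ 0 := pow_ne_zero 2 D.r_ne_zero
    simp_rw [h7]
    rw [← Finset.mul_sum, D.sum_χ, ← D.r_sq]
    simp only [h8]
    split_ifs
    · exact inv_mul_cancel₀ h9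
    · simp

/-- The fusion symbols of `C(G, χ, r)`. -/
noncomputable def fusionSymbols [CharZero k] : FusionSymbols k (TYSimple G) where
  one := grp 1
  N := Fusion
  F := D.F
  Finv := D.Finv
  one_left := by rintro (a | _) (b | _) <;> simp [Fusion]
  one_right := by rintro (a | _) (b | _) <;> simp [Fusion]
  F_one := by rintro (a | _) (b | _) (d | _) <;> simp [Fusion, F]
  F_Finv := by
    classical
    intro a b c d e e' h1 h2 h3 h4
    rw [sum_eq]
    rcases a with a | _ <;> rcases b with b | _ <;> rcases c with c | _ <;>
    rcases e with e | _ <;> (try exact h1.elim) <;>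
    rcases d with d | _ <;> (try exact h2.elim) <;>
    rcases e' with e' | _ <;> (try exact h3.elim) <;> (try exact h4.elim) <;>
    simp only [Fusion, F, Finv] at * <;> subst_vars <;> simp
    · refine Finset.card_eq_one.2 ⟨b * c, ?_⟩
      ext t
      simp only [Finset.mem_filter, Finset.mem_univ, true_and, Finset.mem_singleton]
      exact ⟨fun h => h.1, by rintro rfl; simp [mul_assoc]⟩
    · refine Finset.card_eq_one.2 ⟨a⁻¹ * d, ?_⟩
      ext t
      simp only [Finset.mem_filter, Finset.mem_univ, true_and, Finset.mem_singleton]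
      exact ⟨by rintro rfl; simp, by rintro rfl; simp⟩
    · exact mul_right_cancel h4
    · have h7 : ∀ t, D.r⁻¹ * ((D.χ e t : kˣ) : k)⁻¹ * (D.r⁻¹ * ((D.χ e' t : kˣ) : k)) =
          (D.r ^ 2)⁻¹ * ((D.χ (e⁻¹ * e') t : kˣ) : k) := by
        intro t
        simp
        ring
      have h9 : D.r ^ 2 ≠ 0 := pow_ne_zero 2 D.r_ne_zero
      simp_rw [h7]
      rw [← Finset.mul_sum, D.sum_χ, ← D.r_sq]
      simp only [inv_mul_eq_one]
      split_ifs
      · exact inv_mul_cancel₀ h9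
      · simp
  Finv_F := by
    classical
    intro a b c d e e' h1 h2 h3 h4
    rw [sum_eq]
    rcases a with a | _ <;> rcases b with b | _ <;> rcases c with c | _ <;>
    rcases e with e | _ <;> (try exact h1.elim) <;>
    rcases d with d | _ <;> (try exact h2.elim) <;>
    rcases e' with e' | _ <;> (try exact h3.elim) <;> (try exact h4.elim) <;>
    simp only [Fusion, F, Finv] at * <;> subst_vars <;> simp
    · refine Finset.card_eq_one.2 ⟨a * b, ?_⟩
      ext t
      simp only [Finset.mem_filter, Finset.mem_univ, true_and, Finset.mem_singleton]
      exact ⟨fun h => h.1, by rintro rfl; simp [mul_assoc]⟩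
    · exact mul_left_cancel h4
    · refine Finset.card_eq_one.2 ⟨d * c⁻¹, ?_⟩
      ext t
      simp only [Finset.mem_filter, Finset.mem_univ, true_and, Finset.mem_singleton]
      exact ⟨by rintro rfl; simp, by rintro rfl; simp⟩
    · have h7 : ∀ t, D.r⁻¹ * ((D.χ t e : kˣ) : k) * (D.r⁻¹ * ((D.χ t e' : kˣ) : k)⁻¹) =
          (D.r ^ 2)⁻¹ * ((D.χ (e'⁻¹ * e) t : kˣ) : k) := by
        intro t
        rw [D.symm t e, D.symm t e']
        simp
        ring
      have h9 : D.r ^ 2 ≠ 0 := pow_ne_zero 2 D.r_ne_zero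
      simp_rw [h7]
      rw [← Finset.mul_sum, D.sum_χ, ← D.r_sq]
      simp only [inv_mul_eq_one, eq_comm (a := e')]
      split_ifs
      · exact inv_mul_cancel₀ h9
      · simp
  pentagon := D.fusion_pentagon

end TambaraYamagamiData

/-- The Tambara–Yamagami category `C(G, χ, r)`. -/
abbrev TambaraYamagami {k : Type u} [Field k] [CharZero k] {G : Type w} [CommGroup G] [Fintype G]
    (D : TambaraYamagamiData k G) : Type (w + 1) :=
  FusionCat D.fusionSymbols

/-- A normalized 3-cocycle of the group `Γ` with values in `kˣ`. -/
structure ThreeCocycle (k : Type u) [Field k] (Γ : Type) [Group Γ] where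
  ω : Γ → Γ → Γ → kˣ
  cocycle : ∀ a b c d, ω b c d * ω a (b * c) d * ω a b c = ω (a * b) c d * ω a b (c * d)
  one_left : ∀ a b, ω 1 a b = 1
  one_mid : ∀ a b, ω a 1 b = 1
  one_right : ∀ a b, ω a b 1 = 1

/-- A `Γ`-grading `V = ⊕_{g ∈ Γ} V_g` of a vector space, given by the projections
`V → V_g ⊆ V` onto the homogeneous components. -/
structure Grading (k : Type u) [Field k] (Γ : Type) [Fintype Γ] (V : Type u) [AddCommGroup V]
    [Module k V] where
  proj : Γ → V →ₗ[k] V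
  proj_same : ∀ g v, proj g (proj g v) = proj g v
  proj_ne : ∀ g h v, g ≠ h → proj g (proj h v) = 0
  sum_proj : ∀ v, ∑ g, proj g v = v

namespace Grading

variable {k : Type u} [Field k] {Γ : Type} [Fintype Γ]
  {U V W X : Type u} [AddCommGroup U] [Module k U] [AddCommGroup V] [Module k V]
  [AddCommGroup W] [Module k W] [AddCommGroup X] [Module k X]

open Classical in
theorem proj_proj (P : Grading k Γ V) (g h : Γ) (v : V) :
    P.proj g (P.proj h v) = if g = h then P.proj h v else 0 := by
  split_ifs with e
  · subst e; exact P.proj_same g v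
  · exact P.proj_ne g h v e

/-- `v` is homogeneous of degree `g`. -/
def Homog (P : Grading k Γ V) (g : Γ) (v : V) : Prop := P.proj g v = v

theorem homog_proj (P : Grading k Γ V) (g : Γ) (v : V) : P.Homog g (P.proj g v) :=
  P.proj_same g v

open Classical in
theorem Homog.proj_eq {P : Grading k Γ V} {h : Γ} {v : V} (hv : P.Homog h v) (g : Γ) :
    P.proj g v = if g = h then v else 0 := by
  rw [← hv, proj_proj, hv]

theorem ext_map (P : Grading k Γ V) {M : Type*} [AddCommMonoid M] [Module k M]
    {f f' : V →ₗ[k] M} (h : ∀ g v, P.Homog g v → f v = f' v) : f = f' := by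
  ext v
  rw [← P.sum_proj v, map_sum, map_sum]
  exact Finset.sum_congr rfl fun g _ => h g _ (P.homog_proj g v)

theorem ext₂ (P : Grading k Γ V) (Q : Grading k Γ W) {M : Type*} [AddCommMonoid M] [Module k M]
    {f f' : V ⊗[k] W →ₗ[k] M}
    (h : ∀ a b v w, P.Homog a v → Q.Homog b w → f (v ⊗ₜ w) = f' (v ⊗ₜ w)) : f = f' := by
  apply TensorProduct.ext
  refine P.ext_map fun a v hv => Q.ext_map fun b w hw => h a b v w hv hw

theorem ext₃ (P : Grading k Γ U) (Q : Grading k Γ V) (R : Grading k Γ W) {M : Type*}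
    [AddCommMonoid M] [Module k M] {f f' : (U ⊗[k] V) ⊗[k] W →ₗ[k] M}
    (h : ∀ a b c u v w, P.Homog a u → Q.Homog b v → R.Homog c w →
      f ((u ⊗ₜ v) ⊗ₜ w) = f' ((u ⊗ₜ v) ⊗ₜ w)) : f = f' := by
  apply TensorProduct.ext
  refine P.ext₂ Q fun a b u v hu hv => R.ext_map fun c w hw => h a b c u v w hu hv hw

theorem ext₄ (P : Grading k Γ U) (Q : Grading k Γ V) (R : Grading k Γ W) (S : Grading k Γ X)
    {M : Type*} [AddCommMonoid M] [Module k M] {f f' : ((U ⊗[k] V) ⊗[k] W) ⊗[k] X →ₗ[k] M}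
    (h : ∀ a b c d u v w x, P.Homog a u → Q.Homog b v → R.Homog c w → S.Homog d x →
      f (((u ⊗ₜ v) ⊗ₜ w) ⊗ₜ x) = f' (((u ⊗ₜ v) ⊗ₜ w) ⊗ₜ x)) : f = f' := by
  apply TensorProduct.ext
  refine P.ext₃ Q R fun a b c u v w hu hv hw => S.ext_map fun d x hx =>
    h a b c d u v w x hu hv hw hx

section Group

variable [Group Γ]

open Classical in
theorem tensor_aux (P : Grading k Γ V) (Q : Grading k Γ W) {a b : Γ} {v : V} {w : W}
    (hv : P.Homog a v) (hw : Q.Homog b w) (g : Γ) :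
    (∑ x, TensorProduct.map (P.proj x) (Q.proj (x⁻¹ * g))) (v ⊗ₜ[k] w) =
      if g = a * b then v ⊗ₜ w else 0 := by
  rw [LinearMap.sum_apply, Finset.sum_eq_single a]
  · rw [TensorProduct.map_tmul, hv, hw.proj_eq, inv_mul_eq_iff_eq_mul]
    split_ifs <;> simp
  · intro x _ hx
    rw [TensorProduct.map_tmul, hv.proj_eq, if_neg hx, zero_tmul]
  · simp

/-- The grading of a tensor product: `(V ⊗ W)_g = ⊕_{x y = g} V_x ⊗ W_y`. -/
noncomputable def tensor (P : Grading k Γ V) (Q : Grading k Γ W) : Grading k Γ (V ⊗[k] W) where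
  proj g := ∑ x, TensorProduct.map (P.proj x) (Q.proj (x⁻¹ * g))
  proj_same g t := by
    classical
    refine LinearMap.congr_fun (f := (∑ x, TensorProduct.map (P.proj x) (Q.proj (x⁻¹ * g))) ∘ₗ
      (∑ x, TensorProduct.map (P.proj x) (Q.proj (x⁻¹ * g)))) ?_ t
    refine ext₂ P Q fun a b v w hv hw => ?_
    rw [LinearMap.comp_apply, tensor_aux P Q hv hw]
    split_ifs with h
    · rw [tensor_aux P Q hv hw, if_pos h]
    · simp
  proj_ne g h t hgh := by
    classical
    refine LinearMap.congr_fun (f := (∑ x, TensorProduct.map (P.proj x) (Q.proj (x⁻¹ * g))) ∘ₗ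
      (∑ x, TensorProduct.map (P.proj x) (Q.proj (x⁻¹ * h)))) (g := 0) ?_ t
    refine ext₂ P Q fun a b v w hv hw => ?_
    rw [LinearMap.comp_apply, tensor_aux P Q hv hw]
    split_ifs with h'
    · rw [tensor_aux P Q hv hw, if_neg (fun h'' => hgh (h''.trans h'.symm)), LinearMap.zero_apply]
    · simp
  sum_proj t := by
    classical
    rw [← LinearMap.sum_apply]
    refine LinearMap.congr_fun (g := LinearMap.id) ?_ t
    refine ext₂ P Q fun a b v w hv hw => ?_
    rw [LinearMap.sum_apply]
    simp_rw [tensor_aux P Q hv hw]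
    simp

theorem Homog.tmul {P : Grading k Γ V} {Q : Grading k Γ W} {a b : Γ} {v : V} {w : W}
    (hv : P.Homog a v) (hw : Q.Homog b w) : (P.tensor Q).Homog (a * b) (v ⊗ₜ w) := by
  classical
  exact (tensor_aux P Q hv hw (a * b)).trans (if_pos rfl)

open Classical in
/-- The one-dimensional space `k`, homogeneous of degree `1`. -/
noncomputable def unit (k : Type u) [Field k] (Γ : Type) [Fintype Γ] [Group Γ] :
    Grading k Γ k where
  proj g := if g = 1 then LinearMap.id else 0
  proj_same g v := by split_ifs <;> simp
  proj_ne g h v hgh := by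
    by_cases h1 : g = 1
    · have : h ≠ 1 := fun h2 => hgh (h1.trans h2.symm)
      simp [this]
    · simp [h1]
  sum_proj v := by
    rw [← LinearMap.sum_apply]
    simp

theorem homog_unit (c : k) : (unit k Γ).Homog 1 c := by
  simp [Homog, unit]

/-- The associativity map `(u ⊗ v) ⊗ w ↦ ω(|u|, |v|, |w|) u ⊗ (v ⊗ w)` on homogeneous elements. -/
noncomputable def assocMap (ω : Γ → Γ → Γ → kˣ) (P : Grading k Γ U) (Q : Grading k Γ V)
    (R : Grading k Γ W) : (U ⊗[k] V) ⊗[k] W →ₗ[k] U ⊗[k] (V ⊗[k] W) :=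
  (TensorProduct.assoc k U V W).toLinearMap ∘ₗ
    ∑ a, ∑ b, ∑ c, (ω a b c : k) •
      TensorProduct.map (TensorProduct.map (P.proj a) (Q.proj b)) (R.proj c)

theorem assocMap_apply (ω : Γ → Γ → Γ → kˣ) {P : Grading k Γ U} {Q : Grading k Γ V}
    {R : Grading k Γ W} {a b c : Γ} {u : U} {v : V} {w : W} (hu : P.Homog a u)
    (hv : Q.Homog b v) (hw : R.Homog c w) :
    assocMap ω P Q R ((u ⊗ₜ v) ⊗ₜ w) = (ω a b c : k) • u ⊗ₜ (v ⊗ₜ w) := by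
  classical
  simp only [assocMap, LinearMap.comp_apply, LinearMap.sum_apply, LinearMap.smul_apply,
    TensorProduct.map_tmul]
  rw [Finset.sum_eq_single a, Finset.sum_eq_single b, Finset.sum_eq_single c]
  · rw [hu, hv, hw]; simp
  · intro x _ hx
    simp [hw.proj_eq, hx]
  · simp
  · intro x _ hx
    simp [hv.proj_eq, hx]
  · simp
  · intro x _ hx
    simp [hu.proj_eq, hx]
  · simp

/-- The inverse of the associativity map. -/
noncomputable def assocInvMap (ω : Γ → Γ → Γ → kˣ) (P : Grading k Γ U) (Q : Grading k Γ V)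
    (R : Grading k Γ W) : U ⊗[k] (V ⊗[k] W) →ₗ[k] (U ⊗[k] V) ⊗[k] W :=
  (∑ a, ∑ b, ∑ c, (((ω a b c)⁻¹ : kˣ) : k) •
      TensorProduct.map (TensorProduct.map (P.proj a) (Q.proj b)) (R.proj c)) ∘ₗ
    (TensorProduct.assoc k U V W).symm.toLinearMap

theorem assocInvMap_apply (ω : Γ → Γ → Γ → kˣ) {P : Grading k Γ U} {Q : Grading k Γ V}
    {R : Grading k Γ W} {a b c : Γ} {u : U} {v : V} {w : W} (hu : P.Homog a u)
    (hv : Q.Homog b v) (hw : R.Homog c w) :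
    assocInvMap ω P Q R (u ⊗ₜ (v ⊗ₜ w)) = (((ω a b c)⁻¹ : kˣ) : k) • (u ⊗ₜ v) ⊗ₜ w := by
  have h := assocMap_apply (fun a b c => (ω a b c)⁻¹) hu hv hw
  have h2 := congrArg (TensorProduct.assoc k U V W).symm h
  simpa [assocMap, assocInvMap] using h2

theorem assocInv_comp (ω : Γ → Γ → Γ → kˣ) (P : Grading k Γ U) (Q : Grading k Γ V)
    (R : Grading k Γ W) : assocInvMap ω P Q R ∘ₗ assocMap ω P Q R = LinearMap.id := by
  refine ext₃ P Q R fun a b c u v w hu hv hw => ?_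
  rw [LinearMap.comp_apply, assocMap_apply ω hu hv hw, map_smul, assocInvMap_apply ω hu hv hw,
    smul_smul]
  simp

theorem comp_assocInv (ω : Γ → Γ → Γ → kˣ) (P : Grading k Γ U) (Q : Grading k Γ V)
    (R : Grading k Γ W) : assocMap ω P Q R ∘ₗ assocInvMap ω P Q R = LinearMap.id := by
  have : (assocMap ω P Q R ∘ₗ assocInvMap ω P Q R) ∘ₗ
      (TensorProduct.assoc k U V W).toLinearMap = (TensorProduct.assoc k U V W).toLinearMap := by
    refine ext₃ P Q R fun a b c u v w hu hv hw => ?_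
    simp only [LinearMap.comp_apply, LinearEquiv.coe_coe, TensorProduct.assoc_tmul]
    rw [assocInvMap_apply ω hu hv hw, map_smul, assocMap_apply ω hu hv hw, smul_smul]
    simp
  refine LinearMap.ext fun t => ?_
  obtain ⟨s, rfl⟩ := (TensorProduct.assoc k U V W).surjective t
  exact LinearMap.congr_fun this s

theorem assocMap_graded (ω : Γ → Γ → Γ → kˣ) (P : Grading k Γ U) (Q : Grading k Γ V)
    (R : Grading k Γ W) (g : Γ) (t : (U ⊗[k] V) ⊗[k] W) :
    assocMap ω P Q R (((P.tensor Q).tensor R).proj g t) =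
      (P.tensor (Q.tensor R)).proj g (assocMap ω P Q R t) := by
  classical
  refine LinearMap.congr_fun (f := assocMap ω P Q R ∘ₗ ((P.tensor Q).tensor R).proj g)
    (g := (P.tensor (Q.tensor R)).proj g ∘ₗ assocMap ω P Q R) ?_ t
  refine ext₃ P Q R fun a b c u v w hu hv hw => ?_
  rw [LinearMap.comp_apply, LinearMap.comp_apply, ((hu.tmul hv).tmul hw).proj_eq,
    assocMap_apply ω hu hv hw, map_smul, (hu.tmul (hv.tmul hw)).proj_eq, mul_assoc]
  split_ifs
  · rw [assocMap_apply ω hu hv hw]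
  · simp

theorem lid_graded (P : Grading k Γ V) (g : Γ) (t : k ⊗[k] V) :
    TensorProduct.lid k V (((unit k Γ).tensor P).proj g t) =
      P.proj g (TensorProduct.lid k V t) := by
  classical
  refine LinearMap.congr_fun
    (f := (TensorProduct.lid k V).toLinearMap ∘ₗ ((unit k Γ).tensor P).proj g)
    (g := P.proj g ∘ₗ (TensorProduct.lid k V).toLinearMap) ?_ t
  refine TensorProduct.ext (LinearMap.ext fun c => P.ext_map fun a v hv => ?_)
  change TensorProduct.lid k V (((unit k Γ).tensor P).proj g (c ⊗ₜ v)) =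
    P.proj g (TensorProduct.lid k V (c ⊗ₜ v))
  rw [TensorProduct.lid_tmul, map_smul, ((homog_unit c).tmul hv).proj_eq, hv.proj_eq, one_mul]
  split_ifs <;> simp

theorem rid_graded (P : Grading k Γ V) (g : Γ) (t : V ⊗[k] k) :
    TensorProduct.rid k V ((P.tensor (unit k Γ)).proj g t) =
      P.proj g (TensorProduct.rid k V t) := by
  classical
  refine LinearMap.congr_fun
    (f := (TensorProduct.rid k V).toLinearMap ∘ₗ (P.tensor (unit k Γ)).proj g)
    (g := P.proj g ∘ₗ (TensorProduct.rid k V).toLinearMap) ?_ t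
  refine TensorProduct.ext (P.ext_map fun a v hv => LinearMap.ext fun c => ?_)
  change TensorProduct.rid k V ((P.tensor (unit k Γ)).proj g (v ⊗ₜ c)) =
    P.proj g (TensorProduct.rid k V (v ⊗ₜ c))
  rw [TensorProduct.rid_tmul, map_smul, (hv.tmul (homog_unit c)).proj_eq, hv.proj_eq, mul_one]
  split_ifs <;> simp

end Group

/-- The quotient of a graded space by the image of a graded map. -/
noncomputable def quotient (P : Grading k Γ V) (N : Submodule k V)
    (hN : ∀ g, N ≤ N.comap (P.proj g)) : Grading k Γ (V ⧸ N) where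
  proj g := N.mapQ N (P.proj g) (hN g)
  proj_same g t := by
    obtain ⟨v, rfl⟩ := N.mkQ_surjective t
    simp [P.proj_same]
  proj_ne g h t hgh := by
    obtain ⟨v, rfl⟩ := N.mkQ_surjective t
    simp [P.proj_ne g h v hgh]
  sum_proj t := by
    obtain ⟨v, rfl⟩ := N.mkQ_surjective t
    simp only [Submodule.mkQ_apply, Submodule.mapQ_apply]
    conv_rhs => rw [← P.sum_proj v]
    exact (map_sum N.mkQ _ _).symm

/-- A grading of the space of linear maps, by `|φ| = g` if `|φ v| = m g |v|`. -/
noncomputable def hom (P : Grading k Γ V) (Q : Grading k Γ W) (m : Γ → Γ → Γ)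
    (hm : ∀ a, Function.Bijective fun g => m g a) : Grading k Γ (V →ₗ[k] W) where
  proj g :=
    { toFun := fun φ => ∑ a, Q.proj (m g a) ∘ₗ φ ∘ₗ P.proj a
      map_add' := fun φ ψ => by
        simp [LinearMap.add_comp, LinearMap.comp_add, Finset.sum_add_distrib]
      map_smul' := fun c φ => by
        simp [LinearMap.smul_comp, LinearMap.comp_smul, Finset.smul_sum] }
  proj_same g φ := by
    classical
    refine P.ext_map fun a v hv => ?_
    simp [hv.proj_eq, apply_ite, Q.proj_same]
  proj_ne g h φ hgh := by
    classical
    refine P.ext_map fun a v hv => ?_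
    have : m g a ≠ m h a := fun e => hgh ((hm a).1 e)
    simp [hv.proj_eq, apply_ite, Q.proj_ne _ _ _ this]
  sum_proj φ := by
    classical
    refine P.ext_map fun a v hv => ?_
    simp only [LinearMap.coe_mk, AddHom.coe_mk, LinearMap.sum_apply, LinearMap.comp_apply]
    have : ∀ g, ∑ x, Q.proj (m g x) (φ (P.proj x v)) = Q.proj (m g a) (φ v) := by
      intro g
      rw [Finset.sum_eq_single a]
      · rw [hv]
      · intro x _ hx
        rw [hv.proj_eq, if_neg hx, map_zero, map_zero]
      · simp
    simp_rw [this]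
    exact (Function.Bijective.sum_comp (hm a) fun g => Q.proj g (φ v)).trans (Q.sum_proj (φ v))

theorem hom_proj_apply (P : Grading k Γ V) (Q : Grading k Γ W) (m : Γ → Γ → Γ)
    (hm : ∀ a, Function.Bijective fun g => m g a) (g : Γ) (φ : V →ₗ[k] W) {a : Γ} {v : V}
    (hv : P.Homog a v) : (P.hom Q m hm).proj g φ v = Q.proj (m g a) (φ v) := by
  classical
  simp [hom, hv.proj_eq, apply_ite]

theorem Homog.apply {P : Grading k Γ V} {Q : Grading k Γ W} {m : Γ → Γ → Γ}
    {hm : ∀ a, Function.Bijective fun g => m g a} {a b : Γ} {φ : V →ₗ[k] W} {v : V}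
    (hφ : (P.hom Q m hm).Homog b φ) (hv : P.Homog a v) : Q.Homog (m b a) (φ v) :=
  (hom_proj_apply P Q m hm b φ hv).symm.trans (LinearMap.congr_fun hφ v)

end Grading

/-- An object of `Vec^Γ_ω`: a finite-dimensional `Γ`-graded vector space. -/
structure GradedVec {k : Type u} [Field k] {Γ : Type} [Group Γ] [Fintype Γ]
    (c : ThreeCocycle k Γ) where
  V : Type u
  [addCommGroup : AddCommGroup V]
  [module : Module k V]
  [finite : Module.Finite k V]
  gr : Grading k Γ V

namespace GradedVec

attribute [instance] addCommGroup module finite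

variable {k : Type u} [Field k] {Γ : Type} [Group Γ] [Fintype Γ] {c : ThreeCocycle k Γ}

/-- Morphisms of graded vector spaces: linear maps preserving degrees. -/
@[ext]
structure Hom (X Y : GradedVec c) where
  toLin : X.V →ₗ[k] Y.V
  graded : ∀ g x, toLin (X.gr.proj g x) = Y.gr.proj g (toLin x)

instance : Category (GradedVec c) where
  Hom X Y := Hom X Y
  id X := ⟨LinearMap.id, fun _ _ => rfl⟩
  comp f g := ⟨g.toLin ∘ₗ f.toLin, fun a x => by simp [f.graded, g.graded]⟩

@[ext] theorem hom_ext {X Y : GradedVec c} {f g : X ⟶ Y} (h : f.toLin = g.toLin) : f = g :=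
  Hom.ext h

@[simp] theorem id_toLin (X : GradedVec c) : (𝟙 X : X ⟶ X).toLin = LinearMap.id := rfl
@[simp] theorem comp_toLin {X Y Z : GradedVec c} (f : X ⟶ Y) (g : Y ⟶ Z) :
    (f ≫ g).toLin = g.toLin ∘ₗ f.toLin := rfl

theorem homog_map {X Y : GradedVec c} (f : X ⟶ Y) {g : Γ} {x : X.V} (hx : X.gr.Homog g x) :
    Y.gr.Homog g (f.toLin x) :=
  (f.graded g x).symm.trans (congrArg f.toLin hx)

instance (X Y : GradedVec c) : AddCommGroup (X ⟶ Y) :=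
  let S : Submodule k (X.V →ₗ[k] Y.V) :=
    { carrier := {f | ∀ a x, f (X.gr.proj a x) = Y.gr.proj a (f x)}
      add_mem' := fun hf hg a x => by simp [hf a x, hg a x]
      zero_mem' := fun a x => by simp
      smul_mem' := fun c f hf a x => by simp [hf a x] }
  let e : (X ⟶ Y) ≃ S := ⟨fun f => ⟨f.toLin, f.graded⟩, fun f => ⟨f.1, f.2⟩,
    fun _ => rfl, fun _ => rfl⟩
  e.addCommGroup

instance (X Y : GradedVec c) : Module k (X ⟶ Y) where
  smul c f := ⟨c • f.toLin, fun a x => by simp [f.graded]⟩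
  one_smul f := by apply hom_ext; exact one_smul _ _
  mul_smul a b f := by apply hom_ext; exact mul_smul _ _ _
  smul_zero a := by apply hom_ext; exact smul_zero _
  smul_add a f g := by apply hom_ext; exact smul_add _ _ _
  add_smul a b f := by apply hom_ext; exact add_smul _ _ _
  zero_smul f := by apply hom_ext; exact zero_smul _ _

@[simp] theorem add_toLin {X Y : GradedVec c} (f g : X ⟶ Y) :
    (f + g).toLin = f.toLin + g.toLin := rfl
@[simp] theorem smul_toLin {X Y : GradedVec c} (r : k) (f : X ⟶ Y) :
    (r • f).toLin = r • f.toLin := rfl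

instance : Preadditive (GradedVec c) where
  add_comp _ _ _ f f' g := by apply hom_ext; simp [LinearMap.comp_add]
  comp_add _ _ _ f g g' := by apply hom_ext; simp [LinearMap.add_comp]

instance : Linear k (GradedVec c) where
  smul_comp _ _ _ r f g := by apply hom_ext; simp [LinearMap.comp_smul]
  comp_smul _ _ _ f r g := by apply hom_ext; simp [LinearMap.smul_comp]

/-- The tensor product of graded vector spaces. -/
@[reducible]
noncomputable def tensor (X Y : GradedVec c) : GradedVec c where
  V := X.V ⊗[k] Y.V
  gr := X.gr.tensor Y.gr

/-- The unit object. -/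
@[reducible]
noncomputable def unit (c : ThreeCocycle k Γ) : GradedVec c where
  V := k
  gr := Grading.unit k Γ

/-- The tensor product of morphisms. -/
noncomputable def tensorMap {X X' Y Y' : GradedVec c} (f : X ⟶ X') (g : Y ⟶ Y') :
    tensor X Y ⟶ tensor X' Y' :=
  ⟨TensorProduct.map f.toLin g.toLin, fun a t => by
    classical
    refine LinearMap.congr_fun (f := TensorProduct.map f.toLin g.toLin ∘ₗ (tensor X Y).gr.proj a)
      (g := (tensor X' Y').gr.proj a ∘ₗ TensorProduct.map f.toLin g.toLin) ?_ t
    refine Grading.ext₂ X.gr Y.gr fun a b v w hv hw => ?_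
    rw [LinearMap.comp_apply, LinearMap.comp_apply, TensorProduct.map_tmul,
      (hv.tmul hw).proj_eq, ((homog_map f hv).tmul (homog_map g hw)).proj_eq]
    split_ifs <;> simp⟩

/-- The associativity constraint: `(u ⊗ v) ⊗ w ↦ ω(|u|, |v|, |w|) u ⊗ (v ⊗ w)` on homogeneous
elements. -/
noncomputable def assoc (X Y Z : GradedVec c) :
    tensor (tensor X Y) Z ≅ tensor X (tensor Y Z) where
  hom := ⟨Grading.assocMap c.ω X.gr Y.gr Z.gr, Grading.assocMap_graded c.ω X.gr Y.gr Z.gr⟩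
  inv := ⟨Grading.assocInvMap c.ω X.gr Y.gr Z.gr, fun g t => by
    have h1 := LinearMap.congr_fun (Grading.comp_assocInv c.ω X.gr Y.gr Z.gr)
    have h2 := LinearMap.congr_fun (Grading.assocInv_comp c.ω X.gr Y.gr Z.gr)
    have h3 := Grading.assocMap_graded c.ω X.gr Y.gr Z.gr g
      (Grading.assocInvMap c.ω X.gr Y.gr Z.gr t)
    simp only [LinearMap.comp_apply, LinearMap.id_apply] at h1 h2
    rw [h1] at h3
    rw [← h3, h2]⟩
  hom_inv_id := hom_ext (Grading.assocInv_comp c.ω X.gr Y.gr Z.gr)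
  inv_hom_id := hom_ext (Grading.comp_assocInv c.ω X.gr Y.gr Z.gr)

/-- A graded linear isomorphism is an isomorphism of graded vector spaces. -/
def mkIso {X Y : GradedVec c} (e : X.V ≃ₗ[k] Y.V)
    (h : ∀ g x, e (X.gr.proj g x) = Y.gr.proj g (e x)) : X ≅ Y where
  hom := ⟨e.toLinearMap, h⟩
  inv := ⟨e.symm.toLinearMap, fun a y => by
    apply e.injective
    have := h a (e.symm y)
    simp at this
    simp [this]⟩
  hom_inv_id := by ext; simp
  inv_hom_id := by ext; simp

noncomputable instance : MonoidalCategoryStruct (GradedVec c) where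
  tensorObj := tensor
  tensorHom f g := tensorMap f g
  whiskerLeft X _ _ f := tensorMap (𝟙 X) f
  whiskerRight f Y := tensorMap f (𝟙 Y)
  tensorUnit := unit c
  associator := assoc
  leftUnitor X := mkIso (TensorProduct.lid k X.V) (Grading.lid_graded X.gr)
  rightUnitor X := mkIso (TensorProduct.rid k X.V) (Grading.rid_graded X.gr)

theorem assoc_natural {X X' Y Y' Z Z' : GradedVec c} (f : X ⟶ X') (g : Y ⟶ Y') (h : Z ⟶ Z') :
    tensorMap (tensorMap f g) h ≫ (assoc X' Y' Z').hom =
      (assoc X Y Z).hom ≫ tensorMap f (tensorMap g h) := by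
  apply hom_ext
  refine Grading.ext₃ X.gr Y.gr Z.gr fun a b d u v w hu hv hw => ?_
  refine (Grading.assocMap_apply c.ω (homog_map f hu) (homog_map g hv) (homog_map h hw)).trans ?_
  rw [comp_toLin, LinearMap.comp_apply]
  change _ = (tensorMap f (tensorMap g h)).toLin (Grading.assocMap c.ω X.gr Y.gr Z.gr _)
  rw [Grading.assocMap_apply c.ω hu hv hw, map_smul]
  rfl

theorem assoc_pentagon (W X Y Z : GradedVec c) :
    tensorMap (assoc W X Y).hom (𝟙 Z) ≫ (assoc W (tensor X Y) Z).hom ≫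
      tensorMap (𝟙 W) (assoc X Y Z).hom =
    (assoc (tensor W X) Y Z).hom ≫ (assoc W X (tensor Y Z)).hom := by
  apply hom_ext
  refine Grading.ext₄ W.gr X.gr Y.gr Z.gr fun a b d e u v w x hu hv hw hx => ?_
  change TensorProduct.map LinearMap.id (Grading.assocMap c.ω X.gr Y.gr Z.gr)
      (Grading.assocMap c.ω W.gr (X.gr.tensor Y.gr) Z.gr
        ((Grading.assocMap c.ω W.gr X.gr Y.gr ((u ⊗ₜ v) ⊗ₜ w)) ⊗ₜ x)) =
    Grading.assocMap c.ω W.gr X.gr (Y.gr.tensor Z.gr)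
      (Grading.assocMap c.ω (W.gr.tensor X.gr) Y.gr Z.gr (((u ⊗ₜ v) ⊗ₜ w) ⊗ₜ x))
  rw [Grading.assocMap_apply c.ω hu hv hw, Grading.assocMap_apply c.ω (hu.tmul hv) hw hx,
    ← TensorProduct.smul_tmul', map_smul, map_smul, map_smul,
    Grading.assocMap_apply c.ω hu (hv.tmul hw) hx,
    Grading.assocMap_apply c.ω hu hv (hw.tmul hx), map_smul, TensorProduct.map_tmul,
    Grading.assocMap_apply c.ω hv hw hx, TensorProduct.tmul_smul, smul_smul, smul_smul, smul_smul]
  congr 1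
  have := congrArg (Units.val) (c.cocycle a b d e)
  push_cast at this
  rw [← this]
  ring

/-- The monoidal category `Vec^Γ_ω` of finite-dimensional `Γ`-graded vector spaces with
associativity constraint given by `ω`. -/
noncomputable instance : MonoidalCategory (GradedVec c) where
  tensorHom_def f g := by
    apply hom_ext
    exact TensorProduct.ext' fun x y => rfl
  id_tensorHom_id X Y := by
    apply hom_ext
    exact TensorProduct.ext' fun x y => rfl
  tensorHom_comp_tensorHom f f' g g' := by
    apply hom_ext
    exact TensorProduct.ext' fun x y => rfl
  whiskerLeft_id X Y := by
    apply hom_ext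
    exact TensorProduct.ext' fun x y => rfl
  id_whiskerRight X Y := by
    apply hom_ext
    exact TensorProduct.ext' fun x y => rfl
  associator_naturality := assoc_natural
  leftUnitor_naturality {X Y} f := by
    apply hom_ext
    refine TensorProduct.ext' fun (x : k) y => ?_
    exact (f.toLin.map_smul x y).symm
  rightUnitor_naturality {X Y} f := by
    apply hom_ext
    refine TensorProduct.ext' fun y (x : k) => ?_
    exact (f.toLin.map_smul x y).symm
  pentagon := assoc_pentagon
  triangle X Y := by
    apply hom_ext
    refine Grading.ext₃ X.gr (Grading.unit k Γ) Y.gr fun a b d x (y : k) z hx hy hz => ?_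
    change TensorProduct.map LinearMap.id (TensorProduct.lid k Y.V).toLinearMap
      (Grading.assocMap c.ω X.gr (Grading.unit k Γ) Y.gr ((x ⊗ₜ y) ⊗ₜ z)) = (y • x) ⊗ₜ z
    rw [Grading.assocMap_apply c.ω hx (Grading.homog_unit y) hz, c.one_mid, Units.val_one, one_smul]
    exact (TensorProduct.smul_tmul y x z).symm

/-- The coequalizer of two morphisms of graded vector spaces. -/
noncomputable def coeq {X Y : GradedVec c} (f g : X ⟶ Y) : GradedVec c where
  V := Y.V ⧸ LinearMap.range (f.toLin - g.toLin)
  gr := Y.gr.quotient _ (by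
    rintro a _ ⟨x, rfl⟩
    exact ⟨X.gr.proj a x, by simp [f.graded, g.graded]⟩)

/-- The projection onto the coequalizer. -/
noncomputable def coeqπ {X Y : GradedVec c} (f g : X ⟶ Y) : Y ⟶ coeq f g :=
  ⟨Submodule.mkQ _, fun _ _ => rfl⟩

theorem coeq_condition {X Y : GradedVec c} (f g : X ⟶ Y) : f ≫ coeqπ f g = g ≫ coeqπ f g := by
  apply hom_ext
  refine LinearMap.ext fun x => ?_
  exact (Submodule.Quotient.eq _).2 ⟨x, rfl⟩

/-- The universal property of the coequalizer. -/
noncomputable def coeqDesc {X Y Z : GradedVec c} (f g : X ⟶ Y) (h : Y ⟶ Z) (w : f ≫ h = g ≫ h) :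
    coeq f g ⟶ Z :=
  ⟨Submodule.liftQ _ h.toLin (by
    rintro _ ⟨x, rfl⟩
    have := LinearMap.congr_fun (congrArg Hom.toLin w) x
    simp only [comp_toLin, LinearMap.comp_apply] at this
    simp [this]), fun a t => by
      obtain ⟨y, rfl⟩ := Submodule.mkQ_surjective _ t
      exact h.graded a y⟩

instance : HasCoequalizers (GradedVec c) :=
  have (X Y : GradedVec c) (f g : X ⟶ Y) : HasColimit (parallelPair f g) :=
    ⟨⟨⟨Cofork.ofπ (coeqπ f g) (coeq_condition f g),
      Cofork.IsColimit.mk _ (fun s => coeqDesc f g s.π s.condition)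
        (fun s => rfl)
        (fun s m hm => by
          apply hom_ext
          refine LinearMap.ext fun t => ?_
          obtain ⟨y, rfl⟩ := Submodule.mkQ_surjective _ t
          exact LinearMap.congr_fun (congrArg Hom.toLin hm) y)⟩⟩⟩
  hasCoequalizers_of_hasColimit_parallelPair _

/-- Graded space of linear maps, right adjoint to `X ⊗ -`. -/
@[reducible]
noncomputable def ihomL (X Z : GradedVec c) : GradedVec c where
  V := X.V →ₗ[k] Z.V
  gr := X.gr.hom Z.gr (fun g a => a * g) fun a => (Equiv.mulLeft a).bijective

/-- Graded space of linear maps, right adjoint to `- ⊗ X`. -/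
@[reducible]
noncomputable def ihomR (X Z : GradedVec c) : GradedVec c where
  V := X.V →ₗ[k] Z.V
  gr := X.gr.hom Z.gr (fun g a => g * a) fun a => (Equiv.mulRight a).bijective

/-- The bijection `Hom(X ⊗ Y, Z) = Hom(Y, Hom(X, Z))`. -/
noncomputable def homEquivL (X Y Z : GradedVec c) : (X ⊗ Y ⟶ Z) ≃ (Y ⟶ ihomL X Z) where
  toFun f := ⟨(TensorProduct.curry f.toLin).flip, fun g y => by
    classical
    refine LinearMap.congr_fun (f := (TensorProduct.curry f.toLin).flip ∘ₗ Y.gr.proj g)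
      (g := (ihomL X Z).gr.proj g ∘ₗ (TensorProduct.curry f.toLin).flip) ?_ y
    refine Y.gr.ext_map fun b y hy => X.gr.ext_map fun a x hx => ?_
    refine Eq.trans ?_ (Grading.hom_proj_apply X.gr Z.gr (fun g a => a * g)
      (fun a => (Equiv.mulLeft a).bijective) g ((TensorProduct.curry f.toLin).flip y) hx).symm
    have h1 := homog_map f (hx.tmul hy)
    change f.toLin (x ⊗ₜ Y.gr.proj g y) = Z.gr.proj (a * g) (f.toLin (x ⊗ₜ y))
    rw [h1.proj_eq, hy.proj_eq]
    by_cases h : g = b <;> simp [h]⟩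
  invFun φ := ⟨(TensorProduct.lift φ.toLin.flip), fun g t => by
    classical
    refine LinearMap.congr_fun (f := (TensorProduct.lift φ.toLin.flip) ∘ₗ (X ⊗ Y).gr.proj g)
      (g := Z.gr.proj g ∘ₗ (TensorProduct.lift φ.toLin.flip)) ?_ t
    refine Grading.ext₂ X.gr Y.gr fun a b v w hv hw => ?_
    have h1 : Z.gr.Homog (a * b) ((φ.toLin w : X.V →ₗ[k] Z.V) v) :=
      Grading.Homog.apply (hm := fun a => (Equiv.mulLeft a).bijective)
      (homog_map φ hw) hv
    change (TensorProduct.lift φ.toLin.flip) (((X.gr).tensor Y.gr).proj g (v ⊗ₜ w)) =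
      Z.gr.proj g ((φ.toLin w : X.V →ₗ[k] Z.V) v)
    rw [(hv.tmul hw).proj_eq, h1.proj_eq]
    split_ifs
    · rfl
    · exact map_zero _⟩
  left_inv f := by
    apply hom_ext
    exact TensorProduct.ext' fun x y => rfl
  right_inv f := by
    apply hom_ext
    rfl

/-- The bijection `Hom(Y ⊗ X, Z) = Hom(Y, Hom(X, Z))`. -/
noncomputable def homEquivR (X Y Z : GradedVec c) : (Y ⊗ X ⟶ Z) ≃ (Y ⟶ ihomR X Z) where
  toFun f := ⟨(TensorProduct.curry f.toLin), fun g y => by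
    classical
    refine LinearMap.congr_fun (f := (TensorProduct.curry f.toLin) ∘ₗ Y.gr.proj g)
      (g := (ihomR X Z).gr.proj g ∘ₗ (TensorProduct.curry f.toLin)) ?_ y
    refine Y.gr.ext_map fun b y hy => X.gr.ext_map fun a x hx => ?_
    refine Eq.trans ?_ (Grading.hom_proj_apply X.gr Z.gr (fun g a => g * a)
      (fun a => (Equiv.mulRight a).bijective) g ((TensorProduct.curry f.toLin) y) hx).symm
    have h1 := homog_map f (hy.tmul hx)
    change f.toLin (Y.gr.proj g y ⊗ₜ x) = Z.gr.proj (g * a) (f.toLin (y ⊗ₜ x))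
    rw [h1.proj_eq, hy.proj_eq]
    by_cases h : g = b <;> simp [h]⟩
  invFun φ := ⟨(TensorProduct.lift φ.toLin), fun g t => by
    classical
    refine LinearMap.congr_fun (f := (TensorProduct.lift φ.toLin) ∘ₗ (Y ⊗ X).gr.proj g)
      (g := Z.gr.proj g ∘ₗ (TensorProduct.lift φ.toLin)) ?_ t
    refine Grading.ext₂ Y.gr X.gr fun a b v w hv hw => ?_
    have h1 : Z.gr.Homog (a * b) ((φ.toLin v : X.V →ₗ[k] Z.V) w) :=
      Grading.Homog.apply (hm := fun a => (Equiv.mulRight a).bijective)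
      (homog_map φ hv) hw
    change (TensorProduct.lift φ.toLin) (((Y.gr).tensor X.gr).proj g (v ⊗ₜ w)) =
      Z.gr.proj g ((φ.toLin v : X.V →ₗ[k] Z.V) w)
    rw [(hv.tmul hw).proj_eq, h1.proj_eq]
    split_ifs
    · rfl
    · exact map_zero _⟩
  left_inv f := by
    apply hom_ext
    exact TensorProduct.ext' fun x y => rfl
  right_inv f := by
    apply hom_ext
    rfl

instance (X : GradedVec c) : PreservesColimitsOfSize.{0, 0} (tensorLeft X) :=
  (Adjunction.adjunctionOfEquivRight (F := tensorLeft X) (G_obj := ihomL X) (homEquivL X)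
    (fun _ _ _ _ _ => rfl)).leftAdjoint_preservesColimits

instance (X : GradedVec c) : PreservesColimitsOfSize.{0, 0} (tensorRight X) :=
  (Adjunction.adjunctionOfEquivRight (F := tensorRight X) (G_obj := ihomR X)
    (fun Y Z => homEquivR X Y Z) (fun _ _ _ _ _ => rfl)).leftAdjoint_preservesColimits

end GradedVec

/-- A normalized 2-cochain `α` of a subgroup `F` whose coboundary is `ω|_F`; in particular the
class of `ω|_F` is trivial, and `α` is a 2-cocycle if `ω|_F = 1`. -/
structure TwistedCocycle {k : Type u} [Field k] {Γ : Type} [Group Γ] (c : ThreeCocycle k Γ)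
    (F : Subgroup Γ) where
  α : F → F → kˣ
  coboundary : ∀ x y z, α x y * α (x * y) z = c.ω x y z * (α y z * α x (y * z))
  one_left : ∀ x, α 1 x = 1
  one_right : ∀ x, α x 1 = 1

namespace GradedVec

variable {k : Type u} [Field k] {Γ : Type} [Group Γ] [Fintype Γ] {c : ThreeCocycle k Γ}
  {F : Subgroup Γ} (a : TwistedCocycle c F)

open Classical in
/-- The group algebra `kF`, graded by `|x| = x` for `x ∈ F`. -/
noncomputable def groupAlgGrading (k : Type u) [Field k] (F : Subgroup Γ) :
    Grading k Γ (F →₀ k) where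
  proj g := Finsupp.linearCombination k fun x : F =>
    if (x : Γ) = g then Finsupp.single x 1 else 0
  proj_same g t := by
    refine LinearMap.congr_fun (f := (Finsupp.linearCombination k fun x : F =>
      if (x : Γ) = g then Finsupp.single x (1 : k) else 0) ∘ₗ (Finsupp.linearCombination k
        fun x : F => if (x : Γ) = g then Finsupp.single x (1 : k) else 0)) ?_ t
    refine Finsupp.lhom_ext' fun x => LinearMap.ext_ring ?_
    by_cases h : (x : Γ) = g <;> simp [h]
  proj_ne g h t hgh := by
    refine LinearMap.congr_fun (f := (Finsupp.linearCombination k fun x : F =>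
      if (x : Γ) = g then Finsupp.single x (1 : k) else 0) ∘ₗ (Finsupp.linearCombination k
        fun x : F => if (x : Γ) = h then Finsupp.single x (1 : k) else 0)) (g := 0) ?_ t
    refine Finsupp.lhom_ext' fun x => LinearMap.ext_ring ?_
    by_cases h : (x : Γ) = h <;> simp_all [Ne.symm hgh]
  sum_proj t := by
    rw [← LinearMap.sum_apply]
    refine LinearMap.congr_fun (g := LinearMap.id) ?_ t
    refine Finsupp.lhom_ext' fun x => LinearMap.ext_ring ?_
    simp

theorem homog_single (x : F) (r : k) :
    (groupAlgGrading k F).Homog (x : Γ) (Finsupp.single x r) := by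
  simp [Grading.Homog, groupAlgGrading]

/-- The object `kF` of `Vec^Γ_ω`. -/
@[reducible]
noncomputable def groupAlg (c : ThreeCocycle k Γ) (F : Subgroup Γ) : GradedVec c where
  V := F →₀ k
  gr := groupAlgGrading k F

/-- The multiplication `x · y = α(x, y) xy` of `k_α F`. -/
noncomputable def mulMap : (F →₀ k) ⊗[k] (F →₀ k) →ₗ[k] (F →₀ k) :=
  TensorProduct.lift (Finsupp.linearCombination k fun x =>
    Finsupp.linearCombination k fun y => Finsupp.single (x * y) (a.α x y : k))

theorem mulMap_single (x y : F) (r s : k) :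
    mulMap a (Finsupp.single x r ⊗ₜ Finsupp.single y s) =
      Finsupp.single (x * y) (r * (s * a.α x y)) := by
  simp only [mulMap, TensorProduct.lift.tmul, Finsupp.linearCombination_single,
    LinearMap.smul_apply, Finsupp.smul_single, smul_eq_mul]

/-- The unit of `k_α F`. -/
noncomputable def oneMap (k : Type u) [Field k] (F : Subgroup Γ) : k →ₗ[k] (F →₀ k) :=
  Finsupp.lsingle 1

/-- The multiplication of `k_α F` as a morphism of `Vec^Γ_ω`. -/
noncomputable def mulHom : (groupAlg c F ⊗ groupAlg c F : GradedVec c) ⟶ groupAlg c F :=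
  ⟨mulMap a, fun g t => by
    classical
    refine LinearMap.congr_fun
      (f := mulMap a ∘ₗ ((groupAlgGrading k F).tensor (groupAlgGrading k F)).proj g)
      (g := (groupAlgGrading k F).proj g ∘ₗ mulMap a) ?_ t
    refine TensorProduct.ext (Finsupp.lhom_ext fun x r => ?_)
    refine Finsupp.lhom_ext fun y s => ?_
    change mulMap a (((groupAlgGrading k F).tensor (groupAlgGrading k F)).proj g
      (Finsupp.single x r ⊗ₜ Finsupp.single y s)) =
        (groupAlgGrading k F).proj g (mulMap a (Finsupp.single x r ⊗ₜ Finsupp.single y s))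
    rw [((homog_single x r).tmul (homog_single y s)).proj_eq, mulMap_single,
      (homog_single _ _).proj_eq, Subgroup.coe_mul]
    split_ifs
    · rw [mulMap_single]
    · exact map_zero _⟩

/-- The unit of `k_α F` as a morphism of `Vec^Γ_ω`. -/
noncomputable def oneHom (c : ThreeCocycle k Γ) (F : Subgroup Γ) :
    𝟙_ (GradedVec c) ⟶ groupAlg c F :=
  ⟨oneMap k F, fun g (t : k) => by
    classical
    change Finsupp.lsingle 1 ((Grading.unit k Γ).proj g t) =
      (groupAlgGrading k F).proj g (Finsupp.single 1 t)
    rw [(Grading.homog_unit t).proj_eq, (homog_single 1 t).proj_eq, Subgroup.coe_one]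
    split_ifs
    · rfl
    · exact map_zero _⟩

/-- The twisted group algebra `k_α F`, an algebra in `Vec^Γ_ω`. -/
noncomputable def twistedGroupAlg : Mon (GradedVec c) where
  X := groupAlg c F
  mon :=
    { one := oneHom c F
      mul := mulHom a
      one_mul := by
        apply hom_ext
        refine TensorProduct.ext (LinearMap.ext fun (r : k) => Finsupp.lhom_ext fun x s => ?_)
        change mulMap a (Finsupp.single 1 r ⊗ₜ Finsupp.single x s) = r • Finsupp.single x s
        rw [mulMap_single, a.one_left]
        simp
      mul_one := by
        apply hom_ext
        refine TensorProduct.ext (Finsupp.lhom_ext fun x s => LinearMap.ext fun (r : k) => ?_)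
        change mulMap a (Finsupp.single x s ⊗ₜ Finsupp.single 1 r) = r • Finsupp.single x s
        rw [mulMap_single, a.one_right]
        simp [mul_comm]
      mul_assoc := by
        apply hom_ext
        refine TensorProduct.ext (TensorProduct.ext (Finsupp.lhom_ext fun x r =>
          Finsupp.lhom_ext fun y s => Finsupp.lhom_ext fun z t => ?_))
        change mulMap a (mulMap a (Finsupp.single x r ⊗ₜ Finsupp.single y s) ⊗ₜ
            Finsupp.single z t) =
          mulMap a (TensorProduct.map LinearMap.id (mulMap a)
            (Grading.assocMap c.ω (groupAlgGrading k F) (groupAlgGrading k F)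
              (groupAlgGrading k F)
              ((Finsupp.single x r ⊗ₜ Finsupp.single y s) ⊗ₜ Finsupp.single z t)))
        rw [Grading.assocMap_apply c.ω (homog_single x r) (homog_single y s) (homog_single z t),
          map_smul, map_smul, TensorProduct.map_tmul, LinearMap.id_apply, mulMap_single,
          mulMap_single, mulMap_single, mulMap_single, Finsupp.smul_single, mul_assoc x y z]
        congr 1
        have := congrArg Units.val (a.coboundary x y z)
        push_cast at this
        rw [smul_eq_mul]
        linear_combination r * s * t * this }

/-- The monoidal structure on bimodules over an algebra `A` in `Vec^Γ_ω`: the tensor product is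
`- ⊗_A -`. -/
noncomputable instance bimodMonoidal (A : Mon (GradedVec c)) : MonoidalCategory (Bimod A A) :=
  letI : Bicategory (Mon (GradedVec c)) := Bimod.monBicategory
  inferInstanceAs (MonoidalCategory (EndMonoidal A))

end GradedVec

/-- The monoidal category `C(Γ, ω, F, α)` of `k_α F`-bimodules in `Vec^Γ_ω`. -/
abbrev GroupTheoreticalCat {k : Type u} [Field k] {Γ : Type} [Group Γ] [Fintype Γ]
    {c : ThreeCocycle k Γ} {F : Subgroup Γ} (a : TwistedCocycle c F) : Type (u + 1) :=
  Bimod (GradedVec.twistedGroupAlg a) (GradedVec.twistedGroupAlg a)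

/-- There is an equivalence of monoidal categories `C ≌ D`. -/
def MonoidallyEquivalent (C : Type*) [Category C] [MonoidalCategory C] (D : Type*) [Category D]
    [MonoidalCategory D] : Prop :=
  ∃ e : C ≌ D, Nonempty e.functor.Monoidal

/-- The Hopf algebra `A` is group theoretical: `Rep A` is equivalent, as a `k`-linear monoidal
category, to some `C(Γ, ω, F, α)`. -/
def IsGroupTheoretical (k : Type u) [Field k] (A : Type v) [Ring A] [HopfAlgebra k A] : Prop :=
  ∃ (Γ : Type) (_ : Group Γ) (_ : Fintype Γ) (c : ThreeCocycle k Γ) (F : Subgroup Γ)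
    (a : TwistedCocycle c F) (e : HopfRep.{u, v} k A ≌ GroupTheoreticalCat a),
    Nonempty e.functor.Monoidal ∧ (e.functor ⋙ Bimod.forget _).Additive ∧
      (e.functor ⋙ Bimod.forget _).Linear k

/-- `k → B → A → H → k` (with maps `i : B → A` and `p : A → H`) is a central exact sequence of Hopf
algebras: `i` is injective, `p` is surjective, `ker p = A i(B)⁺`, `i(B)` is the algebra of right and
of left `p`-coinvariants in `A`, and `i(B)` is central in `A`. -/
structure IsCentralExtension {k : Type*} [Field k] {B A H : Type*} [Ring B] [HopfAlgebra k B]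
    [Ring A] [HopfAlgebra k A] [Ring H] [HopfAlgebra k H] (i : B →ₐc[k] A) (p : A →ₐc[k] H) :
    Prop where
  injective : Function.Injective i
  surjective : Function.Surjective p
  ker_eq : {a : A | p a = 0} =
    Ideal.span (i '' {b : B | Coalgebra.counit (R := k) b = 0})
  range_eq_right : Set.range i =
    {a : A | (p : A →ₗ[k] H).lTensor A (Coalgebra.comul (R := k) a) = a ⊗ₜ[k] 1}
  range_eq_left : Set.range i =
    {a : A | (p : A →ₗ[k] H).rTensor A (Coalgebra.comul (R := k) a) = 1 ⊗ₜ[k] a}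
  central : ∀ b a, i b * a = a * i b

/-!
Only the fusion rules of the Tambara–Yamagami category and the existence of a monoidal equivalence
enter the argument; the associativity constraint of `C(G, χ, r)` is never used, since the data it
carries are recovered from `A`.

A semisimple Hopf algebra is finite-dimensional (`finite_of_isSemisimpleRing`), because a normalized
integral gives a separability idempotent. The simple objects of `C(G, χ, r)` correspond to
characters `ψ g` of `A`, `g ∈ G`, and one further irreducible representation `V`; by the double
commutant theorem `A` is `k^G × End V`, and the fusion rules give isomorphisms
`L g : ψ g ⊗ V ≅ V`, `R g : V ⊗ ψ g ≅ V` and `B : V ⊗ V ≅ ⊕ ψ g`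
(`HopfRep.nonempty_tambaraYamagamiReps`).

By Schur's lemma the operators `L g` and `R g` are projective representations of `G` on `V`, which
commute with each other up to a bicharacter `c`. The component `B_1` is a nondegenerate pairing on
`V`, and the pairings `B_1 (L g v ⊗ w)` are proportional to the different components of `B`; hence
the `L g` are a basis of `End V`, and every `R g` is proportional to some `L (dual g)`
(`exists_r_eq_smul_l`). The identification `V ⊗ (ψ g ⊗ V) = (V ⊗ ψ g) ⊗ V` says that `R g` is, up to
a scalar, the adjoint of `L g` for `B_1`. It follows that `dual` is an involution and that `c` is
symmetric and nondegenerate (`c_symm`, `eq_one_of_c_eq_one`). Therefore the elements `sect g` of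
`A`, which act by `c x g` on `ψ x` and by `L g` on `V`, form, together with the two central
idempotents of the decomposition `k^G × End V`, an explicit presentation of `A` as a cleft central
extension of `kG` by `k^(ℤ/2)` (`TambaraYamagamiReps.cleftData`): the products and coproducts of the
`sect g` are given by scalars `σ` and `τ` and by the action of `ℤ/2` on `G` through
`g ↦ dual g⁻¹`.

Both conclusions hold for all such cleft extensions of `kG` by `k^Q`, for `G` abelian and `Q` a
finite group acting on `G` (`CleftData`). The exactness is read off the basis `d t * u g`
(`CleftData.isCentralExtension`). For the second one, the (co)associativity identities for `σ` and
`τ` show that they combine to a 3-cocycle `ω` on `Γ = G ⋊ Q` (`CleftData.threeCocycle`),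
which is trivial on `G`, so that one can take `F = G` and `α = 1`. The functor `X ↦ kG ⊗ X` from
representations of `A` to `Vec^Γ_ω` is lax monoidal, with `kG` as the image of the unit object, so
its values are `kG`-bimodules. The tensor product over `kG` is computed by a split coequalizer,
which makes the functor to bimodules monoidal (`LaxBimod.coreMonoidal`). It is an equivalence: a
bimodule is free as a left module over its components of degree in `Q`, and on these the right
action, corrected by the left action, is a representation of `A`
(`CleftData.isGroupTheoretical`).
-/

set_option linter.unusedSectionVars false

/-! ### Bimodules from a lax monoidal functor -/

namespace LaxBimod

universe v₁ v₂ u₁ u₂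

open Functor.LaxMonoidal MonObj

variable {C : Type u₁} [Category.{v₁} C] [MonoidalCategory C] {V : Type u₂} [Category.{v₂} V]
  [MonoidalCategory V]

/-- A lax monoidal functor together with a monoid `B` identified, as a monoid, with the image of
the unit object. -/
structure Data (C : Type u₁) [Category.{v₁} C] [MonoidalCategory C] (V : Type u₂)
    [Category.{v₂} V] [MonoidalCategory V] where
  T : C ⥤ V
  [lax : T.LaxMonoidal]
  B : Mon V
  φ : B.X ≅ T.obj (𝟙_ C)
  one_φ : η[B.X] ≫ φ.hom = ε T
  mul_φ : μ[B.X] ≫ φ.hom = (φ.hom ⊗ₘ φ.hom) ≫ Functor.LaxMonoidal.μ T _ _ ≫ T.map (λ_ _).hom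

attribute [instance] Data.lax

variable (d : Data C V)

local notation "mu" => Functor.LaxMonoidal.μ

/-- The left action of `B` on the value of the functor at `X`. -/
def actL (X : C) : d.B.X ⊗ d.T.obj X ⟶ d.T.obj X :=
  d.φ.hom ▷ d.T.obj X ≫ mu d.T _ _ ≫ d.T.map (λ_ X).hom

/-- The right action of `B` on the value of the functor at `X`. -/
def actR (X : C) : d.T.obj X ⊗ d.B.X ⟶ d.T.obj X :=
  d.T.obj X ◁ d.φ.hom ≫ mu d.T _ _ ≫ d.T.map (ρ_ X).hom

theorem actL_natural {X Y : C} (f : X ⟶ Y) :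
    actL d X ≫ d.T.map f = d.B.X ◁ d.T.map f ≫ actL d Y := by
  simp [actL, whisker_exchange_assoc, ← Functor.map_comp]

theorem actR_natural {X Y : C} (f : X ⟶ Y) :
    actR d X ≫ d.T.map f = d.T.map f ▷ d.B.X ≫ actR d Y := by
  simp [actR, ← whisker_exchange_assoc, ← Functor.map_comp]

theorem actL_mu (X Y : C) : actL d X ▷ d.T.obj Y ≫ mu d.T X Y =
    (α_ _ _ _).hom ≫ d.B.X ◁ mu d.T X Y ≫ actL d (X ⊗ Y) := by
  simp only [actL, comp_whiskerRight, Category.assoc, μ_natural_left, leftUnitor_whiskerRight,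
    Functor.map_comp, associativity_assoc]
  rw [associator_naturality_left_assoc, whisker_exchange_assoc]

theorem mu_actR (X Y : C) : d.T.obj X ◁ actR d Y ≫ mu d.T X Y =
    (α_ _ _ _).inv ≫ mu d.T X Y ▷ d.B.X ≫ actR d (X ⊗ Y) := by
  simp only [actR, MonoidalCategory.whiskerLeft_comp, Category.assoc, μ_natural_right,
    whiskerLeft_rightUnitor, Functor.map_comp, associativity_inv_assoc]
  rw [associator_inv_naturality_right_assoc, ← whisker_exchange_assoc]

/-- The lax structure is balanced over `B`, so that it factors through the tensor product over
`B`. -/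
theorem actR_mu (X Y : C) : actR d X ▷ d.T.obj Y ≫ mu d.T X Y =
    ((α_ _ _ _).hom ≫ d.T.obj X ◁ actL d Y) ≫ mu d.T X Y := by
  simp only [actL, actR, MonoidalCategory.whiskerLeft_comp, comp_whiskerRight, Category.assoc,
    μ_natural_right, μ_natural_left, ← triangle, Functor.map_comp, associativity_assoc]
  rw [associator_naturality_middle_assoc]

theorem mul_φ_left : μ[d.B.X] ≫ d.φ.hom = d.B.X ◁ d.φ.hom ≫ actL d (𝟙_ C) := by
  rw [d.mul_φ, actL, MonoidalCategory.tensorHom_def', Category.assoc]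

theorem mul_φ_right : μ[d.B.X] ≫ d.φ.hom = d.φ.hom ▷ d.B.X ≫ actR d (𝟙_ C) := by
  rw [d.mul_φ, actR, MonoidalCategory.tensorHom_def, Category.assoc, unitors_equal]

/-- The image of an object under a lax monoidal functor is a bimodule over the image of the unit
object. -/
def obj (X : C) : Bimod d.B d.B where
  X := d.T.obj X
  actLeft := actL d X
  actRight := actR d X
  one_actLeft := by
    rw [actL, ← comp_whiskerRight_assoc, d.one_φ, left_unitality]
  actRight_one := by
    rw [actR, ← whiskerLeft_comp_assoc, d.one_φ, right_unitality]
  left_assoc := by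
    conv_lhs => rw [actL]
    rw [← comp_whiskerRight_assoc, mul_φ_left, comp_whiskerRight_assoc,
      reassoc_of% actL_mu d (𝟙_ C) X,
      actL_natural, actL]
    simp
  right_assoc := by
    conv_lhs => rw [actR]
    rw [← whiskerLeft_comp_assoc, mul_φ_right, whiskerLeft_comp_assoc,
      reassoc_of% mu_actR d X (𝟙_ C),
      actR_natural, actR]
    simp
  middle_assoc := by
    conv_lhs => rw [actR]
    rw [← whisker_exchange_assoc, reassoc_of% actL_mu d X (𝟙_ C), actL_natural, actR]
    simp

/-- The functor from `C` to bimodules defined by a lax monoidal functor. -/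
def functor : C ⥤ Bimod d.B d.B where
  obj := obj d
  map f := ⟨d.T.map f, actL_natural d f, actR_natural d f⟩
  map_id X := by apply Bimod.hom_ext; exact d.T.map_id X
  map_comp f g := by apply Bimod.hom_ext; exact d.T.map_comp f g

section Diagrams

/-- A map `c` out of a quotient of `x ⊗ y` is linear for left actions of `b` if its composite with
the projection is. -/
theorem left_of_epi {b x y p r : V} {q : x ⊗ y ⟶ p} [Epi (b ◁ q)] {aP : b ⊗ p ⟶ p}
    {a : b ⊗ x ⟶ x} {m : x ⊗ y ⟶ r} {c : p ⟶ r} {a' : b ⊗ r ⟶ r}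
    (h1 : b ◁ q ≫ aP = (α_ _ _ _).inv ≫ a ▷ y ≫ q) (h2 : q ≫ c = m)
    (h3 : a ▷ y ≫ m = (α_ _ _ _).hom ≫ b ◁ m ≫ a') : aP ≫ c = b ◁ c ≫ a' := by
  rw [← cancel_epi (b ◁ q), reassoc_of% h1, ← whiskerLeft_comp_assoc, h2, h3]
  simp

/-- A map `c` out of a quotient of `x ⊗ y` is linear for right actions of `b` if its composite
with the projection is. -/
theorem right_of_epi {b x y p r : V} {q : x ⊗ y ⟶ p} [Epi (q ▷ b)] {aP : p ⊗ b ⟶ p}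
    {a : y ⊗ b ⟶ y} {m : x ⊗ y ⟶ r} {c : p ⟶ r} {a' : r ⊗ b ⟶ r}
    (h1 : q ▷ b ≫ aP = (α_ _ _ _).hom ≫ x ◁ a ≫ q) (h2 : q ≫ c = m)
    (h3 : x ◁ a ≫ m = (α_ _ _ _).inv ≫ m ▷ b ≫ a') : aP ≫ c = c ▷ b ≫ a' := by
  rw [← cancel_epi (q ▷ b), reassoc_of% h1, ← comp_whiskerRight_assoc, h2, h3]
  simp

omit [MonoidalCategory V] in
theorem natural_of_cover {x x' p p' r r' : V} {q : x ⟶ p} {q' : x' ⟶ p'} {a : p ⟶ p'}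
    {f : x ⟶ x'} {c : p ⟶ r} {c' : p' ⟶ r'} {m : x ⟶ r} {m' : x' ⟶ r'} {g : r ⟶ r'}
    (h1 : q ≫ a = f ≫ q') (h2 : q' ≫ c' = m') (h3 : q ≫ c = m) (h4 : f ≫ m' = m ≫ g) :
    q ≫ (a ≫ c') = q ≫ (c ≫ g) := by
  rw [reassoc_of% h1, reassoc_of% h3, h2, h4]

omit [MonoidalCategory V] in
theorem unit_of_cover {x x' p p' r s : V} {q : x ⟶ p} {q' : x' ⟶ p'} {a : p ⟶ p'}
    {f : x ⟶ x'} {c : p' ⟶ r} {m : x' ⟶ r} {g : r ⟶ s} {l : p ⟶ s} {act : x ⟶ s}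
    (h0 : q ≫ l = act) (h1 : q ≫ a = f ≫ q') (h2 : q' ≫ c = m) (h3 : act = f ≫ m ≫ g) :
    q ≫ l = q ≫ (a ≫ c ≫ g) := by
  rw [h0, reassoc_of% h1, reassoc_of% h2, h3]

/-- The associativity hexagon of `c` may be checked on `(x ⊗ y) ⊗ z`, where it is the
associativity `h8` of the `m`; here `p`, `p₁`, … are quotients of tensor products with projections
`q`, `q₁`, …, and `c`, `c₂`, … are the maps through which `m₁`, `m₂`, … factor. -/
theorem assoc_of_cover {x y z p p₁ p₂ p₃ p₄ r s t u w : V} {q : x ⊗ y ⟶ p} [Epi (q ▷ z)]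
    {q₁ : p ⊗ z ⟶ p₁} {a : p₁ ⟶ p₂} {c : p ⟶ r} {q₂ : r ⊗ z ⟶ p₂} {c₂ : p₂ ⟶ s} {g : s ⟶ t}
    {a₃ : p₁ ⟶ p₃} {u₁ : y ⊗ z ⟶ u} {q₃ : x ⊗ u ⟶ p₃} {a₄ : p₃ ⟶ p₄} {c₃ : u ⟶ w}
    {q₄ : x ⊗ w ⟶ p₄} {c₄ : p₄ ⟶ t} {m₁ : x ⊗ y ⟶ r} {m₂ : r ⊗ z ⟶ s} {m₃ : y ⊗ z ⟶ w}
    {m₄ : x ⊗ w ⟶ t} (h1 : q₁ ≫ a = c ▷ z ≫ q₂) (h2 : q₂ ≫ c₂ = m₂) (h3 : q ≫ c = m₁)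
    (h4 : q ▷ z ≫ q₁ ≫ a₃ = (α_ _ _ _).hom ≫ x ◁ u₁ ≫ q₃) (h5 : q₃ ≫ a₄ = x ◁ c₃ ≫ q₄)
    (h6 : u₁ ≫ c₃ = m₃) (h7 : q₄ ≫ c₄ = m₄)
    (h8 : m₁ ▷ z ≫ m₂ ≫ g = (α_ _ _ _).hom ≫ x ◁ m₃ ≫ m₄) :
    q₁ ≫ (a ≫ c₂ ≫ g) = q₁ ≫ (a₃ ≫ a₄ ≫ c₄) := by
  rw [← cancel_epi (q ▷ z), reassoc_of% h1, reassoc_of% h2, ← comp_whiskerRight_assoc, h3, h8,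
    reassoc_of% h4, reassoc_of% h5, h7, ← whiskerLeft_comp_assoc, h6]

omit [MonoidalCategory V] in
/-- If `s` and `t` split the fork `f`, `g`, `m` and the epimorphism `q` coequalizes `f` and `g`,
then the map `c` through which `m` factors is invertible. -/
theorem isIso_of_split {x z p r : V} {q : x ⟶ p} [Epi q] {c : p ⟶ r} {m : x ⟶ r} {s : r ⟶ x}
    {t : x ⟶ z} {f g : z ⟶ x} (h0 : q ≫ c = m) (h1 : s ≫ m = 𝟙 _) (h2 : t ≫ f = m ≫ s)
    (h3 : t ≫ g = 𝟙 _) (h4 : f ≫ q = g ≫ q) : IsIso c := by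
  refine ⟨s ≫ q, ?_, by rw [Category.assoc, h0, h1]⟩
  rw [← cancel_epi q, reassoc_of% h0, ← reassoc_of% h2, h4, reassoc_of% h3, Category.comp_id]

end Diagrams

variable [HasCoequalizers V] [∀ X : V, PreservesColimitsOfSize.{0, 0} (tensorLeft X)]
  [∀ X : V, PreservesColimitsOfSize.{0, 0} (tensorRight X)]

/-- The canonical epimorphism onto the tensor product over a monoid. -/
noncomputable def proj {A₁ A₂ A₃ : Mon V} (M : Bimod A₁ A₂) (N : Bimod A₂ A₃) :
    M.X ⊗ N.X ⟶ (M.tensorBimod N).X :=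
  coequalizer.π (M.actRight ▷ N.X) ((α_ _ _ _).hom ≫ M.X ◁ N.actLeft)

instance {A₁ A₂ A₃ : Mon V} (M : Bimod A₁ A₂) (N : Bimod A₂ A₃) : Epi (proj M N) :=
  inferInstanceAs (Epi (coequalizer.π _ _))

instance (Z : V) {A₁ A₂ A₃ : Mon V} (M : Bimod A₁ A₂) (N : Bimod A₂ A₃) : Epi (proj M N ▷ Z) :=
  inferInstanceAs (Epi ((tensorRight Z).map (coequalizer.π (M.actRight ▷ N.X)
    ((α_ _ _ _).hom ≫ M.X ◁ N.actLeft))))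

instance (Z : V) {A₁ A₂ A₃ : Mon V} (M : Bimod A₁ A₂) (N : Bimod A₂ A₃) : Epi (Z ◁ proj M N) :=
  inferInstanceAs (Epi ((tensorLeft Z).map (coequalizer.π (M.actRight ▷ N.X)
    ((α_ _ _ _).hom ≫ M.X ◁ N.actLeft))))

section TensorProduct

variable {A₁ A₂ A₃ A₄ : Mon V}

theorem proj_whiskerRight {M M' : Bimod A₁ A₂} (f : M ⟶ M') (N : Bimod A₂ A₃) :
    proj M N ≫ (Bimod.whiskerRight f N).hom = f.hom ▷ N.X ≫ proj M' N :=
  ι_colimMap _ _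

theorem proj_whiskerLeft (M : Bimod A₁ A₂) {N N' : Bimod A₂ A₃} (f : N ⟶ N') :
    proj M N ≫ (Bimod.whiskerLeft M f).hom = M.X ◁ f.hom ≫ proj M N' :=
  ι_colimMap _ _

theorem proj_associator (L : Bimod A₁ A₂) (M : Bimod A₂ A₃) (N : Bimod A₃ A₄) :
    proj L M ▷ N.X ≫ proj (L.tensorBimod M) N ≫ (Bimod.associatorBimod L M N).hom.hom =
      (α_ _ _ _).hom ≫ L.X ◁ proj M N ≫ proj L (M.tensorBimod N) := by
  have h1 : proj (L.tensorBimod M) N ≫ (Bimod.associatorBimod L M N).hom.hom =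
      Bimod.AssociatorBimod.homAux L M N := coequalizer.π_desc _ _
  exact (congrArg (proj L M ▷ N.X ≫ ·) h1).trans
    (π_tensor_id_preserves_coequalizer_inv_desc _ _ _ _)

theorem proj_leftUnitor (M : Bimod A₁ A₂) :
    proj (Bimod.regular A₁) M ≫ (Bimod.leftUnitorBimod M).hom.hom = M.actLeft :=
  coequalizer.π_desc _ _

theorem proj_rightUnitor (M : Bimod A₁ A₂) :
    proj M (Bimod.regular A₂) ≫ (Bimod.rightUnitorBimod M).hom.hom = M.actRight :=
  coequalizer.π_desc _ _

theorem tensor_hom_ext {M : Bimod A₁ A₂} {N : Bimod A₂ A₃} {P : Bimod A₁ A₃}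
    {f g : M.tensorBimod N ⟶ P} (h : proj M N ≫ f.hom = proj M N ≫ g.hom) : f = g := by
  apply Bimod.hom_ext
  exact coequalizer.hom_ext h

end TensorProduct

/-- The lax structure descends to the tensor product over `B`. -/
noncomputable def comparison (X Y : C) :
    ((obj d X).tensorBimod (obj d Y)).X ⟶ d.T.obj (X ⊗ Y) :=
  coequalizer.desc (mu d.T X Y) (actR_mu d X Y)

theorem proj_comparison (X Y : C) :
    proj (obj d X) (obj d Y) ≫ comparison d X Y = mu d.T X Y :=
  coequalizer.π_desc _ _

/-- If the lax structure and the two actions form a split coequalizer, then the comparison map is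
invertible. -/
theorem isIso_comparison_of_split {X Y : C} (s : d.T.obj (X ⊗ Y) ⟶ d.T.obj X ⊗ d.T.obj Y)
    (t : d.T.obj X ⊗ d.T.obj Y ⟶ (d.T.obj X ⊗ d.B.X) ⊗ d.T.obj Y) (h1 : s ≫ mu d.T X Y = 𝟙 _)
    (h2 : t ≫ actR d X ▷ d.T.obj Y = mu d.T X Y ≫ s)
    (h3 : t ≫ (α_ _ _ _).hom ≫ d.T.obj X ◁ actL d Y = 𝟙 _) : IsIso (comparison d X Y) :=
  isIso_of_split (q := proj (obj d X) (obj d Y)) (proj_comparison d X Y) h1 h2 h3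
    (coequalizer.condition _ _)

variable [hc : ∀ X Y, IsIso (comparison d X Y)]

/-- The comparison map as an isomorphism of bimodules, if it is invertible. -/
noncomputable def comparisonIso (X Y : C) :
    (obj d X).tensorBimod (obj d Y) ≅ obj d (X ⊗ Y) :=
  Bimod.isoOfIso (Q := obj d (X ⊗ Y)) (@asIso _ _ _ _ (comparison d X Y) (hc X Y))
    (left_of_epi (q := proj (obj d X) (obj d Y))
      (Bimod.TensorBimod.whiskerLeft_π_actLeft (obj d X) (obj d Y)) (proj_comparison d X Y)
      (actL_mu d X Y))
    (right_of_epi (q := proj (obj d X) (obj d Y))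
      (Bimod.TensorBimod.π_tensor_id_actRight (obj d X) (obj d Y)) (proj_comparison d X Y)
      (mu_actR d X Y))

/-- The unit bimodule `B` is the image of the unit object. -/
def unitIso : Bimod.regular d.B ≅ obj d (𝟙_ C) :=
  Bimod.isoOfIso (P := Bimod.regular d.B) (Q := obj d (𝟙_ C)) d.φ (mul_φ_left d) (mul_φ_right d)

theorem comparison_natural_left {X Y : C} (f : X ⟶ Y) (Z : C) :
    Bimod.whiskerRight ((functor d).map f) (obj d Z) ≫ (comparisonIso d Y Z).hom =
      (comparisonIso d X Z).hom ≫ (functor d).map (f ▷ Z) :=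
  tensor_hom_ext (natural_of_cover (proj_whiskerRight ((functor d).map f) (obj d Z))
    (proj_comparison d Y Z) (proj_comparison d X Z) (μ_natural_left d.T f Z))

theorem comparison_natural_right {X Y : C} (Z : C) (f : X ⟶ Y) :
    Bimod.whiskerLeft (obj d Z) ((functor d).map f) ≫ (comparisonIso d Z Y).hom =
      (comparisonIso d Z X).hom ≫ (functor d).map (Z ◁ f) :=
  tensor_hom_ext (natural_of_cover (proj_whiskerLeft (obj d Z) ((functor d).map f))
    (proj_comparison d Z Y) (proj_comparison d Z X) (μ_natural_right d.T Z f))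

theorem comparison_assoc (X Y Z : C) :
    Bimod.whiskerRight (comparisonIso d X Y).hom (obj d Z) ≫ (comparisonIso d (X ⊗ Y) Z).hom ≫
      (functor d).map (α_ X Y Z).hom = (Bimod.associatorBimod (obj d X) (obj d Y) (obj d Z)).hom ≫
        Bimod.whiskerLeft (obj d X) (comparisonIso d Y Z).hom ≫
          (comparisonIso d X (Y ⊗ Z)).hom :=
  tensor_hom_ext (assoc_of_cover (q := proj (obj d X) (obj d Y))
    (proj_whiskerRight (comparisonIso d X Y).hom (obj d Z)) (proj_comparison d (X ⊗ Y) Z)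
    (proj_comparison d X Y) (proj_associator (obj d X) (obj d Y) (obj d Z))
    (proj_whiskerLeft (obj d X) (comparisonIso d Y Z).hom) (proj_comparison d Y Z)
    (proj_comparison d X (Y ⊗ Z)) (associativity d.T X Y Z))

theorem comparison_left_unit (X : C) :
    (Bimod.leftUnitorBimod (obj d X)).hom = Bimod.whiskerRight (unitIso d).hom (obj d X) ≫
      (comparisonIso d (𝟙_ C) X).hom ≫ (functor d).map (λ_ X).hom :=
  tensor_hom_ext (unit_of_cover (proj_leftUnitor (obj d X))
    (proj_whiskerRight (unitIso d).hom (obj d X)) (proj_comparison d (𝟙_ C) X) rfl)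

theorem comparison_right_unit (X : C) :
    (Bimod.rightUnitorBimod (obj d X)).hom = Bimod.whiskerLeft (obj d X) (unitIso d).hom ≫
      (comparisonIso d X (𝟙_ C)).hom ≫ (functor d).map (ρ_ X).hom :=
  tensor_hom_ext (unit_of_cover (proj_rightUnitor (obj d X))
    (proj_whiskerLeft (obj d X) (unitIso d).hom) (proj_comparison d X (𝟙_ C)) rfl)

end LaxBimod

section GradedBimodules

variable {k : Type u} [Field k] {Γ : Type} [Group Γ] [Fintype Γ] {c : ThreeCocycle k Γ}
  {C : Type w} [Category.{v} C] [MonoidalCategory C]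

/-- A lax monoidal functor to `Vec^Γ_ω` whose comparison maps are invertible defines a monoidal
functor to bimodules. -/
noncomputable def LaxBimod.coreMonoidal (d : LaxBimod.Data C (GradedVec c))
    [∀ X Y, IsIso (LaxBimod.comparison d X Y)] :
    letI := GradedVec.bimodMonoidal d.B
    (LaxBimod.functor d).CoreMonoidal :=
  letI := GradedVec.bimodMonoidal d.B
  { εIso := LaxBimod.unitIso d
    μIso := LaxBimod.comparisonIso d
    μIso_hom_natural_left := LaxBimod.comparison_natural_left d
    μIso_hom_natural_right := fun Z f => LaxBimod.comparison_natural_right d Z f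
    associativity := LaxBimod.comparison_assoc d
    left_unitality := LaxBimod.comparison_left_unit d
    right_unitality := LaxBimod.comparison_right_unit d }

end GradedBimodules

/-! ### Cleft central extensions by a function algebra -/

/-- A Hopf algebra `A` presented as a cleft central extension of a group algebra `kG`, `G` abelian,
by a function algebra `k^Q`: the elements `d t` are the images of the `δ_t`, the elements `u g` lift
the elements of `G`, and the failure of `u` to be multiplicative, respectively compatible with
the comultiplication, is measured by scalars `σ`, respectively `τ`, and the action `φ`. -/
structure CleftData (k : Type*) [Field k] (A : Type*) [Ring A] [HopfAlgebra k A] {Q G : Type*}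
    [Group Q] [Fintype Q] [CommGroup G] [Fintype G] (φ : Q →* MulAut G) where
  d : Q → A
  u : G → A
  σ : Q → G → G → kˣ
  τ : G → Q → Q → kˣ
  d_mul_self : ∀ t, d t * d t = d t
  d_mul_ne : ∀ s t, s ≠ t → d s * d t = 0
  sum_d : ∑ t, d t = 1
  d_comm : ∀ t a, d t * a = a * d t
  u_one : u 1 = 1
  u_mul : ∀ g h, u g * u h = ∑ t, (σ t g h : k) • (d t * u (g * h))
  comul_d : ∀ t, Coalgebra.comul (R := k) (d t) = ∑ s, d s ⊗ₜ[k] d (s⁻¹ * t)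
  comul_u : ∀ g, Coalgebra.comul (R := k) (u g) =
    ∑ t, ∑ s, (τ g t s : k) • ((d t * u (φ s g)) ⊗ₜ[k] (d s * u g))
  counit_d_one : Coalgebra.counit (R := k) (d 1) = 1
  counit_u : ∀ g, Coalgebra.counit (R := k) (u g) = 1
  basis : Module.Basis (Q × G) k A
  basis_apply : ∀ t g, basis (t, g) = d t * u g

namespace CleftData

variable {k : Type*} [Field k] {A : Type*} [Ring A] [HopfAlgebra k A] {Q G : Type*}
    [Group Q] [Fintype Q] [CommGroup G] [Fintype G] {φ : Q →* MulAut G} (C : CleftData k A φ)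

open Coalgebra

open Classical in
theorem d_mul (s t : Q) : C.d s * C.d t = if s = t then C.d s else 0 := by
  split_ifs with h
  · rw [h, C.d_mul_self]
  · exact C.d_mul_ne s t h

open Classical in
theorem counit_d (t : Q) : counit (R := k) (C.d t) = if t = 1 then 1 else 0 := by
  split_ifs with h
  · rw [h, C.counit_d_one]
  · have := congrArg (counit (R := k)) (C.d_mul_ne t 1 h)
    simpa [C.counit_d_one] using this

theorem d_u_ne_zero (t : Q) (g : G) : C.d t * C.u g ≠ 0 := by
  rw [← C.basis_apply]
  exact C.basis.ne_zero _

theorem smul_cancel {t : Q} {g : G} {a b : k} (h : a • (C.d t * C.u g) = b • (C.d t * C.u g)) :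
    a = b :=
  smul_left_injective k (C.d_u_ne_zero t g) h

theorem tmul_ne_zero {V W : Type*} [AddCommGroup V] [Module k V] [AddCommGroup W] [Module k W]
    {v : V} {w : W} (hv : v ≠ 0) (hw : w ≠ 0) : v ⊗ₜ[k] w ≠ 0 := by
  intro h
  have hf := mt (Module.forall_dual_apply_eq_zero_iff k v).1 hv
  have hg := mt (Module.forall_dual_apply_eq_zero_iff k w).1 hw
  push Not at hf hg
  obtain ⟨f, hf⟩ := hf
  obtain ⟨g, hg⟩ := hg
  have := congrArg (fun x => TensorProduct.lid k k (TensorProduct.map f g x)) h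
  simp [hf, hg] at this

theorem d_mul_u_mul (t : Q) (g h : G) :
    C.d t * (C.u g * C.u h) = (C.σ t g h : k) • (C.d t * C.u (g * h)) := by
  classical
  rw [C.u_mul, Finset.mul_sum, Finset.sum_eq_single t]
  · rw [mul_smul_comm, ← mul_assoc, C.d_mul_self]
  · intro s _ hs
    rw [mul_smul_comm, ← mul_assoc, C.d_mul_ne t s hs.symm, zero_mul, smul_zero]
  · simp

theorem du_mul_du (t : Q) (g h : G) : (C.d t * C.u g) * (C.d t * C.u h) =
    (C.σ t g h : k) • (C.d t * C.u (g * h)) := by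
  rw [← d_mul_u_mul, mul_assoc, ← mul_assoc (C.u g), ← C.d_comm t (C.u g), ← mul_assoc,
    ← mul_assoc, C.d_mul_self, mul_assoc]

theorem du_mul_du_ne {s t : Q} (hst : s ≠ t) (g h : G) :
    (C.d s * C.u g) * (C.d t * C.u h) = 0 := by
  rw [mul_assoc, ← mul_assoc (C.u g), ← C.d_comm t (C.u g), ← mul_assoc,
    ← mul_assoc, C.d_mul_ne s t hst, zero_mul, zero_mul]

theorem sum_d_mul (a : A) : ∑ t, C.d t * a = a := by
  rw [← Finset.sum_mul, C.sum_d, one_mul]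

theorem σ_one_left (g h : G) : C.σ 1 g h = 1 := by
  have := congrArg (counit (R := k)) (C.d_mul_u_mul 1 g h)
  simp only [Bialgebra.counit_mul, C.counit_u, C.counit_d_one, map_smul, smul_eq_mul] at this
  exact Units.ext (by simpa using this.symm)

theorem σ_one_mid (t : Q) (h : G) : C.σ t 1 h = 1 := by
  have := C.d_mul_u_mul t 1 h
  rw [C.u_one, one_mul, one_mul] at this
  exact Units.ext (C.smul_cancel (t := t) (g := h) (by rw [← this]; simp))

theorem σ_one_right (t : Q) (h : G) : C.σ t h 1 = 1 := by
  have := C.d_mul_u_mul t h 1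
  rw [C.u_one, mul_one, mul_one] at this
  exact Units.ext (C.smul_cancel (t := t) (g := h) (by rw [← this]; simp))

/-- Associativity of the product of three elements `u`: each `σ t` is a 2-cocycle on `G`. -/
theorem σ_cocycle (t : Q) (g h l : G) :
    C.σ t g h * C.σ t (g * h) l = C.σ t h l * C.σ t g (h * l) := by
  have h1 : C.d t * (C.u g * C.u h * C.u l) =
      ((C.σ t g h * C.σ t (g * h) l : kˣ) : k) • (C.d t * C.u (g * h * l)) := by
    rw [← mul_assoc, C.d_mul_u_mul, smul_mul_assoc, mul_assoc, C.d_mul_u_mul, smul_smul,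
      Units.val_mul]
  have h2 : C.d t * (C.u g * (C.u h * C.u l)) =
      ((C.σ t h l * C.σ t g (h * l) : kˣ) : k) • (C.d t * C.u (g * h * l)) := by
    rw [← mul_assoc, C.d_comm, mul_assoc, C.d_mul_u_mul, mul_smul_comm, ← mul_assoc, ← C.d_comm,
      mul_assoc, C.d_mul_u_mul, smul_smul, Units.val_mul, mul_assoc g]
  rw [mul_assoc (C.u g), h2] at h1
  exact Units.ext (C.smul_cancel h1).symm

theorem dd_mul_comul_d (t s : Q) :
    (C.d t ⊗ₜ[k] C.d s) * comul (R := k) (C.d (t * s)) = C.d t ⊗ₜ[k] C.d s := by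
  classical
  rw [C.comul_d, Finset.mul_sum, Finset.sum_eq_single t]
  · rw [Algebra.TensorProduct.tmul_mul_tmul, inv_mul_cancel_left, C.d_mul_self, C.d_mul_self]
  · intro r _ hr
    rw [Algebra.TensorProduct.tmul_mul_tmul, C.d_mul_ne t r hr.symm, zero_tmul]
  · simp

/-- The component of `Δ(u g)` in `d t A ⊗ d s A`. -/
theorem dd_mul_comul_u (t s : Q) (g : G) : (C.d t ⊗ₜ[k] C.d s) * comul (R := k) (C.u g) =
    (C.τ g t s : k) • ((C.d t * C.u (φ s g)) ⊗ₜ[k] (C.d s * C.u g)) := by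
  classical
  rw [C.comul_u, Finset.mul_sum, Finset.sum_eq_single t, Finset.mul_sum, Finset.sum_eq_single s]
  · rw [mul_smul_comm, Algebra.TensorProduct.tmul_mul_tmul, ← mul_assoc, ← mul_assoc, C.d_mul_self,
      C.d_mul_self]
  · intro r _ hr
    rw [mul_smul_comm, Algebra.TensorProduct.tmul_mul_tmul, ← mul_assoc, ← mul_assoc,
      C.d_mul_ne s r hr.symm, zero_mul, tmul_zero, smul_zero]
  · simp
  · intro r _ hr
    rw [Finset.mul_sum]
    refine Finset.sum_eq_zero fun r' _ => ?_
    rw [mul_smul_comm, Algebra.TensorProduct.tmul_mul_tmul, ← mul_assoc, ← mul_assoc,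
      C.d_mul_ne t r hr.symm, zero_mul, zero_tmul, smul_zero]
  · simp

theorem τ_one (t s : Q) : C.τ 1 t s = 1 := by
  have := C.dd_mul_comul_u t s 1
  rw [C.u_one, Bialgebra.comul_one, mul_one, map_one, C.u_one, mul_one, mul_one] at this
  refine Units.ext (smul_left_injective k (tmul_ne_zero (k := k) (C.d_u_ne_zero t 1)
    (C.d_u_ne_zero s 1)) ?_)
  simp only [C.u_one, mul_one, Units.val_one, one_smul]
  exact this.symm

theorem τ_left (g : G) (s : Q) : C.τ g 1 s = 1 := by
  classical
  have h := congrArg (TensorProduct.lid k A) (Coalgebra.rTensor_counit_comul (R := k) (C.u g))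
  rw [C.comul_u] at h
  simp only [map_sum, map_smul, LinearMap.rTensor_tmul, TensorProduct.lid_tmul,
    Bialgebra.counit_mul, C.counit_u, C.counit_d, mul_one] at h
  rw [Finset.sum_eq_single 1 (fun t _ ht => by simp [ht]) (by simp)] at h
  have h2 := congrArg (C.d s * ·) h
  simp only [if_true, one_smul, Finset.mul_sum, mul_smul_comm, ← mul_assoc, C.d_mul] at h2
  simp only [ite_mul, zero_mul, smul_ite, smul_zero, Finset.sum_ite_eq, Finset.mem_univ,
    if_true] at h2
  exact Units.ext (C.smul_cancel (t := s) (g := g) (by simpa using h2))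

theorem τ_right (g : G) (t : Q) : C.τ g t 1 = 1 := by
  classical
  have h := congrArg (TensorProduct.rid k A) (Coalgebra.lTensor_counit_comul (R := k) (C.u g))
  rw [C.comul_u] at h
  simp only [map_sum, map_smul, LinearMap.lTensor_tmul, TensorProduct.rid_tmul,
    Bialgebra.counit_mul, C.counit_u, C.counit_d, mul_one] at h
  rw [Finset.sum_comm] at h
  rw [Finset.sum_eq_single 1 (fun t _ ht => by simp [ht]) (by simp)] at h
  have h2 := congrArg (C.d t * ·) h
  simp only [if_true, one_smul, Finset.mul_sum, mul_smul_comm, ← mul_assoc, C.d_mul] at h2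
  simp only [ite_mul, zero_mul, smul_ite, smul_zero, Finset.sum_ite_eq, Finset.mem_univ,
    if_true] at h2
  exact Units.ext (C.smul_cancel (t := t) (g := g) (by simpa using h2))

theorem dd_comm (t s : Q) (x : A ⊗[k] A) :
    (C.d t ⊗ₜ[k] C.d s) * x = x * (C.d t ⊗ₜ[k] C.d s) := by
  induction x with
  | zero => simp
  | add x y hx hy => rw [mul_add, add_mul, hx, hy]
  | tmul x y => simp only [Algebra.TensorProduct.tmul_mul_tmul, C.d_comm]

theorem dd_mul_mul (t s : Q) (x y : A ⊗[k] A) : (C.d t ⊗ₜ[k] C.d s) * (x * y) =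
    ((C.d t ⊗ₜ[k] C.d s) * x) * ((C.d t ⊗ₜ[k] C.d s) * y) := by
  have hP : (C.d t ⊗ₜ[k] C.d s) * (C.d t ⊗ₜ[k] C.d s) = C.d t ⊗ₜ[k] C.d s := by
    rw [Algebra.TensorProduct.tmul_mul_tmul, C.d_mul_self, C.d_mul_self]
  conv_lhs => rw [← hP]
  rw [mul_assoc (C.d t ⊗ₜ[k] C.d s) x, ← mul_assoc x _ y, ← C.dd_comm t s x]
  simp only [mul_assoc]

theorem tmul_smul_cancel {t s : Q} {g h : G} {a b : k}
    (H : a • ((C.d t * C.u g) ⊗ₜ[k] (C.d s * C.u h)) =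
      b • ((C.d t * C.u g) ⊗ₜ[k] (C.d s * C.u h))) : a = b :=
  smul_left_injective k (tmul_ne_zero (C.d_u_ne_zero t g) (C.d_u_ne_zero s h)) H

/-- The comultiplication is multiplicative on the elements `u`. -/
theorem τ_mul (t s : Q) (g h : G) :
    C.τ g t s * C.τ h t s * (C.σ t (φ s g) (φ s h) * C.σ s g h) =
      C.σ (t * s) g h * C.τ (g * h) t s := by
  have h1 : (C.d t ⊗ₜ[k] C.d s) * comul (R := k) (C.u g * C.u h) =
      ((C.τ g t s * C.τ h t s * (C.σ t (φ s g) (φ s h) * C.σ s g h) : kˣ) : k) •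
        ((C.d t * C.u (φ s (g * h))) ⊗ₜ[k] (C.d s * C.u (g * h))) := by
    rw [Bialgebra.comul_mul, dd_mul_mul, dd_mul_comul_u, dd_mul_comul_u, smul_mul_smul_comm,
      Algebra.TensorProduct.tmul_mul_tmul, du_mul_du, du_mul_du, TensorProduct.smul_tmul_smul,
      smul_smul, map_mul]
    simp only [Units.val_mul]
  have h2 : (C.d t ⊗ₜ[k] C.d s) * comul (R := k) (C.u g * C.u h) =
      ((C.σ (t * s) g h * C.τ (g * h) t s : kˣ) : k) •
        ((C.d t * C.u (φ s (g * h))) ⊗ₜ[k] (C.d s * C.u (g * h))) := by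
    rw [← C.dd_mul_comul_d t s, mul_assoc, ← Bialgebra.comul_mul, d_mul_u_mul, map_smul,
      Bialgebra.comul_mul, mul_smul_comm, ← mul_assoc, dd_mul_comul_d, dd_mul_comul_u, smul_smul,
      Units.val_mul]
  exact Units.ext (C.tmul_smul_cancel (h1.symm.trans h2))

/-- Coassociativity at the elements `u`. -/
theorem τ_cocycle (g : G) (t r s : Q) :
    C.τ g (t * r) s * C.τ (φ s g) t r = C.τ g t (r * s) * C.τ g r s := by
  let f : A ⊗[k] A →ₐ[k] (A ⊗[k] A) ⊗[k] A :=
    Algebra.TensorProduct.map (Bialgebra.comulAlgHom k A) (AlgHom.id k A)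
  let f' : A ⊗[k] A →ₐ[k] A ⊗[k] (A ⊗[k] A) :=
    Algebra.TensorProduct.map (AlgHom.id k A) (Bialgebra.comulAlgHom k A)
  have hf : ∀ x y : A, f (x ⊗ₜ y) = comul (R := k) x ⊗ₜ[k] y := fun _ _ => rfl
  have hf' : ∀ x y : A, f' (x ⊗ₜ y) = x ⊗ₜ[k] comul (R := k) y := fun _ _ => rfl
  have h0 : Algebra.TensorProduct.assoc k k k A A A (f (comul (R := k) (C.u g))) =
      f' (comul (R := k) (C.u g)) := Coalgebra.coassoc_apply (C.u g)
  have h1 : ((C.d t ⊗ₜ[k] C.d r) ⊗ₜ[k] C.d s) * f (comul (R := k) (C.u g)) =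
      ((C.τ g (t * r) s * C.τ (φ s g) t r : kˣ) : k) •
        (((C.d t * C.u (φ r (φ s g))) ⊗ₜ[k] (C.d r * C.u (φ s g))) ⊗ₜ[k] (C.d s * C.u g)) := by
    have : (C.d t ⊗ₜ[k] C.d r) ⊗ₜ[k] C.d s =
        ((C.d t ⊗ₜ[k] C.d r) ⊗ₜ[k] C.d s) * f (C.d (t * r) ⊗ₜ C.d s) := by
      rw [hf, Algebra.TensorProduct.tmul_mul_tmul, dd_mul_comul_d, C.d_mul_self]
    rw [this, mul_assoc, ← map_mul, dd_mul_comul_u, map_smul, hf, mul_smul_comm,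
      Algebra.TensorProduct.tmul_mul_tmul, Bialgebra.comul_mul, ← mul_assoc, dd_mul_comul_d,
      dd_mul_comul_u, ← mul_assoc, C.d_mul_self, ← TensorProduct.smul_tmul', smul_smul,
      Units.val_mul]
  have h2 : (C.d t ⊗ₜ[k] (C.d r ⊗ₜ[k] C.d s)) * f' (comul (R := k) (C.u g)) =
      ((C.τ g t (r * s) * C.τ g r s : kˣ) : k) •
        ((C.d t * C.u (φ r (φ s g))) ⊗ₜ[k] ((C.d r * C.u (φ s g)) ⊗ₜ[k] (C.d s * C.u g))) := by
    have : C.d t ⊗ₜ[k] (C.d r ⊗ₜ[k] C.d s) =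
        (C.d t ⊗ₜ[k] (C.d r ⊗ₜ[k] C.d s)) * f' (C.d t ⊗ₜ C.d (r * s)) := by
      rw [hf', Algebra.TensorProduct.tmul_mul_tmul, dd_mul_comul_d, C.d_mul_self]
    rw [this, mul_assoc, ← map_mul, dd_mul_comul_u, map_smul, hf', mul_smul_comm,
      Algebra.TensorProduct.tmul_mul_tmul, Bialgebra.comul_mul, ← mul_assoc (C.d r ⊗ₜ[k] C.d s),
      dd_mul_comul_d, dd_mul_comul_u, ← mul_assoc, C.d_mul_self, TensorProduct.tmul_smul,
      smul_smul, Units.val_mul, map_mul]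
    rfl
  have h3 := congrArg (Algebra.TensorProduct.assoc k k k A A A) h1
  rw [map_mul, h0, map_smul, Algebra.TensorProduct.assoc_tmul, Algebra.TensorProduct.assoc_tmul,
    h2] at h3
  exact Units.ext (smul_left_injective k (tmul_ne_zero (C.d_u_ne_zero _ _)
    (tmul_ne_zero (C.d_u_ne_zero _ _) (C.d_u_ne_zero _ _))) h3.symm)

end CleftData

/-! ### The central exact sequence of a cleft extension -/

namespace CleftData

variable {k : Type*} [Field k] {A : Type*} [Ring A] [HopfAlgebra k A] {Q G : Type*}
    [Group Q] [Fintype Q] [CommGroup G] [Fintype G] {φ : Q →* MulAut G} (C : CleftData k A φ)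

open Coalgebra FunctionAlgebra

theorem basis_one_right (t : Q) : C.basis (t, 1) = C.d t := by
  rw [C.basis_apply, C.u_one, mul_one]

theorem comul_du (t : Q) (g : G) : comul (R := k) (C.d t * C.u g) =
    ∑ s, (C.τ g s (s⁻¹ * t) : k) •
      ((C.d s * C.u (φ (s⁻¹ * t) g)) ⊗ₜ[k] (C.d (s⁻¹ * t) * C.u g)) := by
  rw [Bialgebra.comul_mul, C.comul_d, Finset.sum_mul]
  exact Finset.sum_congr rfl fun s _ => C.dd_mul_comul_u _ _ _

open Classical in
theorem counit_du (t : Q) (g : G) :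
    counit (R := k) (C.d t * C.u g) = if t = 1 then 1 else 0 := by
  rw [Bialgebra.counit_mul, C.counit_u, mul_one, C.counit_d]

/-- The linear map `δ_t ↦ d t`. -/
noncomputable def inclLin : FunctionAlgebra k Q →ₗ[k] A where
  toFun f := ∑ t, f t • C.d t
  map_add' f g := by simp [add_eval, add_smul, Finset.sum_add_distrib]
  map_smul' c f := by simp [smul_eval, mul_smul, Finset.smul_sum]

theorem inclLin_apply (f : FunctionAlgebra k Q) : C.inclLin f = ∑ t, f t • C.d t := rfl

theorem inclLin_delta (t : Q) : C.inclLin (delta t) = C.d t := by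
  classical
  simp [inclLin_apply, delta_eval]

/-- The inclusion `k^Q → A` as a homomorphism of bialgebras. -/
noncomputable def incl : FunctionAlgebra k Q →ₐc[k] A :=
  BialgHom.ofAlgHom
    (AlgHom.ofLinearMap C.inclLin (by simp [inclLin_apply, one_eval, C.sum_d]) (fun f g => by
      classical
      simp only [inclLin_apply, Finset.sum_mul_sum, smul_mul_smul_comm, C.d_mul]
      simp [mul_eval]))
    (by
      apply AlgHom.toLinearMap_injective
      apply linearMap_ext
      intro t
      classical
      change counit (R := k) (C.inclLin (delta t)) = counit (R := k) (delta t : FunctionAlgebra k Q)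
      rw [inclLin_delta, C.counit_d, counit_eq, delta_eval]
      simp only [eq_comm])
    (by
      apply AlgHom.toLinearMap_injective
      apply linearMap_ext
      intro t
      change TensorProduct.map C.inclLin C.inclLin
        (comul (R := k) (delta t : FunctionAlgebra k Q)) =
        comul (R := k) (C.inclLin (delta t))
      rw [inclLin_delta, C.comul_d, comul_eq, comulHom_delta, map_sum]
      simp [inclLin_delta])

theorem incl_apply (f : FunctionAlgebra k Q) : C.incl f = ∑ t, f t • C.d t := rfl

theorem incl_delta (t : Q) : C.incl (delta t) = C.d t := C.inclLin_delta t

open Classical in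
/-- The linear map `d t * u g ↦ δ_{t, 1} g`. -/
noncomputable def projLin : A →ₗ[k] MonoidAlgebra k G :=
  C.basis.constr k fun x => if x.1 = 1 then MonoidAlgebra.of k G x.2 else 0

open Classical in
theorem projLin_du (t : Q) (g : G) :
    C.projLin (C.d t * C.u g) = if t = 1 then MonoidAlgebra.of k G g else 0 := by
  rw [← C.basis_apply, projLin, Module.Basis.constr_basis]

theorem projLin_mul (a b : A) : C.projLin (a * b) = C.projLin a * C.projLin b := by
  classical
  have : (LinearMap.mul k A).compr₂ C.projLin =
      (LinearMap.mul k (MonoidAlgebra k G)).compl₁₂ C.projLin C.projLin := by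
    refine LinearMap.ext_basis C.basis C.basis fun x y => ?_
    obtain ⟨t, g⟩ := x
    obtain ⟨s, h⟩ := y
    simp only [C.basis_apply, LinearMap.compr₂_apply, LinearMap.mul_apply',
      LinearMap.compl₁₂_apply, projLin_du]
    by_cases hts : t = s
    · subst hts
      rw [du_mul_du, map_smul, projLin_du]
      by_cases ht : t = 1
      · subst ht
        simp [C.σ_one_left]
      · simp [ht]
    · rw [C.du_mul_du_ne hts, map_zero]
      by_cases ht : t = 1
      · have : s ≠ 1 := fun h => hts (ht.trans h.symm)
        simp [this]
      · simp [ht]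
  exact LinearMap.congr_fun₂ this a b

theorem projLin_d (t : Q) [Decidable (t = 1)] : C.projLin (C.d t) = if t = 1 then 1 else 0 := by
  classical
  have := C.projLin_du t 1
  rw [C.u_one, mul_one] at this
  rw [this]
  split_ifs
  · exact map_one _
  · rfl

theorem projLin_one : C.projLin 1 = 1 := by
  classical
  rw [← C.sum_d, map_sum]
  simp [projLin_d]

/-- The projection `A → kG` as a homomorphism of bialgebras. -/
noncomputable def proj : A →ₐc[k] MonoidAlgebra k G :=
  BialgHom.ofAlgHom (AlgHom.ofLinearMap C.projLin C.projLin_one C.projLin_mul)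
    (by
      classical
      apply AlgHom.toLinearMap_injective
      refine C.basis.ext fun x => ?_
      obtain ⟨t, g⟩ := x
      rw [C.basis_apply]
      change counit (R := k) (C.projLin (C.d t * C.u g)) = counit (R := k) (C.d t * C.u g)
      rw [projLin_du, counit_du]
      split_ifs
      · simp
      · simp)
    (by
      classical
      apply AlgHom.toLinearMap_injective
      refine C.basis.ext fun x => ?_
      obtain ⟨t, g⟩ := x
      rw [C.basis_apply]
      change TensorProduct.map C.projLin C.projLin (comul (R := k) (C.d t * C.u g)) =
        comul (R := k) (C.projLin (C.d t * C.u g))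
      rw [comul_du, map_sum, projLin_du]
      simp only [map_smul, TensorProduct.map_tmul, projLin_du]
      rw [Finset.sum_eq_single 1 (fun s _ hs => by simp [hs]) (by simp)]
      by_cases ht : t = 1
      · subst ht
        simp [C.τ_left]
      · simp [ht])

theorem proj_apply (a : A) : C.proj a = C.projLin a := rfl

theorem lTensor_proj_comul_du (t : Q) (g : G) :
    C.projLin.lTensor A (comul (R := k) (C.d t * C.u g)) =
      (C.d t * C.u g) ⊗ₜ[k] MonoidAlgebra.of k G g := by
  classical
  rw [comul_du, map_sum]
  simp only [map_smul, LinearMap.lTensor_tmul, projLin_du]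
  rw [Finset.sum_eq_single t]
  · simp [C.τ_right]
  · intro s _ hs
    rw [if_neg (fun h => hs (inv_mul_eq_one.1 h)), tmul_zero, smul_zero]
  · simp

theorem rTensor_proj_comul_du (t : Q) (g : G) :
    C.projLin.rTensor A (comul (R := k) (C.d t * C.u g)) =
      MonoidAlgebra.of k G (φ t g) ⊗ₜ[k] (C.d t * C.u g) := by
  classical
  rw [comul_du, map_sum]
  simp only [map_smul, LinearMap.rTensor_tmul, projLin_du]
  rw [Finset.sum_eq_single 1 (fun s _ hs => by simp [hs]) (by simp)]
  simp [C.τ_left]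

open Classical in
/-- The linear map `d t * u g ↦ δ_{g, 1} δ_t`, a retraction of the inclusion of `k^Q`. -/
noncomputable def retr : A →ₗ[k] FunctionAlgebra k Q :=
  C.basis.constr k fun x => if x.2 = 1 then delta x.1 else 0

open Classical in
theorem incl_retr_du (t : Q) (g : G) :
    C.incl (C.retr (C.d t * C.u g)) = if g = 1 then C.d t * C.u g else 0 := by
  rw [← C.basis_apply, retr, Module.Basis.constr_basis]
  split_ifs with h
  · simp only at h
    rw [incl_delta, h, basis_one_right]
  · exact map_zero _

/-- The coefficient at `g` as a linear functional on the group algebra. -/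
noncomputable def _root_.MonoidAlgebra.coeffLin (k : Type*) [Field k] {G : Type*} [CommGroup G]
    (g : G) :
    MonoidAlgebra k G →ₗ[k] k where
  toFun x := x.coeff g
  map_add' _ _ := rfl
  map_smul' _ _ := rfl

omit [Fintype G] in
open Classical in
theorem _root_.MonoidAlgebra.coeffLin_of (g h : G) :
    MonoidAlgebra.coeffLin k g (MonoidAlgebra.of k G h) = if h = g then 1 else 0 := by
  change Finsupp.single h (1 : k) g = _
  rw [Finsupp.single_apply]

/-- The section `g ↦ d 1 * u g` of the projection to `kG`. -/
noncomputable def sec : MonoidAlgebra k G →ₗ[k] A :=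
  ∑ g, (MonoidAlgebra.coeffLin k g).smulRight (C.d 1 * C.u g)

theorem sec_of (g : G) : C.sec (MonoidAlgebra.of k G g) = C.d 1 * C.u g := by
  classical
  rw [sec, LinearMap.sum_apply]
  simp only [LinearMap.smulRight_apply, MonoidAlgebra.coeffLin_of]
  simp

theorem sec_projLin (a : A) : C.sec (C.projLin a) = C.d 1 * a := by
  classical
  have : C.sec ∘ₗ C.projLin = LinearMap.mulLeft k (C.d 1) := by
    refine C.basis.ext fun x => ?_
    obtain ⟨t, g⟩ := x
    rw [C.basis_apply, LinearMap.comp_apply, projLin_du, LinearMap.mulLeft_apply, ← mul_assoc]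
    split_ifs with h
    · subst h
      rw [sec_of, C.d_mul_self]
    · rw [C.d_mul_ne 1 t (fun e => h e.symm), zero_mul, map_zero]
  exact LinearMap.congr_fun this a

/-- In the basis `d t * u g`, the inclusion hits the `d t`, the projection reads off the
coefficients at `d 1 * u g`, and coinvariance kills all coefficients with `g ≠ 1`. -/
theorem isCentralExtension : IsCentralExtension C.incl C.proj where
  injective := by
    have h : Function.LeftInverse C.retr C.incl := by
      intro f
      have : C.retr ∘ₗ C.inclLin = LinearMap.id := by
        refine linearMap_ext fun t => ?_
        rw [LinearMap.comp_apply, inclLin_delta, ← basis_one_right, retr,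
          Module.Basis.constr_basis]
        simp
      exact LinearMap.congr_fun this f
    exact h.injective
  surjective := by
    classical
    intro x
    induction x using MonoidAlgebra.induction_on with
    | of g => exact ⟨C.d 1 * C.u g, by rw [proj_apply, projLin_du, if_pos rfl]⟩
    | add x y hx hy =>
      obtain ⟨a, rfl⟩ := hx
      obtain ⟨b, rfl⟩ := hy
      exact ⟨a + b, map_add _ _ _⟩
    | smul r x hx =>
      obtain ⟨a, rfl⟩ := hx
      exact ⟨r • a, map_smul _ _ _⟩
  ker_eq := by
    classical
    refine Set.Subset.antisymm (fun a (ha : C.projLin a = 0) => ?_) ?_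
    · have h1 : C.d 1 * a = 0 := by rw [← sec_projLin, ha, map_zero]
      rw [← C.sum_d_mul a]
      refine Ideal.sum_mem _ fun t _ => ?_
      by_cases ht : t = 1
      · subst ht
        rw [h1]
        exact Ideal.zero_mem _
      · rw [C.d_comm]
        refine Ideal.mul_mem_left _ _ (Ideal.subset_span ⟨delta t, ?_, C.incl_delta t⟩)
        change counit (R := k) (delta t : FunctionAlgebra k Q) = 0
        rw [counit_eq, delta_eval, if_neg (fun e => ht e.symm)]
    · have : Ideal.span (C.incl '' {b | counit (R := k) b = 0}) ≤
          RingHom.ker (C.proj : A →ₐ[k] MonoidAlgebra k G) := by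
        rw [Ideal.span_le]
        rintro _ ⟨f, hf, rfl⟩
        change C.projLin (C.incl f) = 0
        have hf : f 1 = 0 := hf
        rw [incl_apply, map_sum]
        simp [projLin_d, hf]
      exact this
  range_eq_right := by
    classical
    ext a
    constructor
    · rintro ⟨f, rfl⟩
      have : C.projLin.lTensor A ∘ₗ comul (R := k) ∘ₗ C.inclLin =
          (TensorProduct.mk k A (MonoidAlgebra k G)).flip 1 ∘ₗ C.inclLin := by
        refine linearMap_ext fun t => ?_
        have := C.lTensor_proj_comul_du t 1
        rw [C.u_one, mul_one] at this
        rw [LinearMap.comp_apply, LinearMap.comp_apply, LinearMap.comp_apply, inclLin_delta, this]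
        rfl
      exact LinearMap.congr_fun this f
    · intro ha
      have hr : (TensorProduct.rid k A).toLinearMap ∘ₗ
          (MonoidAlgebra.coeffLin k (1 : G)).lTensor A ∘ₗ C.projLin.lTensor A ∘ₗ
            comul (R := k) = C.inclLin ∘ₗ C.retr := by
        refine C.basis.ext fun x => ?_
        obtain ⟨t, g⟩ := x
        rw [C.basis_apply]
        refine Eq.trans ?_ (C.incl_retr_du t g).symm
        simp only [LinearMap.comp_apply, lTensor_proj_comul_du, LinearMap.lTensor_tmul,
          MonoidAlgebra.coeffLin_of]
        split_ifs <;> simp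
      have h2 := LinearMap.congr_fun hr a
      have ha : C.projLin.lTensor A (comul (R := k) a) = a ⊗ₜ[k] 1 := ha
      refine ⟨C.retr a, h2.symm.trans ?_⟩
      rw [LinearMap.comp_apply, LinearMap.comp_apply, LinearMap.comp_apply, ha,
        LinearMap.lTensor_tmul, ← map_one (MonoidAlgebra.of k G), MonoidAlgebra.coeffLin_of]
      simp
  range_eq_left := by
    classical
    ext a
    constructor
    · rintro ⟨f, rfl⟩
      have : C.projLin.rTensor A ∘ₗ comul (R := k) ∘ₗ C.inclLin =
          TensorProduct.mk k (MonoidAlgebra k G) A 1 ∘ₗ C.inclLin := by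
        refine linearMap_ext fun t => ?_
        have := C.rTensor_proj_comul_du t 1
        rw [C.u_one, mul_one, map_one] at this
        rw [LinearMap.comp_apply, LinearMap.comp_apply, LinearMap.comp_apply, inclLin_delta, this]
        rfl
      exact LinearMap.congr_fun this f
    · intro ha
      have hr : (TensorProduct.lid k A).toLinearMap ∘ₗ
          (MonoidAlgebra.coeffLin k (1 : G)).rTensor A ∘ₗ C.projLin.rTensor A ∘ₗ
            comul (R := k) = C.inclLin ∘ₗ C.retr := by
        refine C.basis.ext fun x => ?_
        obtain ⟨t, g⟩ := x
        rw [C.basis_apply]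
        refine Eq.trans ?_ (C.incl_retr_du t g).symm
        simp only [LinearMap.comp_apply, rTensor_proj_comul_du, LinearMap.rTensor_tmul,
          MonoidAlgebra.coeffLin_of, EmbeddingLike.map_eq_one_iff]
        split_ifs <;> simp
      have h2 := LinearMap.congr_fun hr a
      have ha : C.projLin.rTensor A (comul (R := k) a) = 1 ⊗ₜ[k] a := ha
      refine ⟨C.retr a, h2.symm.trans ?_⟩
      rw [LinearMap.comp_apply, LinearMap.comp_apply, LinearMap.comp_apply, ha,
        LinearMap.rTensor_tmul, ← map_one (MonoidAlgebra.of k G), MonoidAlgebra.coeffLin_of]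
      simp
  central := by
    intro b a
    rw [incl_apply, Finset.sum_mul, Finset.mul_sum]
    exact Finset.sum_congr rfl fun t _ => by rw [smul_mul_assoc, mul_smul_comm, C.d_comm]

end CleftData

/-! ### The fibre functor of a cleft extension to graded bimodules -/

noncomputable instance {N K : Type*} [Group N] [Group K] [Fintype N] [Fintype K]
    (φ : K →* MulAut N) : Fintype (N ⋊[φ] K) :=
  Fintype.ofEquiv _ SemidirectProduct.equivProd.symm

namespace CleftData

variable {k : Type u} [Field k] {A : Type v} [Ring A] [HopfAlgebra k A] {Q G : Type}
    [Group Q] [Fintype Q] [CommGroup G] [Fintype G] {φ : Q →* MulAut G} (C : CleftData k A φ)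

open Coalgebra

/-- The 3-cocycle of `G ⋊ Q` assembled from `σ` and `τ`. -/
def threeCocycle : ThreeCocycle k (G ⋊[φ] Q) where
  ω x y z := C.τ z.left x.right y.right * C.σ x.right (φ y.right z.left) y.left
  cocycle x y z w := by
    have e1 := congrArg Units.val (C.τ_cocycle w.left x.right y.right z.right)
    have e2 := congrArg Units.val (C.τ_mul x.right y.right (φ z.right w.left) z.left)
    have e3 := congrArg Units.val (C.σ_cocycle x.right (φ y.right (φ z.right w.left))
      (φ y.right z.left) y.left)
    apply Units.ext
    rw [mul_comm (φ y.right z.left)] at e3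
    rw [mul_comm (φ z.right w.left) z.left] at e2
    simp only [SemidirectProduct.mul_left, SemidirectProduct.mul_right, map_mul, Units.val_mul,
      MulAut.mul_apply, mul_comm (φ y.right (φ z.right w.left))] at e1 e2 e3 ⊢
    linear_combination (C.τ w.left (x.right * y.right) z.right : k) *
      C.σ x.right (φ y.right z.left * φ y.right (φ z.right w.left)) y.left * e2 -
      (C.σ x.right (φ y.right z.left * φ y.right (φ z.right w.left)) y.left : k) *
      C.τ z.left x.right y.right * C.σ x.right (φ y.right (φ z.right w.left)) (φ y.right z.left) *
      C.σ y.right (φ z.right w.left) z.left * e1 - (C.τ w.left x.right (y.right * z.right) : k) *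
      C.τ w.left y.right z.right * C.τ z.left x.right y.right *
      C.σ y.right (φ z.right w.left) z.left * e3
  one_left x y := by simp [C.τ_left, C.σ_one_left]
  one_mid x y := by simp [C.τ_right, C.σ_one_right]
  one_right x y := by simp [C.τ_one, C.σ_one_mid]

section Unbundled

variable {V W U : Type u} [AddCommGroup V] [Module k V] [AddCommGroup W] [Module k W]
  [AddCommGroup U] [Module k U]

/-- The vector `x` lies in the component of degree `a` of the representation `ρ`, on which the
central idempotent `d a` acts as the identity. -/
def Deg (ρ : A →ₐ[k] Module.End k V) (a : Q) (x : V) : Prop := ρ (C.d a) x = x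

variable {C} {ρ : A →ₐ[k] Module.End k V} {ρ' : A →ₐ[k] Module.End k W}
  {ρ'' : A →ₐ[k] Module.End k U}

open Classical in
theorem Deg.d_apply {a : Q} {x : V} (hx : C.Deg ρ a x) (b : Q) :
    ρ (C.d b) x = if b = a then x else 0 := by
  rw [← hx, ← Module.End.mul_apply, ← map_mul, C.d_mul]
  split_ifs with h
  · rw [h]
  · simp

theorem Deg.act {a : Q} {x : V} (hx : C.Deg ρ a x) (b : A) : C.Deg ρ a (ρ b x) := by
  unfold Deg at *
  rw [← Module.End.mul_apply, ← map_mul, C.d_comm, map_mul, Module.End.mul_apply, hx]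

theorem deg_d (a : Q) (x : V) : C.Deg ρ a (ρ (C.d a) x) := by
  unfold Deg
  rw [← Module.End.mul_apply, ← map_mul, C.d_mul_self]

theorem sum_d_apply (x : V) : ∑ a, ρ (C.d a) x = x := by
  rw [← LinearMap.sum_apply, ← map_sum, C.sum_d]
  simp

theorem deg_ext {M : Type*} [AddCommMonoid M] [Module k M] {f f' : V →ₗ[k] M}
    (h : ∀ a x, C.Deg ρ a x → f x = f' x) : f = f' := by
  ext x
  rw [← sum_d_apply (C := C) (ρ := ρ) x, map_sum, map_sum]
  exact Finset.sum_congr rfl fun a _ => h a _ (deg_d a x)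

theorem Deg.act₂ {a b : Q} {x : V} {y : W} (hx : C.Deg ρ a x) (hy : C.Deg ρ' b y)
    (t : A ⊗[k] A) :
    HopfRep.act₂ ρ ρ' t (x ⊗ₜ y) = HopfRep.act₂ ρ ρ' ((C.d a ⊗ₜ C.d b) * t) (x ⊗ₜ y) := by
  rw [C.dd_comm, map_mul, Module.End.mul_apply, HopfRep.act₂_tmul, hx, hy]

theorem Deg.tmul {a b : Q} {x : V} {y : W} (hx : C.Deg ρ a x) (hy : C.Deg ρ' b y) :
    C.Deg (HopfRep.diag ρ ρ') (a * b) (x ⊗ₜ[k] y) := by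
  unfold Deg
  rw [HopfRep.diag_apply, hx.act₂ hy, C.dd_mul_comul_d, HopfRep.act₂_tmul, hx, hy]

/-- The element `u g` acts diagonally on `x ⊗ y`, up to the scalar `τ`, by `u (φ b g)` and `u g`.
-/
theorem Deg.tensor_u {a b : Q} {x : V} {y : W} (hx : C.Deg ρ a x) (hy : C.Deg ρ' b y) (g : G) :
    HopfRep.diag ρ ρ' (C.u g) (x ⊗ₜ[k] y) =
      (C.τ g a b : k) • (ρ (C.u (φ b g)) x ⊗ₜ[k] ρ' (C.u g) y) := by
  rw [HopfRep.diag_apply, hx.act₂ hy, C.dd_mul_comul_u, map_smul, LinearMap.smul_apply,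
    HopfRep.act₂_tmul, C.d_comm, C.d_comm, map_mul, map_mul, Module.End.mul_apply,
    Module.End.mul_apply, hx, hy]

theorem Deg.u_u {a : Q} {x : V} (hx : C.Deg ρ a x) (g h : G) :
    ρ (C.u g) (ρ (C.u h) x) = (C.σ a g h : k) • ρ (C.u (g * h)) x := by
  have key : ρ (C.u g) (ρ (C.u h) (ρ (C.d a) x)) =
      (C.σ a g h : k) • ρ (C.u (g * h)) (ρ (C.d a) x) := by
    rw [← Module.End.mul_apply, ← Module.End.mul_apply, ← map_mul, ← map_mul, ← C.d_comm,
      C.d_mul_u_mul, map_smul, C.d_comm, map_mul]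
    rfl
  rwa [hx] at key

theorem deg_unit (r : k) : C.Deg (HopfRep.triv k A) 1 r := by
  unfold Deg
  rw [HopfRep.triv_apply, C.counit_d_one, one_mul]

variable (C) in
theorem unit_u (g : G) (r : k) : HopfRep.triv k A (C.u g) r = r := by
  rw [HopfRep.triv_apply, C.counit_u, one_mul]

variable (C ρ) in
/-- The grading of `kG ⊗ V` by `G ⋊ Q` in which `g ⊗ x` has degree `(g, a)` if `x` has degree
`a`. -/
noncomputable def grading : Grading k (G ⋊[φ] Q) (G →₀ V) where
  proj p := Finsupp.lsingle p.left ∘ₗ ρ (C.d p.right) ∘ₗ Finsupp.lapply p.left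
  proj_same p v := by
    simp only [LinearMap.comp_apply, Finsupp.lapply_apply, Finsupp.lsingle_apply,
      Finsupp.single_eq_same]
    rw [← Module.End.mul_apply, ← map_mul, C.d_mul_self]
  proj_ne p q v hpq := by
    classical
    simp only [LinearMap.comp_apply, Finsupp.lapply_apply, Finsupp.lsingle_apply,
      Finsupp.single_apply]
    split_ifs with h
    · rw [← Module.End.mul_apply, ← map_mul,
        C.d_mul_ne _ _ (fun e => hpq (SemidirectProduct.ext h.symm e))]
      simp
    · simp
  sum_proj v := by
    classical
    rw [← LinearMap.sum_apply]
    refine LinearMap.congr_fun (g := LinearMap.id) (Finsupp.lhom_ext' fun g =>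
      deg_ext (C := C) (ρ := ρ) fun a x hx => ?_) v
    simp only [LinearMap.comp_apply, LinearMap.sum_apply, Finsupp.lapply_apply,
      Finsupp.lsingle_apply, Finsupp.single_apply, LinearMap.id_apply]
    rw [Finset.sum_eq_single ⟨g, a⟩]
    · simp [hx.d_apply]
    · rintro ⟨h, b⟩ _ hb
      by_cases e : g = h
      · subst e
        have : b ≠ a := fun e => hb (by rw [e])
        simp [hx.d_apply, this]
      · simp [e]
    · simp

theorem Deg.homog {a : Q} {x : V} (hx : C.Deg ρ a x) (g : G) :
    (C.grading ρ).Homog ⟨g, a⟩ (Finsupp.single g x) := by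
  change Finsupp.single g (ρ (C.d a) ((Finsupp.single g x : G →₀ V) g)) = _
  rw [Finsupp.single_eq_same, hx]

theorem finsupp_ext {M : Type*} [AddCommMonoid M] [Module k M] {f f' : (G →₀ V) →ₗ[k] M}
    (h : ∀ g a x, C.Deg ρ a x → f (Finsupp.single g x) = f' (Finsupp.single g x)) : f = f' :=
  Finsupp.lhom_ext' fun g => deg_ext (C := C) (ρ := ρ) fun a x hx => h g a x hx

theorem finsupp_ext₂ {M : Type*} [AddCommMonoid M] [Module k M]
    {f f' : (G →₀ V) ⊗[k] (G →₀ W) →ₗ[k] M}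
    (h : ∀ g a x h b y, C.Deg ρ a x → C.Deg ρ' b y →
      f (Finsupp.single g x ⊗ₜ Finsupp.single h y) =
        f' (Finsupp.single g x ⊗ₜ Finsupp.single h y)) : f = f' := by
  apply TensorProduct.ext
  exact finsupp_ext (C := C) (ρ := ρ) fun g a x hx => finsupp_ext (C := C) (ρ := ρ')
    fun l b y hy => h g a x l b y hx hy

theorem finsupp_ext₃ {M : Type*} [AddCommMonoid M] [Module k M]
    {f f' : ((G →₀ V) ⊗[k] (G →₀ W)) ⊗[k] (G →₀ U) →ₗ[k] M}
    (h : ∀ g a x h b y l c z, C.Deg ρ a x → C.Deg ρ' b y → C.Deg ρ'' c z →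
      f ((Finsupp.single g x ⊗ₜ Finsupp.single h y) ⊗ₜ Finsupp.single l z) =
        f' ((Finsupp.single g x ⊗ₜ Finsupp.single h y) ⊗ₜ Finsupp.single l z)) : f = f' := by
  apply TensorProduct.ext
  exact finsupp_ext₂ (C := C) (ρ := ρ) (ρ' := ρ') fun g a x l b y hx hy =>
    finsupp_ext (C := C) (ρ := ρ'') fun m c z hz => h g a x l b y m c z hx hy hz

theorem graded_of_homog (P : Grading k (G ⋊[φ] Q) U) (f : (G →₀ V) →ₗ[k] U)
    (h : ∀ g a x, C.Deg ρ a x → P.Homog ⟨g, a⟩ (f (Finsupp.single g x))) (p : G ⋊[φ] Q)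
    (t : G →₀ V) : f ((C.grading ρ).proj p t) = P.proj p (f t) := by
  classical
  refine LinearMap.congr_fun (f := f ∘ₗ (C.grading ρ).proj p) (g := P.proj p ∘ₗ f)
    (finsupp_ext (C := C) (ρ := ρ) fun g a x hx => ?_) t
  rw [LinearMap.comp_apply, LinearMap.comp_apply, (hx.homog g).proj_eq, (h g a x hx).proj_eq]
  split_ifs <;> simp

theorem graded_of_homog₂ (P : Grading k (G ⋊[φ] Q) U) (f : (G →₀ V) ⊗[k] (G →₀ W) →ₗ[k] U)
    (H : ∀ g a x h b y, C.Deg ρ a x → C.Deg ρ' b y →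
      P.Homog ⟨g * φ a h, a * b⟩ (f (Finsupp.single g x ⊗ₜ Finsupp.single h y)))
    (p : G ⋊[φ] Q) (t : (G →₀ V) ⊗[k] (G →₀ W)) :
    f (((C.grading ρ).tensor (C.grading ρ')).proj p t) = P.proj p (f t) := by
  classical
  refine LinearMap.congr_fun (f := f ∘ₗ ((C.grading ρ).tensor (C.grading ρ')).proj p)
    (g := P.proj p ∘ₗ f)
    (finsupp_ext₂ (C := C) (ρ := ρ) (ρ' := ρ') fun g a x h b y hx hy => ?_) t
  rw [LinearMap.comp_apply, LinearMap.comp_apply, ((hx.homog g).tmul (hy.homog h)).proj_eq,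
    (H g a x h b y hx hy).proj_eq]
  have e : (⟨g, a⟩ : G ⋊[φ] Q) * ⟨h, b⟩ = ⟨g * φ a h, a * b⟩ := rfl
  rw [e]
  split_ifs
  · rfl
  · exact map_zero _

/-- The linear map `(g ⊗ x) ⊗ (h ⊗ y) ↦ g (a · h) ⊗ (u h x ⊗ y)`, for `x` of degree `a`. -/
noncomputable def tensMap (C : CleftData k A φ) (ρ : A →ₐ[k] Module.End k V) (W : Type u)
    [AddCommGroup W] [Module k W] : (G →₀ V) ⊗[k] (G →₀ W) →ₗ[k] (G →₀ V ⊗[k] W) :=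
  TensorProduct.lift (Finsupp.lsum k fun g => LinearMap.flip (Finsupp.lsum k fun h =>
    LinearMap.flip (∑ a, (TensorProduct.mk k V W ∘ₗ ρ (C.u h * C.d a)).compr₂
      (Finsupp.lsingle (g * φ a h)))))

theorem tensMap_single {a : Q} {x : V} (hx : C.Deg ρ a x) (g h : G) (y : W) :
    C.tensMap ρ W (Finsupp.single g x ⊗ₜ Finsupp.single h y) =
      Finsupp.single (g * φ a h) (ρ (C.u h) x ⊗ₜ y) := by
  classical
  simp only [tensMap, TensorProduct.lift.tmul, Finsupp.lsum_single, LinearMap.flip_apply,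
    LinearMap.sum_apply]
  rw [Finset.sum_eq_single a]
  · simp [hx.d_apply]
  · intro b _ hb
    simp [hx.d_apply, hb]
  · simp

theorem tensMap_graded (p : G ⋊[φ] Q) (t : (G →₀ V) ⊗[k] (G →₀ W)) :
    C.tensMap ρ W (((C.grading ρ).tensor (C.grading ρ')).proj p t) =
      (C.grading (HopfRep.diag ρ ρ')).proj p (C.tensMap ρ W t) :=
  graded_of_homog₂ _ _ (fun g a x h b y hx hy => by
    rw [tensMap_single hx]
    exact ((hx.act (C.u h)).tmul hy).homog _) p t

omit [CommGroup G] [Fintype G] in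
theorem mapRange_single (f : V →ₗ[k] W) (g : G) (x : V) :
    Finsupp.mapRange.linearMap f (Finsupp.single g x) = Finsupp.single g (f x) := by
  rw [Finsupp.mapRange.linearMap_apply, Finsupp.mapRange_single]

/-- The maps `tensMap` are compatible with the associativity constraint `ω`: moving `u l` past the
tensor product `x ⊗ y` costs a factor `τ`, and composing it with `u h` costs a factor `σ`. -/
theorem tensMap_associativity (t : ((G →₀ V) ⊗[k] (G →₀ W)) ⊗[k] (G →₀ U)) :
    Finsupp.mapRange.linearMap (TensorProduct.assoc k V W U).toLinearMap
      (C.tensMap (HopfRep.diag ρ ρ') U ((C.tensMap ρ W).rTensor _ t)) =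
    C.tensMap ρ (W ⊗[k] U) ((C.tensMap ρ' U).lTensor _
      (Grading.assocMap C.threeCocycle.ω (C.grading ρ) (C.grading ρ') (C.grading ρ'') t)) := by
  refine LinearMap.congr_fun
    (f := Finsupp.mapRange.linearMap (TensorProduct.assoc k V W U).toLinearMap ∘ₗ
      C.tensMap (HopfRep.diag ρ ρ') U ∘ₗ (C.tensMap ρ W).rTensor _)
    (g := C.tensMap ρ (W ⊗[k] U) ∘ₗ (C.tensMap ρ' U).lTensor _ ∘ₗ
      Grading.assocMap C.threeCocycle.ω (C.grading ρ) (C.grading ρ') (C.grading ρ''))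
    (finsupp_ext₃ (C := C) (ρ := ρ) (ρ' := ρ') (ρ'' := ρ'') fun g a x h b y l c z hx hy hz => ?_) t
  simp only [LinearMap.comp_apply, LinearMap.rTensor_tmul]
  rw [Grading.assocMap_apply _ (hx.homog g) (hy.homog h) (hz.homog l), map_smul, map_smul,
    LinearMap.lTensor_tmul, tensMap_single hx, tensMap_single hy, tensMap_single hx,
    tensMap_single ((hx.act (C.u h)).tmul hy), (hx.act (C.u h)).tensor_u hy, hx.u_u,
    mapRange_single, Finsupp.smul_single, map_mul, map_mul, mul_assoc, MulAut.mul_apply]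
  congr 1
  simp only [threeCocycle, TensorProduct.smul_tmul', smul_smul, Units.val_mul,
    LinearEquiv.coe_coe, TensorProduct.assoc_tmul, mul_comm h]

end Unbundled

variable {C} {X Y Z : HopfRep.{u, v} k A}

theorem Deg.map {a : Q} {x : X.V} (hx : C.Deg X.ρ a x) (f : X ⟶ Y) :
    C.Deg Y.ρ a (f.toLin x) := by
  unfold Deg at *
  rw [← f.equivariant, hx]

variable (C) in
/-- The graded space `kG ⊗ X`. -/
@[reducible]
noncomputable def fib (X : HopfRep.{u, v} k A) : GradedVec C.threeCocycle where
  V := G →₀ X.V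
  gr := C.grading X.ρ

variable (C) in
/-- The functor `X ↦ kG ⊗ X`. -/
noncomputable def fibFunctor : HopfRep.{u, v} k A ⥤ GradedVec C.threeCocycle where
  obj := C.fib
  map {X Y} f := ⟨Finsupp.mapRange.linearMap f.toLin, graded_of_homog _ _ fun g a x hx => by
    rw [mapRange_single]
    exact (hx.map f).homog g⟩
  map_id X := by
    apply GradedVec.hom_ext
    exact Finsupp.mapRange.linearMap_id
  map_comp f g := by
    apply GradedVec.hom_ext
    exact Finsupp.mapRange.linearMap_comp _ _

theorem tensMap_natural_left (f : X ⟶ Y) (t : (G →₀ X.V) ⊗[k] (G →₀ Z.V)) :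
    C.tensMap Y.ρ Z.V ((Finsupp.mapRange.linearMap f.toLin).rTensor _ t) =
      Finsupp.mapRange.linearMap (f.toLin.rTensor Z.V) (C.tensMap X.ρ Z.V t) := by
  refine LinearMap.congr_fun
    (f := C.tensMap Y.ρ Z.V ∘ₗ (Finsupp.mapRange.linearMap f.toLin).rTensor _)
    (g := Finsupp.mapRange.linearMap (f.toLin.rTensor Z.V) ∘ₗ C.tensMap X.ρ Z.V)
    (finsupp_ext₂ (C := C) (ρ := X.ρ) (ρ' := Z.ρ) fun g a x h b y hx hy => ?_) t
  rw [LinearMap.comp_apply, LinearMap.comp_apply, LinearMap.rTensor_tmul, mapRange_single,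
    tensMap_single hx, tensMap_single (hx.map f), ← f.equivariant, mapRange_single,
    LinearMap.rTensor_tmul]

theorem tensMap_natural_right (f : X ⟶ Y) (t : (G →₀ Z.V) ⊗[k] (G →₀ X.V)) :
    C.tensMap Z.ρ Y.V ((Finsupp.mapRange.linearMap f.toLin).lTensor _ t) =
      Finsupp.mapRange.linearMap (f.toLin.lTensor Z.V) (C.tensMap Z.ρ X.V t) := by
  refine LinearMap.congr_fun
    (f := C.tensMap Z.ρ Y.V ∘ₗ (Finsupp.mapRange.linearMap f.toLin).lTensor _)
    (g := Finsupp.mapRange.linearMap (f.toLin.lTensor Z.V) ∘ₗ C.tensMap Z.ρ X.V)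
    (finsupp_ext₂ (C := C) (ρ := Z.ρ) (ρ' := X.ρ) fun g a x h b y hx hy => ?_) t
  rw [LinearMap.comp_apply, LinearMap.comp_apply, LinearMap.lTensor_tmul, mapRange_single,
    tensMap_single hx, tensMap_single hx, mapRange_single, LinearMap.lTensor_tmul]

theorem tensUnit_graded (p : G ⋊[φ] Q) (t : k) :
    (Finsupp.lsingle 1 : k →ₗ[k] (G →₀ k)) ((Grading.unit k (G ⋊[φ] Q)).proj p t) =
      (C.grading (HopfRep.triv k A)).proj p (Finsupp.single 1 t) := by
  classical
  rw [(Grading.homog_unit t).proj_eq,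
    ((deg_unit (C := C) t).homog 1).proj_eq]
  have e : (⟨1, 1⟩ : G ⋊[φ] Q) = 1 := rfl
  rw [e]
  split_ifs
  · rfl
  · exact map_zero _

theorem left_unit_fib (r : k) (x : G →₀ X.V) :
    Finsupp.mapRange.linearMap (TensorProduct.lid k X.V).toLinearMap
      (C.tensMap (HopfRep.triv k A) X.V (Finsupp.single 1 r ⊗ₜ x)) = r • x := by
  refine LinearMap.congr_fun
    (f := Finsupp.mapRange.linearMap (TensorProduct.lid k X.V).toLinearMap ∘ₗ
      C.tensMap (HopfRep.triv k A) X.V ∘ₗ TensorProduct.mk k _ _ (Finsupp.single 1 r))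
    (g := LinearMap.lsmul k _ r) (Finsupp.lhom_ext fun g x => ?_) x
  rw [LinearMap.comp_apply, LinearMap.comp_apply, TensorProduct.mk_apply,
    tensMap_single (deg_unit r), unit_u, mapRange_single]
  simp

theorem right_unit_fib (r : k) (x : G →₀ X.V) :
    Finsupp.mapRange.linearMap (TensorProduct.rid k X.V).toLinearMap
      (C.tensMap X.ρ k (x ⊗ₜ Finsupp.single 1 r)) = r • x := by
  refine LinearMap.congr_fun
    (f := Finsupp.mapRange.linearMap (TensorProduct.rid k X.V).toLinearMap ∘ₗ
      C.tensMap X.ρ k ∘ₗ (TensorProduct.mk k _ _).flip (Finsupp.single 1 r))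
    (g := LinearMap.lsmul k _ r)
    (finsupp_ext (C := C) (ρ := X.ρ) fun g a x hx => ?_) x
  rw [LinearMap.comp_apply, LinearMap.comp_apply, LinearMap.flip_apply, TensorProduct.mk_apply,
    tensMap_single hx, mapRange_single, C.u_one]
  simp

noncomputable instance : C.fibFunctor.LaxMonoidal where
  ε := ⟨Finsupp.lsingle 1, tensUnit_graded⟩
  μ X Y := ⟨C.tensMap X.ρ Y.V, tensMap_graded⟩
  μ_natural_left f _ := GradedVec.hom_ext (LinearMap.ext (tensMap_natural_left f))
  μ_natural_right _ f := GradedVec.hom_ext (LinearMap.ext (tensMap_natural_right f))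
  associativity _ _ _ := GradedVec.hom_ext (LinearMap.ext tensMap_associativity)
  left_unitality _ := GradedVec.hom_ext (TensorProduct.ext' fun r x => (left_unit_fib r x).symm)
  right_unitality _ := GradedVec.hom_ext (TensorProduct.ext' fun x r => (right_unit_fib r x).symm)

end CleftData

/-! ### The monoidal structure of the fibre functor -/

namespace CleftData

variable {k : Type u} [Field k] {A : Type v} [Ring A] [HopfAlgebra k A] {Q G : Type}
    [Group Q] [Fintype Q] [CommGroup G] [Fintype G] {φ : Q →* MulAut G} (C : CleftData k A φ)

open Coalgebra

/-- The 3-cocycle is trivial on the subgroup `G` of `G ⋊ Q`, which is equipped with the constant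
2-cochain `1`. -/
def twist : TwistedCocycle C.threeCocycle (SemidirectProduct.inl : G →* G ⋊[φ] Q).range where
  α _ _ := 1
  coboundary := by
    rintro ⟨_, g, rfl⟩ ⟨_, h, rfl⟩ ⟨_, l, rfl⟩
    simp [threeCocycle, C.τ_left, C.σ_one_left]
  one_left _ := rfl
  one_right _ := rfl

/-- The identification of the subgroup `G` of `G ⋊ Q` with `G`. -/
def rangeEquiv (φ : Q →* MulAut G) : (SemidirectProduct.inl : G →* G ⋊[φ] Q).range ≃ G where
  toFun x := x.1.left
  invFun g := ⟨SemidirectProduct.inl g, g, rfl⟩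
  left_inv := by
    rintro ⟨_, g, rfl⟩
    rfl
  right_inv _ := rfl

theorem rangeEquiv_mul (x y : (SemidirectProduct.inl : G →* G ⋊[φ] Q).range) :
    rangeEquiv φ (x * y) = rangeEquiv φ x * rangeEquiv φ y := by
  obtain ⟨_, g, rfl⟩ := x
  obtain ⟨_, h, rfl⟩ := y
  change (SemidirectProduct.inl g * SemidirectProduct.inl h : G ⋊[φ] Q).left = g * h
  simp

theorem coe_eq_rangeEquiv (x : (SemidirectProduct.inl : G →* G ⋊[φ] Q).range) :
    (x : G ⋊[φ] Q) = ⟨rangeEquiv φ x, 1⟩ := by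
  obtain ⟨_, g, rfl⟩ := x
  rfl

variable (k φ) in
/-- The identification of the group algebra of the subgroup `G` of `G ⋊ Q` with `kG`. -/
noncomputable def relabel :
    ((SemidirectProduct.inl : G →* G ⋊[φ] Q).range →₀ k) ≃ₗ[k] (G →₀ k) :=
  Finsupp.domLCongr (rangeEquiv φ)

theorem relabel_single (x : (SemidirectProduct.inl : G →* G ⋊[φ] Q).range) (r : k) :
    relabel k φ (Finsupp.single x r) = Finsupp.single (rangeEquiv φ x) r :=
  Finsupp.domLCongr_single _ _ _

theorem relabel_graded (p : G ⋊[φ] Q)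
    (t : (SemidirectProduct.inl : G →* G ⋊[φ] Q).range →₀ k) :
    relabel k φ ((GradedVec.groupAlgGrading k _).proj p t) =
      (C.grading (HopfRep.triv k A)).proj p (relabel k φ t) := by
  classical
  refine LinearMap.congr_fun
    (f := (relabel k φ).toLinearMap ∘ₗ (GradedVec.groupAlgGrading k _).proj p)
    (g := (C.grading (HopfRep.triv k A)).proj p ∘ₗ (relabel k φ).toLinearMap)
    (Finsupp.lhom_ext fun x r => ?_) t
  rw [LinearMap.comp_apply, LinearMap.comp_apply, (GradedVec.homog_single x r).proj_eq,
    LinearEquiv.coe_coe, relabel_single, ((deg_unit (C := C) r).homog _).proj_eq,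
    coe_eq_rangeEquiv]
  split_ifs
  · rw [relabel_single]
  · exact map_zero _

theorem relabel_mul (t : ((SemidirectProduct.inl : G →* G ⋊[φ] Q).range →₀ k) ⊗[k]
    ((SemidirectProduct.inl : G →* G ⋊[φ] Q).range →₀ k)) :
    relabel k φ (GradedVec.mulMap C.twist t) =
      Finsupp.mapRange.linearMap (TensorProduct.lid k k).toLinearMap
        (C.tensMap (HopfRep.triv k A) k (TensorProduct.map (relabel k φ).toLinearMap
          (relabel k φ).toLinearMap t)) := by
  refine LinearMap.congr_fun
    (f := (relabel k φ).toLinearMap ∘ₗ GradedVec.mulMap C.twist)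
    (g := Finsupp.mapRange.linearMap (TensorProduct.lid k k).toLinearMap ∘ₗ
      C.tensMap (HopfRep.triv k A) k ∘ₗ
        TensorProduct.map (relabel k φ).toLinearMap (relabel k φ).toLinearMap)
    (TensorProduct.ext (Finsupp.lhom_ext fun x r => Finsupp.lhom_ext fun y s => ?_)) t
  change relabel k φ (GradedVec.mulMap C.twist (Finsupp.single x r ⊗ₜ Finsupp.single y s)) =
      Finsupp.mapRange.linearMap (TensorProduct.lid k k).toLinearMap
        (C.tensMap (HopfRep.triv k A) k
          (relabel k φ (Finsupp.single x r) ⊗ₜ relabel k φ (Finsupp.single y s)))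
  rw [GradedVec.mulMap_single, relabel_single, relabel_single,
    relabel_single, tensMap_single (deg_unit r), unit_u, mapRange_single, map_one,
    rangeEquiv_mul]
  simp [twist]

/-- The fibre functor, with the identification of its value at the unit object with `kG`. -/
noncomputable def fibData : LaxBimod.Data (HopfRep.{u, v} k A) (GradedVec C.threeCocycle) where
  T := C.fibFunctor
  B := GradedVec.twistedGroupAlg C.twist
  φ := GradedVec.mkIso (Y := C.fib (𝟙_ _)) (relabel k φ) C.relabel_graded
  one_φ := GradedVec.hom_ext (LinearMap.ext_ring (relabel_single _ _))
  mul_φ := GradedVec.hom_ext (LinearMap.ext C.relabel_mul)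

variable {C} {X Y : HopfRep.{u, v} k A}

variable (C X) in
/-- The left action `h · (g ⊗ x) = hg ⊗ x` on `kG ⊗ X`. -/
noncomputable def leftAct :
    ((SemidirectProduct.inl : G →* G ⋊[φ] Q).range →₀ k) ⊗[k] (G →₀ X.V) →ₗ[k] (G →₀ X.V) :=
  Finsupp.mapRange.linearMap (TensorProduct.lid k X.V).toLinearMap ∘ₗ
    C.tensMap (HopfRep.triv k A) X.V ∘ₗ (relabel k φ).toLinearMap.rTensor _

variable (C X) in
/-- The right action `(g ⊗ x) · h = g (a · h) ⊗ u h x` on `kG ⊗ X`, for `x` of degree `a`. -/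
noncomputable def rightAct :
    (G →₀ X.V) ⊗[k] ((SemidirectProduct.inl : G →* G ⋊[φ] Q).range →₀ k) →ₗ[k] (G →₀ X.V) :=
  Finsupp.mapRange.linearMap (TensorProduct.rid k X.V).toLinearMap ∘ₗ
    C.tensMap X.ρ k ∘ₗ (relabel k φ).toLinearMap.lTensor _

theorem leftAct_single (x : (SemidirectProduct.inl : G →* G ⋊[φ] Q).range) (r : k) (g : G)
    (y : X.V) : C.leftAct X (Finsupp.single x r ⊗ₜ[k] Finsupp.single g y) =
      Finsupp.single (rangeEquiv φ x * g) (r • y) := by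
  rw [leftAct, LinearMap.comp_apply, LinearMap.comp_apply, LinearMap.rTensor_tmul,
    LinearEquiv.coe_coe, relabel_single, tensMap_single (deg_unit r), unit_u, mapRange_single]
  simp

theorem rightAct_single {a : Q} {y : X.V} (hy : C.Deg X.ρ a y)
    (x : (SemidirectProduct.inl : G →* G ⋊[φ] Q).range) (r : k) (g : G) :
    C.rightAct X (Finsupp.single g y ⊗ₜ[k] Finsupp.single x r) =
      Finsupp.single (g * φ a (rangeEquiv φ x)) (r • X.ρ (C.u (rangeEquiv φ x)) y) := by
  rw [rightAct, LinearMap.comp_apply, LinearMap.comp_apply, LinearMap.lTensor_tmul,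
    LinearEquiv.coe_coe, relabel_single, tensMap_single hy, mapRange_single]
  simp

variable (X Y) in
/-- The map `g ⊗ (x ⊗ y) ↦ (g ⊗ x) ⊗ (1 ⊗ y)`. -/
noncomputable def splitMap : (G →₀ X.V ⊗[k] Y.V) →ₗ[k] (G →₀ X.V) ⊗[k] (G →₀ Y.V) :=
  Finsupp.lsum k fun g => TensorProduct.map (Finsupp.lsingle g) (Finsupp.lsingle 1)

theorem splitMap_single (g : G) (x : X.V) (y : Y.V) :
    splitMap X Y (Finsupp.single g (x ⊗ₜ y)) = Finsupp.single g x ⊗ₜ Finsupp.single 1 y := by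
  rw [splitMap, Finsupp.lsum_single]
  rfl

theorem finsupp_tensor_ext {M : Type*} [AddCommMonoid M] [Module k M]
    {f f' : (G →₀ X.V ⊗[k] Y.V) →ₗ[k] M}
    (h : ∀ g a x b y, C.Deg X.ρ a x → C.Deg Y.ρ b y →
      f (Finsupp.single g (x ⊗ₜ y)) = f' (Finsupp.single g (x ⊗ₜ y))) : f = f' :=
  Finsupp.lhom_ext' fun g => TensorProduct.ext (deg_ext (C := C) (ρ := X.ρ) fun a x hx =>
    deg_ext (C := C) (ρ := Y.ρ) fun b y hy => h g a x b y hx hy)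

theorem splitMap_graded (p : G ⋊[φ] Q) (t : G →₀ X.V ⊗[k] Y.V) :
    splitMap X Y ((C.grading (HopfRep.diag X.ρ Y.ρ)).proj p t) =
      ((C.grading X.ρ).tensor (C.grading Y.ρ)).proj p (splitMap X Y t) := by
  classical
  refine LinearMap.congr_fun
    (f := splitMap X Y ∘ₗ (C.grading (HopfRep.diag X.ρ Y.ρ)).proj p)
    (g := ((C.grading X.ρ).tensor (C.grading Y.ρ)).proj p ∘ₗ splitMap X Y)
    (finsupp_tensor_ext (C := C) fun g a x b y hx hy => ?_) t
  have e : (⟨g, a⟩ : G ⋊[φ] Q) * ⟨1, b⟩ = ⟨g, a * b⟩ := SemidirectProduct.ext (by simp) rfl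
  rw [LinearMap.comp_apply, LinearMap.comp_apply, splitMap_single,
    ((hx.tmul hy).homog g).proj_eq, ((hx.homog g).tmul (hy.homog 1)).proj_eq, e]
  split_ifs
  · exact splitMap_single _ _ _
  · exact map_zero _

variable (φ X Y) in
/-- The map `(g ⊗ x) ⊗ (h ⊗ y) ↦ ((g ⊗ x) ⊗ h) ⊗ (1 ⊗ y)`. -/
noncomputable def insertMap : (G →₀ X.V) ⊗[k] (G →₀ Y.V) →ₗ[k]
    ((G →₀ X.V) ⊗[k] ((SemidirectProduct.inl : G →* G ⋊[φ] Q).range →₀ k)) ⊗[k] (G →₀ Y.V) :=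
  TensorProduct.lift (Finsupp.lsum k fun h =>
    ((TensorProduct.mk k ((G →₀ X.V) ⊗[k] ((SemidirectProduct.inl : G →* G ⋊[φ] Q).range →₀ k))
      (G →₀ Y.V)).compl₁₂ ((TensorProduct.mk k (G →₀ X.V) _).flip
        (Finsupp.single ((rangeEquiv φ).symm h) 1)) (Finsupp.lsingle 1)).flip).flip

theorem insertMap_single (x : G →₀ X.V) (h : G) (y : Y.V) :
    insertMap φ X Y (x ⊗ₜ Finsupp.single h y) =
      (x ⊗ₜ Finsupp.single ((rangeEquiv φ).symm h) 1) ⊗ₜ Finsupp.single 1 y := by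
  rw [insertMap, TensorProduct.lift.tmul, LinearMap.flip_apply, Finsupp.lsum_single]
  rfl

theorem insertMap_graded (p : G ⋊[φ] Q) (t : (G →₀ X.V) ⊗[k] (G →₀ Y.V)) :
    insertMap φ X Y (((C.grading X.ρ).tensor (C.grading Y.ρ)).proj p t) =
      (((C.grading X.ρ).tensor (GradedVec.groupAlgGrading k _)).tensor (C.grading Y.ρ)).proj p
        (insertMap φ X Y t) := by
  refine graded_of_homog₂ (C := C) (ρ := X.ρ) (ρ' := Y.ρ) (((C.grading X.ρ).tensor
    (GradedVec.groupAlgGrading k _)).tensor (C.grading Y.ρ)) (insertMap φ X Y)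
    (fun g a x h b y hx hy => ?_) p t
  rw [insertMap_single]
  have := ((hx.homog g).tmul (GradedVec.homog_single ((rangeEquiv φ).symm h) (1 : k))).tmul
    (hy.homog 1)
  rw [coe_eq_rangeEquiv, Equiv.apply_symm_apply] at this
  have e : (⟨g, a⟩ : G ⋊[φ] Q) * ⟨h, 1⟩ * ⟨1, b⟩ = ⟨g * φ a h, a * b⟩ :=
    SemidirectProduct.ext (by simp) (by simp)
  rwa [e] at this

/-- The tensor product of `kG ⊗ X` and `kG ⊗ Y` over `kG` is `kG ⊗ (X ⊗ Y)`: the factor `kG` in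
the middle is free, and `splitMap` and `insertMap` split the coequalizer that defines the tensor
product. -/
instance (X Y : HopfRep.{u, v} k A) : IsIso (LaxBimod.comparison C.fibData X Y) := by
  refine LaxBimod.isIso_comparison_of_split C.fibData (X := X) (Y := Y)
    (⟨splitMap X Y, splitMap_graded⟩ : C.fib (X ⊗ Y) ⟶ C.fib X ⊗ C.fib Y)
    (⟨insertMap φ X Y, insertMap_graded⟩ : C.fib X ⊗ C.fib Y ⟶
      (C.fib X ⊗ (GradedVec.twistedGroupAlg C.twist).X) ⊗ C.fib Y) ?_ ?_ ?_
  · apply GradedVec.hom_ext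
    refine finsupp_tensor_ext (C := C) (X := X) (Y := Y) fun g a x b y hx hy => ?_
    change C.tensMap X.ρ Y.V (splitMap X Y (Finsupp.single g (x ⊗ₜ y))) =
      Finsupp.single g (x ⊗ₜ y)
    rw [splitMap_single, tensMap_single hx, C.u_one]
    simp
  · apply GradedVec.hom_ext
    refine finsupp_ext₂ (C := C) (ρ := X.ρ) (ρ' := Y.ρ) fun g a x h b y hx hy => ?_
    change (C.rightAct X).rTensor (G →₀ Y.V)
      (insertMap φ X Y (Finsupp.single g x ⊗ₜ Finsupp.single h y)) =
        splitMap X Y (C.tensMap X.ρ Y.V (Finsupp.single g x ⊗ₜ Finsupp.single h y))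
    rw [insertMap_single, tensMap_single hx, splitMap_single]
    refine congrArg (fun z => z ⊗ₜ[k] (Finsupp.single 1 y : G →₀ Y.V)) ?_
    rw [rightAct_single hx]
    simp
  · apply GradedVec.hom_ext
    refine finsupp_ext₂ (C := C) (ρ := X.ρ) (ρ' := Y.ρ) fun g a x h b y hx hy => ?_
    change (C.leftAct Y).lTensor (G →₀ X.V)
      (Grading.assocMap C.threeCocycle.ω (C.grading X.ρ) (GradedVec.groupAlgGrading k _)
        (C.grading Y.ρ) (insertMap φ X Y (Finsupp.single g x ⊗ₜ Finsupp.single h y))) =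
        Finsupp.single g x ⊗ₜ Finsupp.single h y
    rw [insertMap_single, Grading.assocMap_apply _ (hx.homog g) (GradedVec.homog_single _ _)
      (hy.homog 1), coe_eq_rangeEquiv, map_smul]
    have e : C.threeCocycle.ω ⟨g, a⟩ ⟨rangeEquiv φ ((rangeEquiv φ).symm h), 1⟩ ⟨1, b⟩ = 1 := by
      simp [threeCocycle, C.τ_one, C.σ_one_mid]
    rw [e, Units.val_one, one_smul]
    refine congrArg (fun z => (Finsupp.single g x : G →₀ X.V) ⊗ₜ[k] z) ?_
    rw [leftAct_single]
    simp

end CleftData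

/-! ### The fibre functor is fully faithful -/

namespace CleftData

variable {k : Type u} [Field k] {A : Type v} [Ring A] [HopfAlgebra k A] {Q G : Type}
    [Group Q] [Fintype Q] [CommGroup G] [Fintype G] {φ : Q →* MulAut G} (C : CleftData k A φ)

open Coalgebra

/-- Equivariance may be checked on the elements `d a` and `u g`. -/
theorem equivariant_of_gens {V W : Type*} [AddCommGroup V] [Module k V] [AddCommGroup W]
    [Module k W] {ρ : A →ₐ[k] Module.End k V} {ρ' : A →ₐ[k] Module.End k W} (f : V →ₗ[k] W)
    (hd : ∀ a x, f (ρ (C.d a) x) = ρ' (C.d a) (f x))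
    (hu : ∀ g x, f (ρ (C.u g) x) = ρ' (C.u g) (f x)) (b : A) (x : V) :
    f (ρ b x) = ρ' b (f x) := by
  refine LinearMap.congr_fun (f := f ∘ₗ ρ.toLinearMap.flip x) (g := ρ'.toLinearMap.flip (f x))
    (C.basis.ext fun y => ?_) b
  obtain ⟨t, g⟩ := y
  rw [C.basis_apply]
  change f (ρ (C.d t * C.u g) x) = ρ' (C.d t * C.u g) (f x)
  rw [map_mul, map_mul, Module.End.mul_apply, Module.End.mul_apply, hd, hu]

instance : (LaxBimod.functor C.fibData).Faithful where
  map_injective {X Y f g} h := by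
    have h1 : Finsupp.mapRange.linearMap (α := G) f.toLin =
        Finsupp.mapRange.linearMap g.toLin :=
      congrArg (fun z => GradedVec.Hom.toLin (Bimod.Hom.hom z)) h
    apply HopfRep.hom_ext
    ext x
    have h2 := LinearMap.congr_fun h1 (Finsupp.single 1 x)
    rw [mapRange_single, mapRange_single] at h2
    exact Finsupp.single_injective 1 h2

section Full

variable {C} {X Y : HopfRep.{u, v} k A} (L : (G →₀ X.V) →ₗ[k] (G →₀ Y.V))

/-- The restriction of a map of bimodules `kG ⊗ X → kG ⊗ Y` to the component of `1`. -/
noncomputable def core : X.V →ₗ[k] Y.V := Finsupp.lapply 1 ∘ₗ L ∘ₗ Finsupp.lsingle 1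

variable {L} (hg : ∀ p t, L ((C.grading X.ρ).proj p t) = (C.grading Y.ρ).proj p (L t))

include hg in
theorem core_deg {a : Q} {x : X.V} (hx : C.Deg X.ρ a x) :
    L (Finsupp.single 1 x) = Finsupp.single 1 (core L x) ∧ C.Deg Y.ρ a (core L x) := by
  have h1 := hg ⟨1, a⟩ (Finsupp.single 1 x)
  rw [hx.homog 1] at h1
  have h2 : L (Finsupp.single 1 x) = Finsupp.single 1 (Y.ρ (C.d a) (core L x)) := h1
  have h3 : core L x = Y.ρ (C.d a) (core L x) :=
    (congrArg (fun z => z 1) h2).trans Finsupp.single_eq_same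
  exact ⟨by rw [h2, ← h3], h3.symm⟩

include hg in
/-- Elements of degree `(1, a)` are of the form `1 ⊗ x`, hence a graded map preserves these. -/
theorem core_single (x : X.V) : L (Finsupp.single 1 x) = Finsupp.single 1 (core L x) :=
  LinearMap.congr_fun (f := L ∘ₗ Finsupp.lsingle 1) (g := Finsupp.lsingle 1 ∘ₗ core L)
    (deg_ext (C := C) (ρ := X.ρ) fun _ _ hx => (core_deg hg hx).1) x

variable (hL : ∀ t, L (C.leftAct X t) = C.leftAct Y (L.lTensor _ t))
  (hR : ∀ t, L (C.rightAct X t) = C.rightAct Y (L.rTensor _ t))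

include hg hL in
theorem core_single' (g : G) (x : X.V) : L (Finsupp.single g x) = Finsupp.single g (core L x) := by
  have h := hL (Finsupp.single ((rangeEquiv φ).symm g) 1 ⊗ₜ Finsupp.single 1 x)
  rw [LinearMap.lTensor_tmul, core_single hg, leftAct_single, leftAct_single] at h
  simpa using h

include hg hL hR in
/-- The right action of `h` recovers the action of `u h`, and the grading that of `d a`. -/
theorem core_equivariant (b : A) (x : X.V) : core L (X.ρ b x) = Y.ρ b (core L x) := by
  classical
  refine C.equivariant_of_gens (core L) (fun a x => ?_) (fun g x => ?_) b x
  · refine LinearMap.congr_fun (f := core L ∘ₗ X.ρ (C.d a)) (g := Y.ρ (C.d a) ∘ₗ core L)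
      (deg_ext (C := C) (ρ := X.ρ) fun c x hx => ?_) x
    rw [LinearMap.comp_apply, LinearMap.comp_apply, hx.d_apply, (core_deg hg hx).2.d_apply]
    split_ifs <;> simp
  · refine LinearMap.congr_fun (f := core L ∘ₗ X.ρ (C.u g)) (g := Y.ρ (C.u g) ∘ₗ core L)
      (deg_ext (C := C) (ρ := X.ρ) fun c x hx => ?_) x
    have h := hR (Finsupp.single 1 x ⊗ₜ Finsupp.single ((rangeEquiv φ).symm g) 1)
    rw [LinearMap.rTensor_tmul, core_single hg, rightAct_single hx,
      rightAct_single (core_deg hg hx).2, core_single' hg hL] at h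
    have h2 := Finsupp.single_injective _ h
    simpa using h2

end Full

instance : (LaxBimod.functor C.fibData).Full where
  map_surjective {X Y} f := by
    let L : (G →₀ X.V) →ₗ[k] (G →₀ Y.V) := f.hom.toLin
    have hg : ∀ p t, L ((C.grading X.ρ).proj p t) = (C.grading Y.ρ).proj p (L t) := f.hom.graded
    have hL : ∀ t, L (C.leftAct X t) = C.leftAct Y (L.lTensor _ t) :=
      LinearMap.congr_fun (congrArg GradedVec.Hom.toLin f.left_act_hom)
    have hR : ∀ t, L (C.rightAct X t) = C.rightAct Y (L.rTensor _ t) :=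
      LinearMap.congr_fun (congrArg GradedVec.Hom.toLin f.right_act_hom)
    refine ⟨⟨core L, core_equivariant hg hL hR⟩, ?_⟩
    apply Bimod.hom_ext
    apply GradedVec.hom_ext
    refine Finsupp.lhom_ext fun g x => ?_
    exact (mapRange_single _ _ _).trans (core_single' hg hL g x).symm

/-! ### Bimodules as graded spaces with operators -/

/-- The operators by which `G` acts from the left and from the right on a bimodule over `kG` in
`Vec^Γ_ω`, `Γ = G ⋊ Q`. -/
structure BimodOps (V : Type u) [AddCommGroup V] [Module k V] where
  gr : Grading k (G ⋊[φ] Q) V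
  L : G → V →ₗ[k] V
  R : G → V →ₗ[k] V
  L_homog : ∀ {g a v} h, gr.Homog ⟨g, a⟩ v → gr.Homog ⟨h * g, a⟩ (L h v)
  R_homog : ∀ {g a v} h, gr.Homog ⟨g, a⟩ v → gr.Homog ⟨g * φ a h, a⟩ (R h v)
  L_one : ∀ v, L 1 v = v
  R_one : ∀ v, R 1 v = v
  L_mul : ∀ g h v, L (g * h) v = L g (L h v)
  R_R : ∀ {g a v} l h, gr.Homog ⟨g, a⟩ v → R l (R h v) = (C.σ a l h : k) • R (h * l) v
  R_L : ∀ g h v, R h (L g v) = L g (R h v)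

section FromBimod

variable {C} (M : GroupTheoreticalCat C.twist)

/-- The left action of a bimodule as a linear map. -/
noncomputable def lact :
    ((SemidirectProduct.inl : G →* G ⋊[φ] Q).range →₀ k) ⊗[k] M.X.V →ₗ[k] M.X.V :=
  M.actLeft.toLin

/-- The right action of a bimodule as a linear map. -/
noncomputable def ract :
    M.X.V ⊗[k] ((SemidirectProduct.inl : G →* G ⋊[φ] Q).range →₀ k) →ₗ[k] M.X.V :=
  M.actRight.toLin

theorem lact_homog {g h : G} {a : Q} {v : M.X.V} (hv : M.X.gr.Homog ⟨g, a⟩ v) :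
    M.X.gr.Homog ⟨h * g, a⟩ (lact M (Finsupp.single ((rangeEquiv φ).symm h) 1 ⊗ₜ v)) := by
  have h1 := GradedVec.homog_map M.actLeft
    ((GradedVec.homog_single ((rangeEquiv φ).symm h) (1 : k)).tmul hv)
  have e : (((rangeEquiv φ).symm h : (SemidirectProduct.inl : G →* G ⋊[φ] Q).range) : G ⋊[φ] Q) *
      ⟨g, a⟩ = ⟨h * g, a⟩ := by
    rw [coe_eq_rangeEquiv]
    exact SemidirectProduct.ext (by simp) (by simp)
  rw [e] at h1
  exact h1

theorem ract_homog {g h : G} {a : Q} {v : M.X.V} (hv : M.X.gr.Homog ⟨g, a⟩ v) :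
    M.X.gr.Homog ⟨g * φ a h, a⟩ (ract M (v ⊗ₜ Finsupp.single ((rangeEquiv φ).symm h) 1)) := by
  have h1 := GradedVec.homog_map M.actRight
    (hv.tmul (GradedVec.homog_single ((rangeEquiv φ).symm h) (1 : k)))
  have e : (⟨g, a⟩ : G ⋊[φ] Q) *
      ((rangeEquiv φ).symm h : (SemidirectProduct.inl : G →* G ⋊[φ] Q).range) =
        ⟨g * φ a h, a⟩ := by
    rw [coe_eq_rangeEquiv]
    exact SemidirectProduct.ext (by simp) (by simp)
  rw [e] at h1
  exact h1

theorem lact_one (v : M.X.V) : lact M (Finsupp.single 1 1 ⊗ₜ v) = v := by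
  have := LinearMap.congr_fun (congrArg GradedVec.Hom.toLin M.one_actLeft) ((1 : k) ⊗ₜ v)
  exact Eq.trans this (one_smul k v)

theorem ract_one (v : M.X.V) : ract M (v ⊗ₜ Finsupp.single 1 1) = v := by
  have := LinearMap.congr_fun (congrArg GradedVec.Hom.toLin M.actRight_one) (v ⊗ₜ (1 : k))
  exact Eq.trans this (one_smul k v)

theorem lact_lact {p : G ⋊[φ] Q} (x y : (SemidirectProduct.inl : G →* G ⋊[φ] Q).range) {v : M.X.V}
    (hv : M.X.gr.Homog p v) :
    lact M (GradedVec.mulMap C.twist (Finsupp.single x 1 ⊗ₜ Finsupp.single y 1) ⊗ₜ v) =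
      (C.threeCocycle.ω x y p : k) •
        lact M (Finsupp.single x 1 ⊗ₜ lact M (Finsupp.single y 1 ⊗ₜ v)) := by
  have h := LinearMap.congr_fun (congrArg GradedVec.Hom.toLin M.left_assoc)
    ((Finsupp.single x 1 ⊗ₜ Finsupp.single y 1) ⊗ₜ v)
  refine h.trans ?_
  change lact M ((lact M).lTensor _ (Grading.assocMap C.threeCocycle.ω
    (GradedVec.groupAlgGrading k _) (GradedVec.groupAlgGrading k _) M.X.gr
      ((Finsupp.single x 1 ⊗ₜ Finsupp.single y 1) ⊗ₜ v))) = _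
  rw [Grading.assocMap_apply _ (GradedVec.homog_single x 1) (GradedVec.homog_single y 1) hv,
    map_smul, map_smul, LinearMap.lTensor_tmul]

theorem ract_ract {p : G ⋊[φ] Q} (x y : (SemidirectProduct.inl : G →* G ⋊[φ] Q).range) {v : M.X.V}
    (hv : M.X.gr.Homog p v) :
    ract M (ract M (v ⊗ₜ Finsupp.single x 1) ⊗ₜ Finsupp.single y 1) =
      (C.threeCocycle.ω p x y : k) •
        ract M (v ⊗ₜ GradedVec.mulMap C.twist (Finsupp.single x 1 ⊗ₜ Finsupp.single y 1)) := by
  have h0 := congrArg ((α_ _ _ _).hom ≫ ·) M.right_assoc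
  simp only [Iso.hom_inv_id_assoc] at h0
  have h := LinearMap.congr_fun (congrArg GradedVec.Hom.toLin h0)
    ((v ⊗ₜ Finsupp.single x 1) ⊗ₜ Finsupp.single y 1)
  refine h.symm.trans ?_
  change ract M ((GradedVec.mulMap C.twist).lTensor _ (Grading.assocMap C.threeCocycle.ω
    M.X.gr (GradedVec.groupAlgGrading k _) (GradedVec.groupAlgGrading k _)
      ((v ⊗ₜ Finsupp.single x 1) ⊗ₜ Finsupp.single y 1))) = _
  rw [Grading.assocMap_apply _ hv (GradedVec.homog_single x 1) (GradedVec.homog_single y 1),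
    map_smul, map_smul, LinearMap.lTensor_tmul]

theorem ract_lact {p : G ⋊[φ] Q} (x y : (SemidirectProduct.inl : G →* G ⋊[φ] Q).range) {v : M.X.V}
    (hv : M.X.gr.Homog p v) :
    ract M (lact M (Finsupp.single x 1 ⊗ₜ v) ⊗ₜ Finsupp.single y 1) =
      (C.threeCocycle.ω x p y : k) •
        lact M (Finsupp.single x 1 ⊗ₜ ract M (v ⊗ₜ Finsupp.single y 1)) := by
  have h := LinearMap.congr_fun (congrArg GradedVec.Hom.toLin M.middle_assoc)
    ((Finsupp.single x 1 ⊗ₜ v) ⊗ₜ Finsupp.single y 1)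
  refine h.trans ?_
  change lact M ((ract M).lTensor _ (Grading.assocMap C.threeCocycle.ω
    (GradedVec.groupAlgGrading k _) M.X.gr (GradedVec.groupAlgGrading k _)
      ((Finsupp.single x 1 ⊗ₜ v) ⊗ₜ Finsupp.single y 1))) = _
  rw [Grading.assocMap_apply _ (GradedVec.homog_single x 1) hv (GradedVec.homog_single y 1),
    map_smul, map_smul, LinearMap.lTensor_tmul]

theorem mulMap_symm (g h : G) : GradedVec.mulMap C.twist
    (Finsupp.single ((rangeEquiv φ).symm g) 1 ⊗ₜ Finsupp.single ((rangeEquiv φ).symm h) 1) =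
      Finsupp.single ((rangeEquiv φ).symm (g * h)) (1 : k) := by
  rw [GradedVec.mulMap_single]
  have : (rangeEquiv φ).symm g * (rangeEquiv φ).symm h = (rangeEquiv φ).symm (g * h) :=
    (rangeEquiv φ).injective (by simp [rangeEquiv_mul])
  rw [this]
  simp [twist]

/-- The operators of a bimodule. -/
noncomputable def bimodOps : BimodOps C M.X.V where
  gr := M.X.gr
  L h := lact M ∘ₗ TensorProduct.mk k _ _ (Finsupp.single ((rangeEquiv φ).symm h) 1)
  R h := ract M ∘ₗ (TensorProduct.mk k _ _).flip (Finsupp.single ((rangeEquiv φ).symm h) 1)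
  L_homog h hv := lact_homog M hv
  R_homog h hv := ract_homog M hv
  L_one v := lact_one M v
  R_one v := ract_one M v
  L_mul g h v := by
    refine LinearMap.congr_fun
      (f := lact M ∘ₗ TensorProduct.mk k _ _ (Finsupp.single ((rangeEquiv φ).symm (g * h)) 1))
      (g := (lact M ∘ₗ TensorProduct.mk k _ _ (Finsupp.single ((rangeEquiv φ).symm g) 1)) ∘ₗ
        (lact M ∘ₗ TensorProduct.mk k _ _ (Finsupp.single ((rangeEquiv φ).symm h) 1)))
      (M.X.gr.ext_map fun p v hv => ?_) v
    have := lact_lact M ((rangeEquiv φ).symm g) ((rangeEquiv φ).symm h) hv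
    rw [mulMap_symm] at this
    refine this.trans ?_
    have e : C.threeCocycle.ω ((rangeEquiv φ).symm g) ((rangeEquiv φ).symm h) p = 1 := by
      simp [threeCocycle, coe_eq_rangeEquiv, C.τ_left, C.σ_one_left]
    rw [e, Units.val_one, one_smul]
    rfl
  R_R {g a v} l h hv := by
    have := ract_ract M ((rangeEquiv φ).symm h) ((rangeEquiv φ).symm l) hv
    rw [mulMap_symm] at this
    refine this.trans ?_
    have e : C.threeCocycle.ω ⟨g, a⟩ ((rangeEquiv φ).symm h) ((rangeEquiv φ).symm l) =
        C.σ a l h := by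
      simp [threeCocycle, coe_eq_rangeEquiv, C.τ_right]
    rw [e]
    rfl
  R_L g h v := by
    refine LinearMap.congr_fun
      (f := (ract M ∘ₗ (TensorProduct.mk k _ _).flip (Finsupp.single ((rangeEquiv φ).symm h) 1)) ∘ₗ
        (lact M ∘ₗ TensorProduct.mk k _ _ (Finsupp.single ((rangeEquiv φ).symm g) 1)))
      (g := (lact M ∘ₗ TensorProduct.mk k _ _ (Finsupp.single ((rangeEquiv φ).symm g) 1)) ∘ₗ
        (ract M ∘ₗ (TensorProduct.mk k _ _).flip (Finsupp.single ((rangeEquiv φ).symm h) 1)))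
      (M.X.gr.ext_map fun p v hv => ?_) v
    refine (ract_lact M ((rangeEquiv φ).symm g) ((rangeEquiv φ).symm h) hv).trans ?_
    have e : C.threeCocycle.ω ((rangeEquiv φ).symm g) p ((rangeEquiv φ).symm h) = 1 := by
      simp [threeCocycle, coe_eq_rangeEquiv, C.τ_left, C.σ_one_left]
    rw [e, Units.val_one, one_smul]
    rfl

end FromBimod

end CleftData

/-! ### The representation attached to a bimodule -/

namespace CleftData

variable {k : Type u} [Field k] {A : Type v} [Ring A] [HopfAlgebra k A] {Q G : Type}
    [Group Q] [Fintype Q] [CommGroup G] [Fintype G] {φ : Q →* MulAut G} {C : CleftData k A φ}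

open Coalgebra

namespace BimodOps

variable {V : Type u} [AddCommGroup V] [Module k V] (O : BimodOps C V)

/-- The projection to the component of degree `(1, a)`. -/
def D (a : Q) : V →ₗ[k] V := O.gr.proj ⟨1, a⟩

/-- The operator by which the element `u h` acts on the components of degree `(1, a)`. -/
def U (h : G) : V →ₗ[k] V := ∑ a, O.L (φ a h)⁻¹ ∘ₗ O.R h ∘ₗ O.D a

open Classical in
theorem D_apply {a : Q} {v : V} (hv : O.gr.Homog ⟨1, a⟩ v) (b : Q) :
    O.D b v = if b = a then v else 0 := by
  have e : ((⟨1, b⟩ : G ⋊[φ] Q) = ⟨1, a⟩) = (b = a) := by simp [SemidirectProduct.ext_iff]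
  rw [D, hv.proj_eq]
  simp only [e]

theorem U_apply {a : Q} {v : V} (hv : O.gr.Homog ⟨1, a⟩ v) (h : G) :
    O.U h v = O.L (φ a h)⁻¹ (O.R h v) := by
  classical
  rw [U, LinearMap.sum_apply, Finset.sum_eq_single a]
  · simp [O.D_apply hv]
  · intro b _ hb
    simp [O.D_apply hv, hb]
  · simp

theorem U_homog {a : Q} {v : V} (hv : O.gr.Homog ⟨1, a⟩ v) (h : G) :
    O.gr.Homog ⟨1, a⟩ (O.U h v) := by
  rw [O.U_apply hv]
  have := O.L_homog (φ a h)⁻¹ (O.R_homog h hv)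
  rwa [one_mul, inv_mul_cancel] at this

/-- The operators `U` multiply like the elements `d a * u h` of `A`. -/
theorem U_U {a : Q} {v : V} (hv : O.gr.Homog ⟨1, a⟩ v) (g h : G) :
    O.U g (O.U h v) = (C.σ a g h : k) • O.U (g * h) v := by
  rw [O.U_apply (O.U_homog hv h), O.U_apply hv, O.U_apply hv, O.R_L, O.R_R g h hv, ← O.L_mul,
    map_smul, map_mul, mul_inv, mul_comm g h]

theorem U_one {a : Q} {v : V} (hv : O.gr.Homog ⟨1, a⟩ v) : O.U 1 v = v := by
  rw [O.U_apply hv, map_one, inv_one, O.L_one, O.R_one]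

/-- The action of `A` on the components of degree `(1, a)`, extended by zero. -/
noncomputable def E : A →ₗ[k] Module.End k V := C.basis.constr k fun x => O.D x.1 ∘ₗ O.U x.2

theorem E_du (t : Q) (g : G) : O.E (C.d t * C.u g) = O.D t ∘ₗ O.U g := by
  rw [← C.basis_apply, E, Module.Basis.constr_basis]

open Classical in
theorem E_du_apply {a : Q} {v : V} (hv : O.gr.Homog ⟨1, a⟩ v) (t : Q) (g : G) :
    O.E (C.d t * C.u g) v = if t = a then O.U g v else 0 := by
  rw [E_du, LinearMap.comp_apply, O.D_apply (O.U_homog hv g)]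

open Classical in
theorem E_d_apply {a : Q} {v : V} (hv : O.gr.Homog ⟨1, a⟩ v) (t : Q) :
    O.E (C.d t) v = if t = a then v else 0 := by
  rw [← mul_one (C.d t), ← C.u_one, O.E_du_apply hv, O.U_one hv]

theorem E_mul {a : Q} {v : V} (hv : O.gr.Homog ⟨1, a⟩ v) (x y : A) :
    O.E (x * y) v = O.E x (O.E y v) := by
  classical
  have : (LinearMap.mul k A).compr₂ (O.E.flip v) =
      ((LinearMap.id : Module.End k V →ₗ[k] Module.End k V).compl₁₂ O.E (O.E.flip v)) := by
    refine LinearMap.ext_basis C.basis C.basis fun x y => ?_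
    obtain ⟨t, g⟩ := x
    obtain ⟨s, h⟩ := y
    rw [C.basis_apply, C.basis_apply]
    change O.E ((C.d t * C.u g) * (C.d s * C.u h)) v =
      O.E (C.d t * C.u g) (O.E (C.d s * C.u h) v)
    rw [O.E_du_apply hv]
    by_cases hts : t = s
    · subst hts
      rw [C.du_mul_du, map_smul, LinearMap.smul_apply, O.E_du_apply hv]
      by_cases ht : t = a
      · subst ht
        rw [if_pos rfl, if_pos rfl, O.E_du_apply (O.U_homog hv h), if_pos rfl, O.U_U hv]
      · rw [if_neg ht, if_neg ht, map_zero, smul_zero]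
    · rw [C.du_mul_du_ne hts, map_zero, LinearMap.zero_apply]
      by_cases hs : s = a
      · subst hs
        rw [if_pos rfl, O.E_du_apply (O.U_homog hv h), if_neg hts]
      · rw [if_neg hs, map_zero]
  exact LinearMap.congr_fun₂ this x y

/-- The sum of the components of degree `(1, a)`. -/
def W : Submodule k V := LinearMap.eqLocus (∑ a, O.D a) LinearMap.id

theorem mem_W {v : V} : v ∈ O.W ↔ ∑ a, O.D a v = v := by
  rw [W, LinearMap.mem_eqLocus, LinearMap.sum_apply, LinearMap.id_apply]

theorem homog_mem {a : Q} {v : V} (hv : O.gr.Homog ⟨1, a⟩ v) : v ∈ O.W := by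
  classical
  rw [mem_W]
  simp [O.D_apply hv]

theorem D_mem (a : Q) (v : V) : O.D a v ∈ O.W := O.homog_mem (O.gr.homog_proj _ v)

theorem E_mem (b : A) (v : V) : O.E b v ∈ O.W := by
  have : O.W.mkQ ∘ₗ O.E.flip v = 0 := by
    refine C.basis.ext fun x => ?_
    obtain ⟨t, g⟩ := x
    rw [C.basis_apply, LinearMap.comp_apply, LinearMap.flip_apply, E_du]
    exact (Submodule.Quotient.mk_eq_zero _).2 (O.D_mem t _)
  exact (Submodule.Quotient.mk_eq_zero _).1 (LinearMap.congr_fun this b)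

/-- A linear map on `W` is determined by its values on elements of degree `(1, a)`. -/
theorem W_ext {M : Type*} [AddCommMonoid M] [Module k M] {f f' : O.W →ₗ[k] M}
    (h : ∀ a v (hv : O.gr.Homog ⟨1, a⟩ v), f ⟨v, O.homog_mem hv⟩ = f' ⟨v, O.homog_mem hv⟩) :
    f = f' := by
  refine LinearMap.ext fun w => ?_
  have e : w = ∑ a, ⟨O.D a w, O.D_mem a w⟩ := by
    ext
    rw [AddSubmonoidClass.coe_finsetSum]
    exact (O.mem_W.1 w.2).symm
  rw [e, map_sum, map_sum]
  exact Finset.sum_congr rfl fun a _ => h a _ (O.gr.homog_proj _ _)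

/-- The representation of `A` on the sum of the components of degree `(1, a)`. -/
noncomputable def rho : A →ₐ[k] Module.End k O.W :=
  AlgHom.ofLinearMap
    { toFun := fun b => (O.E b).restrict fun v _ => O.E_mem b v
      map_add' := fun x y => by
        ext v
        simp [LinearMap.restrict_apply]
      map_smul' := fun c x => by
        ext v
        simp [LinearMap.restrict_apply] }
    (by
      classical
      refine O.W_ext fun a v hv => Subtype.ext ?_
      change O.E 1 v = v
      rw [← C.sum_d, map_sum, LinearMap.sum_apply]
      simp [O.E_d_apply hv])
    (fun x y => O.W_ext fun a v hv => Subtype.ext (O.E_mul hv x y))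

theorem rho_coe (b : A) (w : O.W) : (O.rho b w : V) = O.E b w := rfl

theorem Deg.homog_coe {a : Q} {w : O.W} (hw : C.Deg O.rho a w) : O.gr.Homog ⟨1, a⟩ (w : V) := by
  classical
  have : (O.W.subtype ∘ₗ O.rho (C.d a)) = O.D a ∘ₗ O.W.subtype := by
    refine O.W_ext fun b v hv => ?_
    change O.E (C.d a) v = O.D a v
    rw [O.E_d_apply hv, O.D_apply hv]
  have h1 := LinearMap.congr_fun this w
  have h2 : (O.rho (C.d a) w : V) = w := congrArg Subtype.val hw
  exact h1.symm.trans h2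

theorem coe_U {a : Q} {w : O.W} (hw : C.Deg O.rho a w) (h : G) :
    (O.rho (C.u h) w : V) = O.L (φ a h)⁻¹ (O.R h w) := by
  have hv := Deg.homog_coe O hw
  rw [← O.U_apply hv]
  have : O.rho (C.u h) w = O.rho (C.d a * C.u h) w := by
    rw [C.d_comm, map_mul, Module.End.mul_apply, hw]
  rw [this, rho_coe, O.E_du_apply hv, if_pos rfl]

/-- The comparison map `g ⊗ v ↦ g · v`. -/
noncomputable def T : (G →₀ O.W) →ₗ[k] V := Finsupp.lsum k fun g => O.L g ∘ₗ O.W.subtype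

theorem T_single (g : G) (w : O.W) : O.T (Finsupp.single g w) = O.L g w := by
  rw [T, Finsupp.lsum_single]
  rfl

theorem T_homog {a : Q} {w : O.W} (hw : C.Deg O.rho a w) (g : G) :
    O.gr.Homog ⟨g, a⟩ (O.T (Finsupp.single g w)) := by
  have := O.L_homog g (Deg.homog_coe O hw)
  rwa [mul_one, ← T_single] at this

theorem T_graded (p : G ⋊[φ] Q) (t : G →₀ O.W) :
    O.T ((C.grading O.rho).proj p t) = O.gr.proj p (O.T t) :=
  graded_of_homog (C := C) (ρ := O.rho) O.gr O.T (fun g _ _ hw => O.T_homog hw g) p t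

/-- The map `T` is injective since the grading separates the subspaces `L g W`. -/
theorem proj_T (g : G) (a : Q) (t : G →₀ O.W) : O.gr.proj ⟨g, a⟩ (O.T t) = O.L g (O.D a (t g)) := by
  classical
  refine LinearMap.congr_fun (f := O.gr.proj ⟨g, a⟩ ∘ₗ O.T)
    (g := O.L g ∘ₗ O.D a ∘ₗ O.W.subtype ∘ₗ Finsupp.lapply g)
    (finsupp_ext (C := C) (ρ := O.rho) fun h b w hw => ?_) t
  simp only [LinearMap.comp_apply, Finsupp.lapply_apply, Finsupp.single_apply]
  rw [(O.T_homog hw h).proj_eq]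
  by_cases e : h = g
  · subst e
    rw [if_pos rfl, Submodule.subtype_apply, O.D_apply (Deg.homog_coe O hw)]
    by_cases e' : a = b
    · subst e'
      rw [if_pos rfl, if_pos rfl, T_single]
    · rw [if_neg e', if_neg (fun h => e' (congrArg SemidirectProduct.right h)), map_zero]
  · rw [if_neg e, if_neg (fun h => e (congrArg SemidirectProduct.left h).symm), map_zero, map_zero,
      map_zero]

theorem L_cancel (g : G) (v : V) : O.L g⁻¹ (O.L g v) = v := by
  rw [← O.L_mul, inv_mul_cancel, O.L_one]

theorem T_injective : Function.Injective O.T := by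
  refine (injective_iff_map_eq_zero O.T).2 fun t ht => ?_
  ext g
  rw [← O.mem_W.1 (t g).2]
  refine Finset.sum_eq_zero fun a _ => ?_
  rw [← O.L_cancel g (O.D a _), ← proj_T, ht, map_zero, map_zero]

theorem T_surjective : Function.Surjective O.T := by
  intro v
  change v ∈ LinearMap.range O.T
  rw [← O.gr.sum_proj v]
  refine Submodule.sum_mem _ fun p _ => ?_
  have h1 := O.L_homog p.left⁻¹ (O.gr.homog_proj p v)
  rw [inv_mul_cancel] at h1
  refine ⟨Finsupp.single p.left ⟨_, O.homog_mem h1⟩, ?_⟩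
  rw [T_single, ← O.L_mul, mul_inv_cancel, O.L_one]

end BimodOps

variable (M : GroupTheoreticalCat C.twist)

/-- The representation of `A` attached to a bimodule. -/
@[reducible]
noncomputable def repOfBimod : HopfRep.{u, v} k A where
  V := (bimodOps M).W
  ρ := (bimodOps M).rho

theorem smul_single_one {ι : Type*} (x : ι) (r : k) :
    Finsupp.single x r = r • (Finsupp.single x 1 : ι →₀ k) := by simp

theorem T_leftAct (t) : (bimodOps M).T (C.leftAct (repOfBimod M) t) =
    lact M ((bimodOps M).T.lTensor _ t) := by
  refine LinearMap.congr_fun (f := (bimodOps M).T ∘ₗ C.leftAct (repOfBimod M))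
    (g := lact M ∘ₗ (bimodOps M).T.lTensor _)
    (TensorProduct.ext (Finsupp.lhom_ext fun x r => Finsupp.lhom_ext fun g w => ?_)) t
  change (bimodOps M).T (C.leftAct (repOfBimod M) (Finsupp.single x r ⊗ₜ Finsupp.single g w)) =
    lact M (Finsupp.single x r ⊗ₜ (bimodOps M).T (Finsupp.single g w))
  refine (congrArg (bimodOps M).T (leftAct_single x r g w)).trans ?_
  refine ((bimodOps M).T_single _ _).trans ?_
  rw [BimodOps.T_single, BimodOps.L_mul, smul_single_one, ← TensorProduct.smul_tmul', map_smul]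
  refine (map_smul ((bimodOps M).L _ ∘ₗ (bimodOps M).L _ ∘ₗ (bimodOps M).W.subtype) r w).trans ?_
  change r • lact M (Finsupp.single ((rangeEquiv φ).symm (rangeEquiv φ x)) 1 ⊗ₜ _) = _
  rw [Equiv.symm_apply_apply]
  rfl

theorem T_rightAct (t) : (bimodOps M).T (C.rightAct (repOfBimod M) t) =
    ract M ((bimodOps M).T.rTensor _ t) := by
  refine LinearMap.congr_fun (f := (bimodOps M).T ∘ₗ C.rightAct (repOfBimod M))
    (g := ract M ∘ₗ (bimodOps M).T.rTensor _)
    (TensorProduct.ext (finsupp_ext (C := C) (ρ := (bimodOps M).rho) fun g a w hw =>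
      Finsupp.lhom_ext fun x r => ?_)) t
  change (bimodOps M).T (C.rightAct (repOfBimod M) (Finsupp.single g w ⊗ₜ Finsupp.single x r)) =
    ract M ((bimodOps M).T (Finsupp.single g w) ⊗ₜ Finsupp.single x r)
  refine (congrArg (bimodOps M).T (rightAct_single (X := repOfBimod M) hw x r g)).trans ?_
  refine ((bimodOps M).T_single _ _).trans ?_
  rw [BimodOps.T_single, BimodOps.L_mul, smul_single_one, TensorProduct.tmul_smul, map_smul]
  refine (map_smul ((bimodOps M).L _ ∘ₗ (bimodOps M).L _ ∘ₗ (bimodOps M).W.subtype) r _).trans ?_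
  congr 1
  change (bimodOps M).L _ ((bimodOps M).L _ ((bimodOps M).rho (C.u (rangeEquiv φ x)) w :
    (bimodOps M).W)) = _
  rw [(bimodOps M).coe_U hw, ← BimodOps.L_mul _ (φ a _), mul_inv_cancel, BimodOps.L_one,
    ← BimodOps.R_L]
  change ract M (_ ⊗ₜ Finsupp.single ((rangeEquiv φ).symm (rangeEquiv φ x)) 1) = _
  rw [Equiv.symm_apply_apply]

/-- A bimodule is isomorphic to the image of the representation attached to it. -/
noncomputable def bimodIso : (LaxBimod.functor C.fibData).obj (repOfBimod M) ≅ M :=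
  Bimod.isoOfIso (Q := M)
    (GradedVec.mkIso (X := C.fib (repOfBimod M)) (Y := M.X)
      (LinearEquiv.ofBijective (bimodOps M).T ⟨(bimodOps M).T_injective, (bimodOps M).T_surjective⟩)
      (bimodOps M).T_graded)
    (GradedVec.hom_ext (LinearMap.ext (T_leftAct M)))
    (GradedVec.hom_ext (LinearMap.ext (T_rightAct M)))

instance : (LaxBimod.functor C.fibData).EssSurj where
  mem_essImage M := ⟨repOfBimod M, ⟨bimodIso M⟩⟩

/-- The functor `X ↦ kG ⊗ X` is a `k`-linear monoidal equivalence from the representations of a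
cleft extension to the `kG`-bimodules in `Vec^Γ_ω`, `Γ = G ⋊ Q`. -/
theorem isGroupTheoretical (C : CleftData k A φ) : IsGroupTheoretical k A := by
  have : (LaxBimod.functor C.fibData).IsEquivalence := {}
  refine ⟨G ⋊[φ] Q, inferInstance, inferInstance, C.threeCocycle, _, C.twist,
    (LaxBimod.functor C.fibData).asEquivalence,
    ⟨(LaxBimod.coreMonoidal C.fibData).toMonoidal⟩, ?_, ?_⟩
  · refine @Functor.Additive.mk _ _ _ _ _ _ _ fun {X Y f g} => ?_
    apply GradedVec.hom_ext
    refine Finsupp.lhom_ext fun h x => ?_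
    refine (mapRange_single (f + g).toLin h x).trans ?_
    refine Eq.trans ?_ (congrArg₂ (· + ·) (mapRange_single f.toLin h x)
      (mapRange_single g.toLin h x)).symm
    exact Finsupp.single_add _ _ _
  · refine ⟨fun {X Y} f r => ?_⟩
    apply GradedVec.hom_ext
    refine Finsupp.lhom_ext fun h x => ?_
    refine (mapRange_single (r • f).toLin h x).trans ?_
    refine Eq.trans ?_ (congrArg (r • ·) (mapRange_single f.toLin h x)).symm
    exact (Finsupp.smul_single _ _ _).symm

end CleftData

/-! ### Change of the quotient group -/

namespace CleftData

variable {k : Type*} [Field k] {A : Type*} [Ring A] [HopfAlgebra k A] {Q G H : Type*}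
    [Group Q] [Fintype Q] [CommGroup G] [Fintype G] [CommGroup H] [Fintype H] {φ : Q →* MulAut G}

/-- Transport of a cleft extension along an isomorphism of the quotient group. -/
noncomputable def congr (C : CleftData k A φ) (e : G ≃* H) :
    CleftData k A ((MulAut.congr e).toMonoidHom.comp φ) where
  d := C.d
  u h := C.u (e.symm h)
  σ t g h := C.σ t (e.symm g) (e.symm h)
  τ g := C.τ (e.symm g)
  d_mul_self := C.d_mul_self
  d_mul_ne := C.d_mul_ne
  sum_d := C.sum_d
  d_comm := C.d_comm
  u_one := by rw [map_one, C.u_one]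
  u_mul g h := by rw [C.u_mul, map_mul]
  comul_d := C.comul_d
  comul_u g := by
    rw [C.comul_u]
    simp
  counit_d_one := C.counit_d_one
  counit_u g := C.counit_u _
  basis := C.basis.reindex ((Equiv.refl Q).prodCongr e.toEquiv)
  basis_apply t g := by
    rw [Module.Basis.reindex_apply]
    exact C.basis_apply _ _

end CleftData

/-! ### Semisimple Hopf algebras -/

section Integral

variable {k : Type*} [Field k] {A : Type*} [Ring A] [HopfAlgebra k A]

open Coalgebra

variable (k A) in
/-- A semisimple Hopf algebra has a left integral with counit `1`. -/
theorem exists_integral [IsSemisimpleRing A] :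
    ∃ l : A, counit (R := k) l = 1 ∧ ∀ a, a * l = counit (R := k) a • l := by
  let K : Ideal A := RingHom.ker (Bialgebra.counitAlgHom k A)
  obtain ⟨I, hI⟩ := exists_isCompl K
  have h1 : (1 : A) ∈ K ⊔ I := by rw [hI.sup_eq_top]; exact Submodule.mem_top
  obtain ⟨x, hx, l, hl, hxl⟩ := Submodule.mem_sup.1 h1
  have hx' : counit (R := k) x = 0 := hx
  have hl1 : counit (R := k) l = 1 := by
    have := congrArg (counit (R := k)) hxl
    rwa [map_add, hx', zero_add, Bialgebra.counit_one] at this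
  refine ⟨l, hl1, fun a => ?_⟩
  have h2 : a * l - counit (R := k) a • l ∈ K ⊓ I := by
    constructor
    · change counit (R := k) _ = 0
      rw [map_sub, Bialgebra.counit_mul, map_smul, hl1]
      simp
    · rw [Algebra.smul_def]
      exact I.sub_mem (I.mul_mem_left _ hl) (I.mul_mem_left _ hl)
  rw [hI.inf_eq_bot] at h2
  exact sub_eq_zero.1 h2

/-- The map `x ⊗ y ↦ x ⊗ S(y)`. -/
noncomputable def antipodeRight : A ⊗[k] A →ₗ[k] A ⊗[k] A :=
  (HopfAlgebra.antipode k (A := A)).lTensor A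

/-- The map `(b ⊗ c) ⊗ d ↦ (id ⊗ S)((b ⊗ c) x) (1 ⊗ d)`. -/
noncomputable def antipodeSandwich (x : A ⊗[k] A) : (A ⊗[k] A) ⊗[k] A →ₗ[k] A ⊗[k] A :=
  LinearMap.mul' k (A ⊗[k] A) ∘ₗ
    TensorProduct.map (antipodeRight ∘ₗ LinearMap.mulRight k x) (TensorProduct.mk k A A 1)

theorem antipodeSandwich_tmul (x y : A ⊗[k] A) (d : A) :
    antipodeSandwich x (y ⊗ₜ d) = antipodeRight (y * x) * (1 ⊗ₜ d) := rfl

theorem antipodeSandwich_assoc (p q b : A) (y : A ⊗[k] A) :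
    antipodeSandwich (p ⊗ₜ q) ((TensorProduct.assoc k A A A).symm (b ⊗ₜ y)) =
      (b * p) ⊗ₜ (HopfAlgebra.antipode k q *
        LinearMap.mul' k A ((HopfAlgebra.antipode k).rTensor A y)) := by
  induction y with
  | zero => simp
  | add s t hs ht => rw [tmul_add, map_add, map_add, hs, ht, map_add, map_add, mul_add, tmul_add]
  | tmul c d =>
    rw [TensorProduct.assoc_symm_tmul, antipodeSandwich_tmul,
      Algebra.TensorProduct.tmul_mul_tmul, antipodeRight, LinearMap.lTensor_tmul,
      Algebra.TensorProduct.tmul_mul_tmul, HopfAlgebra.antipode_mul_antidistrib, mul_one,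
      LinearMap.rTensor_tmul, LinearMap.mul'_apply, mul_assoc]

/-- The identity `a₁ x₁ ⊗ S(a₂ x₂) a₃ = a x₁ ⊗ S(x₂)` for `x = x₁ ⊗ x₂`. -/
theorem antipodeSandwich_comul (x : A ⊗[k] A) (a : A) :
    antipodeSandwich x ((comul (R := k)).rTensor A (comul (R := k) a)) =
      (a ⊗ₜ[k] 1) * antipodeRight x := by
  have h1 : (comul (R := k)).rTensor A (comul (R := k) a) = (TensorProduct.assoc k A A A).symm
      ((comul (R := k)).lTensor A (comul (R := k) a)) := by
    rw [← Coalgebra.coassoc_apply, LinearEquiv.symm_apply_apply]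
  have h2 : ∀ w : A ⊗[k] A, antipodeSandwich x ((TensorProduct.assoc k A A A).symm
      ((comul (R := k)).lTensor A w)) =
        (TensorProduct.rid k A ((counit (R := k)).lTensor A w) ⊗ₜ[k] 1) * antipodeRight x := by
    intro w
    induction x with
    | zero =>
      have : antipodeSandwich (0 : A ⊗[k] A) = 0 := by
        refine TensorProduct.ext' fun y d => ?_
        rw [antipodeSandwich_tmul, mul_zero, map_zero, zero_mul, LinearMap.zero_apply]
      rw [this, map_zero, mul_zero, LinearMap.zero_apply]
    | add s t hs ht =>
      rw [map_add, mul_add, ← hs, ← ht]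
      have : antipodeSandwich (s + t) = antipodeSandwich s + antipodeSandwich t := by
        refine TensorProduct.ext' fun y d => ?_
        rw [LinearMap.add_apply, antipodeSandwich_tmul, antipodeSandwich_tmul,
          antipodeSandwich_tmul, mul_add, map_add, add_mul]
      rw [this, LinearMap.add_apply]
    | tmul p q =>
      induction w with
      | zero => simp
      | add s t hs ht => rw [map_add, map_add, map_add, hs, ht, map_add, map_add, add_tmul, add_mul]
      | tmul b c =>
        rw [LinearMap.lTensor_tmul, antipodeSandwich_assoc,
          HopfAlgebra.mul_antipode_rTensor_comul_apply, LinearMap.lTensor_tmul,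
          TensorProduct.rid_tmul, antipodeRight, LinearMap.lTensor_tmul,
          Algebra.TensorProduct.tmul_mul_tmul, one_mul, smul_mul_assoc, ← Algebra.commutes,
          ← Algebra.smul_def, TensorProduct.smul_tmul]
  rw [h1, h2, Coalgebra.lTensor_counit_comul, TensorProduct.rid_tmul, one_smul]

variable (k A) in
/-- The separability idempotent `∑ l₁ ⊗ S(l₂)` of a semisimple Hopf algebra. -/
theorem exists_separability [IsSemisimpleRing A] : ∃ e : A ⊗[k] A,
    LinearMap.mul' k A e = 1 ∧ ∀ a : A, (a ⊗ₜ[k] 1) * e = e * (1 ⊗ₜ[k] a) := by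
  obtain ⟨l, hl1, hl⟩ := exists_integral k A
  refine ⟨antipodeRight (comul (R := k) l), ?_, fun a => ?_⟩
  · rw [antipodeRight, HopfAlgebra.mul_antipode_lTensor_comul_apply, hl1, map_one]
  · have h1 := antipodeSandwich_comul (comul (R := k) l) a
    have h2 : ∀ w : A ⊗[k] A, antipodeSandwich (comul (R := k) l)
        ((comul (R := k)).rTensor A w) = antipodeRight (comul (R := k) l) *
          (1 ⊗ₜ TensorProduct.lid k A ((counit (R := k)).rTensor A w)) := by
      intro w
      induction w with
      | zero => simp
      | add s t hs ht => rw [map_add, map_add, hs, ht, map_add, map_add, tmul_add, mul_add]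
      | tmul b d =>
        rw [LinearMap.rTensor_tmul, antipodeSandwich_tmul, ← Bialgebra.comul_mul, hl, map_smul,
          map_smul, LinearMap.rTensor_tmul, TensorProduct.lid_tmul, smul_mul_assoc, tmul_smul,
          mul_smul_comm]
    rw [← h1, h2, Coalgebra.rTensor_counit_comul, TensorProduct.lid_tmul, one_smul]

/-- A semisimple Hopf algebra is finite-dimensional: the first tensor factors of a separability
idempotent `e` span a finite-dimensional space `Y`, the products `a * y` for `y ∈ Y` remain in a
fixed finite-dimensional space, and `a` vanishes if `a * Y = 0`, as `e` multiplies to `1`. -/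
theorem finite_of_isSemisimpleRing [IsSemisimpleRing A] : Module.Finite k A := by
  classical
  obtain ⟨e, he1, he⟩ := exists_separability k A
  let b := Module.Basis.ofVectorSpace k A
  obtain ⟨X₀, hX₀, hX⟩ : ∃ X₀ : Submodule k A, X₀.FG ∧ ∀ (f : A →ₗ[k] k) (a : A),
      TensorProduct.rid k A (f.lTensor A (e * (1 ⊗ₜ a))) ∈ X₀ := by
    clear he1 he
    induction e with
    | zero => exact ⟨⊥, Submodule.fg_bot, fun f a => by simp⟩
    | tmul x y =>
      refine ⟨k ∙ x, Submodule.fg_span_singleton x, fun f a => ?_⟩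
      rw [Algebra.TensorProduct.tmul_mul_tmul, mul_one, LinearMap.lTensor_tmul,
        TensorProduct.rid_tmul]
      exact Submodule.smul_mem _ _ (Submodule.mem_span_singleton_self x)
    | add s t hs ht =>
      obtain ⟨X, hX, h1⟩ := hs
      obtain ⟨Y, hY, h2⟩ := ht
      refine ⟨X ⊔ Y, hX.sup hY, fun f a => ?_⟩
      rw [add_mul, map_add, map_add]
      exact Submodule.add_mem_sup (h1 f a) (h2 f a)
  have key : ∀ (a : A) (f : A →ₗ[k] k), a * TensorProduct.rid k A (f.lTensor A e) =
      TensorProduct.rid k A (f.lTensor A (e * (1 ⊗ₜ a))) := by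
    intro a f
    rw [← he]
    clear he he1 hX
    induction e with
    | zero => simp
    | tmul x y => simp
    | add s t hs ht => rw [mul_add, map_add, map_add, map_add, map_add, mul_add, hs, ht]
  have hsum : ∀ t : A ⊗[k] A, (∀ f : A →ₗ[k] k, TensorProduct.rid k A (f.lTensor A t) = 0) →
      t = 0 := by
    intro t ht
    apply (TensorProduct.equivFinsuppOfBasisRight b).injective
    ext i
    rw [map_zero, Finsupp.zero_apply, ← ht (b.coord i)]
    clear ht
    induction t with
    | zero => simp
    | tmul x y => simp
    | add s t hs ht => rw [map_add, Finsupp.add_apply, hs, ht, map_add, map_add]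
  let Y : Submodule k A := Submodule.span k
    (Set.range fun f : A →ₗ[k] k => TensorProduct.rid k A (f.lTensor A e))
  have hYX : Y ≤ X₀ := Submodule.span_le.2 (by
    rintro _ ⟨f, rfl⟩
    have := hX f 1
    rwa [← Algebra.TensorProduct.one_def, mul_one] at this)
  have : Module.Finite k X₀ := Module.Finite.iff_fg.2 hX₀
  have : Module.Finite k Y := Submodule.finiteDimensional_of_le hYX
  have hmul : ∀ a : A, ∀ y ∈ Y, a * y ∈ X₀ := by
    intro a y hy
    refine Submodule.span_induction ?_ (by simp) (fun x y _ _ hx hy => ?_)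
      (fun c x _ hx => ?_) hy
    · rintro _ ⟨f, rfl⟩
      rw [key]
      exact hX f a
    · rw [mul_add]; exact X₀.add_mem hx hy
    · rw [mul_smul_comm]; exact X₀.smul_mem c hx
  let Ψ : A →ₗ[k] Y →ₗ[k] X₀ :=
    { toFun := fun a => (LinearMap.mulLeft k a).restrict (hmul a)
      map_add' := fun a b => LinearMap.ext fun y => Subtype.ext (add_mul a b y)
      map_smul' := fun c a => LinearMap.ext fun y => Subtype.ext (smul_mul_assoc c a y) }
  refine Module.Finite.of_injective Ψ ((injective_iff_map_eq_zero Ψ).2 fun a ha => ?_)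
  have h3 : (a ⊗ₜ[k] 1) * e = 0 := by
    refine hsum _ fun f => ?_
    rw [he, ← key]
    exact congrArg Subtype.val (LinearMap.congr_fun ha ⟨_, Submodule.subset_span ⟨f, rfl⟩⟩)
  have h4 : LinearMap.mul' k A ((a ⊗ₜ[k] 1) * e) = a * LinearMap.mul' k A e := by
    clear h3 ha Ψ hmul this hYX Y hsum key hX he he1
    clear this
    induction e with
    | zero => simp
    | tmul x y => simp [mul_assoc]
    | add s t hs ht => rw [mul_add, map_add, map_add, mul_add, hs, ht]
  rw [h3, map_zero, he1, mul_one] at h4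
  exact h4.symm

/-- The double commutant theorem for representations of a semisimple algebra. -/
theorem exists_eq_of_commute {k : Type*} [Field k] {A : Type*} [Ring A] [Algebra k A]
    [IsSemisimpleRing A] {M : Type*} [AddCommGroup M]
    [Module k M] [Module.Finite k M] (ρ : A →ₐ[k] Module.End k M) (T : Module.End k M)
    (hT : ∀ f : Module.End k M, (∀ a, f ∘ₗ ρ a = ρ a ∘ₗ f) → f ∘ₗ T = T ∘ₗ f) :
    ∃ a, ρ a = T := by
  let _ : Module A M := Module.compHom M (ρ : A →+* Module.End k M)
  have smul_def : ∀ (a : A) (m : M), a • m = ρ a m := fun _ _ => rfl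
  have : IsScalarTower k A M := ⟨fun c a m => by simp [smul_def]⟩
  have : SMulCommClass A k M := ⟨fun a c m => by simp [smul_def]⟩
  have : SMulCommClass k A M := ⟨fun a c m => by simp [smul_def]⟩
  have : Module.Finite (Module.End A M) M := by
    have : IsScalarTower k (Module.End A M) M := ⟨fun c f m => rfl⟩
    exact Module.Finite.of_restrictScalars_finite k (Module.End A M) M
  let T' : Module.End (Module.End A M) M :=
    { toFun := T
      map_add' := map_add T
      map_smul' := fun f m => LinearMap.congr_fun (hT (f.restrictScalars k)
        (fun a => LinearMap.ext fun x => f.map_smul a x)).symm m }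
  obtain ⟨a, ha⟩ := Module.Finite.toModuleEnd_moduleEnd_surjective (R := A) (M := M) T'
  exact ⟨a, LinearMap.ext fun m => LinearMap.congr_fun ha m⟩

end Integral

/-! ### Simple objects of a fusion category -/

namespace FusionCat

variable {k : Type u} [Field k] {S : Type w} [Fintype S] {d : FusionSymbols k S}

noncomputable instance (X Y : FusionCat d) : Zero (X ⟶ Y) := ⟨⟨fun _ _ => 0, fun _ _ _ => rfl⟩⟩

theorem zero_mat {X Y : FusionCat d} (i : X.ι) (j : Y.ι) : (0 : X ⟶ Y).mat i j = 0 := rfl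

noncomputable instance : HasZeroMorphisms (FusionCat d) where
  comp_zero f Z := hom_ext fun i j => by simp [zero_mat]
  zero_comp X Y Z f := hom_ext fun i j => by simp [zero_mat]

/-- The simple object with label `s`, as a family with one member. -/
@[reducible]
def simple (d : FusionSymbols k S) (s : S) : FusionCat d := ⟨PUnit, fun _ => s⟩

open Classical in
/-- The projection of a direct sum onto one of its summands. -/
noncomputable def proj (X : FusionCat d) (i : X.ι) : X ⟶ simple d (X.label i) :=
  ⟨fun j _ => if j = i then 1 else 0, fun j _ h => if_neg (by rintro rfl; exact h rfl)⟩

open Classical in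
theorem comp_proj_mat {X Y : FusionCat d} (f : X ⟶ Y) (i : X.ι) (j : Y.ι) (t : PUnit) :
    (f ≫ proj Y j).mat i t = f.mat i j := by
  rw [comp_mat]
  simp [proj]

theorem eq_zero_of_comp_proj {X Y : FusionCat d} (f : X ⟶ Y) (h : ∀ j, f ≫ proj Y j = 0) :
    f = 0 := by
  refine hom_ext fun i j => ?_
  rw [← comp_proj_mat f i j PUnit.unit, h]
  rfl

theorem proj_ne_zero (X : FusionCat d) (i : X.ι) : proj X i ≠ 0 := by
  intro h
  have := congrArg (fun f => Hom.mat f i PUnit.unit) h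
  simp [proj, zero_mat] at this

theorem hom_simple_eq_zero {s : S} (X : FusionCat d) (h : ∀ i, X.label i ≠ s)
    (f : X ⟶ simple d s) : f = 0 :=
  hom_ext fun i j => f.supp i j (h i)

/-- A morphism to a simple object of multiplicity one factors through the projection. -/
theorem exists_eq_proj_comp (X : FusionCat d) (i : X.ι) (h : ∀ j, X.label j = X.label i → j = i)
    (f : X ⟶ simple d (X.label i)) : ∃ θ, f = proj X i ≫ θ := by
  refine ⟨⟨fun _ _ => f.mat i PUnit.unit, fun _ _ h => (h rfl).elim⟩, hom_ext fun j t => ?_⟩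
  rw [comp_mat]
  by_cases hj : j = i
  · subst hj
    simp [proj]
  · rw [f.supp j t fun h' => hj (h j h')]
    simp [proj, hj]

/-- A family with one member is a simple object. -/
noncomputable def isoSimple (X : FusionCat d) (i : X.ι) (h : ∀ j, j = i) :
    X ≅ simple d (X.label i) where
  hom := ⟨fun _ _ => 1, fun j _ hj => (hj (by rw [h j])).elim⟩
  inv := ⟨fun _ _ => 1, fun _ j hj => (hj (by rw [h j])).elim⟩
  hom_inv_id := hom_ext fun j j' => by
    rw [comp_mat, id_mat, if_pos ((h j).trans (h j').symm)]
    simp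
  inv_hom_id := hom_ext fun j j' => by
    rw [comp_mat, id_mat, Finset.sum_eq_single i]
    · simp
    · exact fun b _ hb => (hb (h b)).elim
    · simp

/-- If `c` is the only simple object in `a ⊗ b`, then `a ⊗ b` is isomorphic to `c`. -/
noncomputable def tensorSimpleIso {a b c : S} (h : ∀ x, d.N a b x ↔ x = c) :
    simple d a ⊗ simple d b ≅ simple d c :=
  isoSimple (tensor (simple d a) (simple d b)) ⟨PUnit.unit, PUnit.unit, c, (h c).2 rfl⟩
    fun j => Chan.ext rfl rfl ((h _).1 j.adm)

theorem simple_id_ne_zero (s : S) : 𝟙 (simple d s) ≠ 0 := by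
  intro h
  have := congrArg (fun f => Hom.mat f PUnit.unit PUnit.unit) h
  simp [zero_mat] at this

theorem isIso_of_ne_zero {s : S} (f : simple d s ⟶ simple d s) (hf : f ≠ 0) : IsIso f := by
  have hc : f.mat PUnit.unit PUnit.unit ≠ 0 := fun h => hf (hom_ext fun _ _ => h)
  refine ⟨⟨fun _ _ => (f.mat PUnit.unit PUnit.unit)⁻¹, fun _ _ h => (h rfl).elim⟩, ?_, ?_⟩
  · refine hom_ext fun i j => ?_
    rw [comp_mat, id_mat, if_pos rfl]
    simpa using mul_inv_cancel₀ hc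
  · refine hom_ext fun i j => ?_
    rw [comp_mat, id_mat, if_pos rfl]
    simpa using inv_mul_cancel₀ hc

end FusionCat

/-! ### One-dimensional representations -/

section Twist

variable {k : Type*} [Field k] {A : Type*} [Ring A] [HopfAlgebra k A]

/-- The algebra endomorphism `a ↦ χ(a₁) a₂`. -/
noncomputable def leftTwist (χ : A →ₐ[k] k) : A →ₐ[k] A :=
  ((Algebra.TensorProduct.lid k A).toAlgHom.comp
    (Algebra.TensorProduct.map χ (AlgHom.id k A))).comp (Bialgebra.comulAlgHom k A)

/-- The algebra endomorphism `a ↦ a₁ χ(a₂)`. -/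
noncomputable def rightTwist (χ : A →ₐ[k] k) : A →ₐ[k] A :=
  ((Algebra.TensorProduct.rid k k A).toAlgHom.comp
    (Algebra.TensorProduct.map (AlgHom.id k A) χ)).comp (Bialgebra.comulAlgHom k A)

theorem leftTwist_apply (χ : A →ₐ[k] k) (a : A) : leftTwist χ a =
    TensorProduct.lid k A (χ.toLinearMap.rTensor A (Coalgebra.comul (R := k) a)) := rfl

theorem rightTwist_apply (χ : A →ₐ[k] k) (a : A) : rightTwist χ a =
    TensorProduct.rid k A (χ.toLinearMap.lTensor A (Coalgebra.comul (R := k) a)) := rfl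

end Twist

namespace HopfRep

section

variable {k : Type u} [Field k] {A : Type v} [Ring A] [HopfAlgebra k A]

/-- The action of `A` on `k` by a character. -/
noncomputable def charAct (χ : A →ₐ[k] k) : A →ₐ[k] Module.End k k := (Algebra.lmul k k).comp χ

@[simp] theorem charAct_apply (χ : A →ₐ[k] k) (a : A) (t : k) : charAct χ a t = χ a * t := rfl

/-- The action of `A` on `χ ⊗ V`, under the identification `k ⊗ V = V`. -/
theorem lid_diag_char {V : Type*} [AddCommGroup V] [Module k V] (χ : A →ₐ[k] k)
    (f : A →ₐ[k] Module.End k V) (a : A) (t : k ⊗[k] V) :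
    TensorProduct.lid k V (diag (charAct χ) f a t) =
      f (leftTwist χ a) (TensorProduct.lid k V t) := by
  have key : ∀ b : A ⊗[k] A, TensorProduct.lid k V (act₂ (charAct χ) f b t) =
      f (TensorProduct.lid k A (χ.toLinearMap.rTensor A b)) (TensorProduct.lid k V t) := by
    intro b
    induction b with
    | zero => simp
    | add b c hb hc => simp only [map_add, LinearMap.add_apply, hb, hc]
    | tmul b c =>
      induction t with
      | zero => simp
      | add s t hs ht => simp only [map_add, hs, ht]
      | tmul x z => simp [mul_smul, smul_comm x]
  rw [diag_apply, key, leftTwist_apply]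

/-- The action of `A` on `V ⊗ χ`, under the identification `V ⊗ k = V`. -/
theorem rid_diag_char {V : Type*} [AddCommGroup V] [Module k V] (χ : A →ₐ[k] k)
    (f : A →ₐ[k] Module.End k V) (a : A) (t : V ⊗[k] k) :
    TensorProduct.rid k V (diag f (charAct χ) a t) =
      f (rightTwist χ a) (TensorProduct.rid k V t) := by
  have key : ∀ b : A ⊗[k] A, TensorProduct.rid k V (act₂ f (charAct χ) b t) =
      f (TensorProduct.rid k A (χ.toLinearMap.lTensor A b)) (TensorProduct.rid k V t) := by
    intro b
    induction b with
    | zero => simp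
    | add b c hb hc => simp only [map_add, LinearMap.add_apply, hb, hc]
    | tmul b c =>
      induction t with
      | zero => simp
      | add s t hs ht => simp only [map_add, hs, ht]
      | tmul x z => simp [mul_smul, smul_comm z]
  rw [diag_apply, key, rightTwist_apply]

/-- The one-dimensional representation given by a character. -/
@[reducible]
noncomputable def char (χ : A →ₐ[k] k) : HopfRep.{u, v} k A := ⟨k, charAct χ⟩

/-- The restriction of a representation along an algebra endomorphism. -/
@[reducible]
noncomputable def comap (X : HopfRep.{u, v} k A) (θ : A →ₐ[k] A) : HopfRep.{u, v} k A :=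
  ⟨X.V, X.ρ.comp θ⟩

/-- Tensoring with a character on the left twists the action by `leftTwist`. -/
noncomputable def charTensorIso (χ : A →ₐ[k] k) (X : HopfRep.{u, v} k A) :
    char χ ⊗ X ≅ X.comap (leftTwist χ) :=
  mkIso (X := tensor (char χ) X) (TensorProduct.lid k X.V) (lid_diag_char χ X.ρ)

/-- Tensoring with a character on the right twists the action by `rightTwist`. -/
noncomputable def tensorCharIso (χ : A →ₐ[k] k) (X : HopfRep.{u, v} k A) :
    X ⊗ char χ ≅ X.comap (rightTwist χ) :=
  mkIso (X := tensor X (char χ)) (TensorProduct.rid k X.V) (rid_diag_char χ X.ρ)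

/-- The linear equivalence underlying an isomorphism of representations. -/
noncomputable def isoLin {X Y : HopfRep.{u, v} k A} (e : X ≅ Y) : X.V ≃ₗ[k] Y.V :=
  LinearEquiv.ofLinearMap e.hom.toLin e.inv.toLin
    (congrArg Hom.toLin e.inv_hom_id) (congrArg Hom.toLin e.hom_inv_id)

theorem isoLin_equivariant {X Y : HopfRep.{u, v} k A} (e : X ≅ Y) (a : A) (x : X.V) :
    isoLin e (X.ρ a x) = Y.ρ a (isoLin e x) := e.hom.equivariant a x

/-- Isomorphic one-dimensional representations have the same character. -/
theorem char_injective {χ χ' : A →ₐ[k] k} (e : char χ ≅ char χ') : χ = χ' := by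
  refine AlgHom.ext fun a => ?_
  have h1 := isoLin_equivariant e a (1 : k)
  change isoLin e (χ a * 1 : k) = χ' a * isoLin e (1 : k) at h1
  have h2 : isoLin e (χ a * 1 : k) = χ a * isoLin e (1 : k) := (isoLin e).map_smul (χ a) (1 : k)
  have h3 : isoLin e (1 : k) ≠ (0 : k) := fun h =>
    one_ne_zero (α := k) ((isoLin e).injective (h.trans (map_zero (isoLin e)).symm))
  exact mul_right_cancel₀ h3 (h2.symm.trans h1)

theorem exists_iso_char (X : HopfRep.{u, v} k A) (h : Module.finrank k X.V = 1) :
    ∃ χ : A →ₐ[k] k, Nonempty (X ≅ char χ) := by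
  let e : X.V ≃ₗ[k] k := LinearEquiv.ofFinrankEq X.V k (h.trans (Module.finrank_self k).symm)
  have key : ∀ a x, e (X.ρ a x) = e (X.ρ a (e.symm 1)) * e x := by
    intro a x
    have : x = e x • e.symm 1 := e.injective (by simp)
    conv_lhs => rw [this, map_smul, map_smul, smul_eq_mul, mul_comm]
  refine ⟨AlgHom.ofLinearMap
    { toFun := fun a => e (X.ρ a (e.symm 1))
      map_add' := fun a b => by simp
      map_smul' := fun c a => by simp } (by simp) fun a b => ?_, ⟨mkIso e fun a x => key a x⟩⟩
  change e (X.ρ (a * b) (e.symm 1)) = _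
  rw [map_mul, Module.End.mul_apply, key]
  rfl

end

end HopfRep

/-! ### Representations that form a fusion category -/

namespace HopfRep

section Simple

variable {k : Type u} [Field k] {A : Type v} [Ring A] [HopfAlgebra k A] {S : Type w} [Fintype S]
  {d : FusionSymbols k S} (e : HopfRep.{u, v} k A ≌ FusionCat d)

/-- The irreducible representation corresponding to a simple object. -/
@[reducible]
noncomputable def irr (s : S) : HopfRep.{u, v} k A := e.inverse.obj (FusionCat.simple d s)

/-- The subrepresentation on an invariant subspace. -/
@[reducible]
noncomputable def sub (X : HopfRep.{u, v} k A) (K : Submodule k X.V)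
    (hK : ∀ a, ∀ x ∈ K, X.ρ a x ∈ K) : HopfRep.{u, v} k A where
  V := K
  ρ := AlgHom.ofLinearMap
    { toFun := fun a => (X.ρ a).restrict (hK a)
      map_add' := fun a b => LinearMap.ext fun x => Subtype.ext (by simp)
      map_smul' := fun c a => LinearMap.ext fun x => Subtype.ext (by simp) }
    (LinearMap.ext fun x => Subtype.ext (by simp))
    fun a b => LinearMap.ext fun x => Subtype.ext (by simp)

/-- The inclusion of a subrepresentation. -/
noncomputable def subι (X : HopfRep.{u, v} k A) (K : Submodule k X.V)
    (hK : ∀ a, ∀ x ∈ K, X.ρ a x ∈ K) : sub X K hK ⟶ X := ⟨K.subtype, fun _ _ => rfl⟩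

/-- A vector that is killed by all morphisms to irreducible representations vanishes. -/
theorem eq_zero_of_forall_irr {X : HopfRep.{u, v} k A} {x : X.V}
    (h : ∀ s (f : X ⟶ irr e s), f.toLin x = 0) : x = 0 := by
  let K : Submodule k X.V := ⨅ s, ⨅ f : X ⟶ irr e s, LinearMap.ker f.toLin
  have memK : ∀ y, y ∈ K ↔ ∀ s (f : X ⟶ irr e s), f.toLin y = 0 := fun y => by
    simp [K, Submodule.mem_iInf]
  have hK : ∀ a, ∀ y ∈ K, X.ρ a y ∈ K := fun a y hy => (memK _).2 fun s f => by
    rw [f.equivariant, (memK y).1 hy, map_zero]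
  have h0 : subι X K hK = 0 := by
    apply e.functor.map_injective
    rw [Functor.map_zero]
    refine FusionCat.eq_zero_of_comp_proj _ fun j => ?_
    apply e.inverse.map_injective
    rw [Functor.map_zero, Functor.map_comp]
    have h1 : e.unit.app (sub X K hK) ≫ e.inverse.map (e.functor.map (subι X K hK)) =
        subι X K hK ≫ e.unit.app X := (e.unit.naturality (subι X K hK)).symm
    rw [← cancel_epi (e.unit.app (sub X K hK)), comp_zero, ← Category.assoc, h1, Category.assoc]
    apply hom_ext
    refine LinearMap.ext fun y => ?_
    exact (memK y.1).1 y.2 _ (e.unit.app X ≫ e.inverse.map (FusionCat.proj _ j))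
  exact LinearMap.congr_fun (congrArg Hom.toLin h0) (⟨x, (memK x).2 h⟩ : K)

theorem irr_hom_eq_zero {s t : S} (h : s ≠ t) (f : irr e s ⟶ irr e t) : f = 0 := by
  obtain ⟨f, rfl⟩ := e.inverse.map_surjective f
  have h0 : f = 0 := FusionCat.hom_simple_eq_zero _ (fun _ => h) f
  rw [h0, Functor.map_zero]

theorem isIso_of_irr_hom_ne_zero {s : S} (f : irr e s ⟶ irr e s) (hf : f ≠ 0) : IsIso f := by
  obtain ⟨f, rfl⟩ := e.inverse.map_surjective f
  have := FusionCat.isIso_of_ne_zero f (by rintro rfl; exact hf (Functor.map_zero _ _ _))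
  exact Functor.map_isIso e.inverse f

theorem irr_id_ne_zero (s : S) : 𝟙 (irr e s) ≠ 0 := by
  intro h
  apply FusionCat.simple_id_ne_zero (d := d) s
  apply e.inverse.map_injective
  rw [CategoryTheory.Functor.map_id, CategoryTheory.Functor.map_zero]
  exact h

theorem nontrivial_irr (s : S) : Nontrivial (irr e s).V := by
  by_contra h
  rw [not_nontrivial_iff_subsingleton] at h
  exact irr_id_ne_zero e s (hom_ext (LinearMap.ext fun x => Subsingleton.elim _ _))

/-- Schur's lemma. -/
theorem irr_hom_eq_smul [IsAlgClosed k] {s : S} (f : irr e s ⟶ irr e s) :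
    ∃ c : k, f.toLin = c • LinearMap.id := by
  have := nontrivial_irr e s
  obtain ⟨c, hc⟩ := Module.End.exists_eigenvalue f.toLin
  obtain ⟨x, hx⟩ := hc.exists_hasEigenvector
  refine ⟨c, ?_⟩
  let f' : irr e s ⟶ irr e s := ⟨f.toLin - c • LinearMap.id, fun a x => by simp [f.equivariant]⟩
  have h0 : f' = 0 := by
    by_contra h
    have := isIso_of_irr_hom_ne_zero e f' h
    apply hx.2
    apply (isoLin (asIso f')).injective
    rw [map_zero]
    change f.toLin x - c • x = 0
    rw [hx.apply_eq_smul, sub_self]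
  exact sub_eq_zero.1 (congrArg Hom.toLin h0)

variable [e.functor.Monoidal]

/-- The fusion rule `a ⊗ b = c` for irreducible representations. -/
theorem nonempty_irr_tensor_iso {a b c : S} (h : ∀ x, d.N a b x ↔ x = c) :
    Nonempty (irr e a ⊗ irr e b ≅ irr e c) := by
  let _ := e.inverseMonoidal
  exact ⟨Functor.Monoidal.μIso e.inverse _ _ ≪≫
    e.inverse.mapIso (FusionCat.tensorSimpleIso h)⟩

theorem nonempty_irr_one_iso : Nonempty (irr e d.one ≅ 𝟙_ (HopfRep.{u, v} k A)) := by
  let _ := e.inverseMonoidal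
  exact ⟨(Functor.Monoidal.εIso e.inverse).symm⟩

theorem finrank_mul_of_iso {X Y Z : HopfRep.{u, v} k A} (i : X ⊗ Y ≅ Z) :
    Module.finrank k X.V * Module.finrank k Y.V = Module.finrank k Z.V := by
  rw [← (isoLin i).finrank_eq]
  exact (Module.finrank_tensorProduct (R := k) (S := k)).symm

/-- An invertible irreducible representation is one-dimensional. -/
theorem exists_irr_iso_char {a b : S} (h : ∀ x, d.N a b x ↔ x = d.one) :
    ∃ χ : A →ₐ[k] k, Nonempty (irr e a ≅ char χ) := by
  obtain ⟨i⟩ := nonempty_irr_tensor_iso e h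
  obtain ⟨j⟩ := nonempty_irr_one_iso e
  refine exists_iso_char _ (Nat.eq_one_of_mul_eq_one_right
    ((finrank_mul_of_iso (i ≪≫ j)).trans ?_))
  exact Module.finrank_self k

/-- The morphisms from `a ⊗ b` to an irreducible constituent are multiples of a single one. -/
theorem exists_tensor_proj {a b c : S} (h : d.N a b c) : ∃ p : irr e a ⊗ irr e b ⟶ irr e c,
    p ≠ 0 ∧ ∀ f : irr e a ⊗ irr e b ⟶ irr e c, ∃ θ, f = p ≫ θ := by
  let _ := e.inverseMonoidal
  let X := FusionCat.tensor (FusionCat.simple d a) (FusionCat.simple d b)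
  let i : X.ι := ⟨PUnit.unit, PUnit.unit, c, h⟩
  let μ : irr e a ⊗ irr e b ≅ e.inverse.obj X := Functor.Monoidal.μIso e.inverse _ _
  refine ⟨μ.hom ≫ e.inverse.map (FusionCat.proj X i), fun h0 => ?_, fun f => ?_⟩
  · apply FusionCat.proj_ne_zero X i
    apply e.inverse.map_injective
    rw [← cancel_epi μ.hom, Functor.map_zero, comp_zero]
    exact h0
  · obtain ⟨f', hf'⟩ := e.inverse.map_surjective (μ.inv ≫ f)
    obtain ⟨θ, hθ⟩ := FusionCat.exists_eq_proj_comp X i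
      (fun j hj => FusionCat.Chan.ext rfl rfl hj) f'
    refine ⟨e.inverse.map θ, ?_⟩
    rw [Category.assoc, ← Functor.map_comp, ← hθ, hf', Iso.hom_inv_id_assoc]

theorem tensor_hom_eq_zero {a b c : S} (h : ¬ d.N a b c) (f : irr e a ⊗ irr e b ⟶ irr e c) :
    f = 0 := by
  let _ := e.inverseMonoidal
  let X := FusionCat.tensor (FusionCat.simple d a) (FusionCat.simple d b)
  let μ : irr e a ⊗ irr e b ≅ e.inverse.obj X := Functor.Monoidal.μIso e.inverse _ _
  obtain ⟨f', hf'⟩ := e.inverse.map_surjective (μ.inv ≫ f)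
  have h0 : f' = 0 := FusionCat.hom_simple_eq_zero X
    (fun j hj => h (by have := j.adm; rwa [show j.out = c from hj] at this)) f'
  rw [h0, Functor.map_zero] at hf'
  rw [← cancel_epi μ.inv, ← hf', comp_zero]

end Simple

end HopfRep

/-! ### Representations with Tambara–Yamagami fusion rules -/

/-- The irreducible representations of a Hopf algebra with the fusion rules of a Tambara–Yamagami
category: characters `ψ g` for `g ∈ G` and one further representation `V`, such that `A` is the
algebra `k^G × End V`, together with isomorphisms `L g : ψ g ⊗ V ≅ V`, `R g : V ⊗ ψ g ≅ V` and
`B : V ⊗ V ≅ ⊕_g ψ g`. No relation between these isomorphisms is required. -/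
structure TambaraYamagamiReps (k : Type u) [Field k] (A : Type v) [Ring A] [HopfAlgebra k A]
    (G : Type w) [CommGroup G] where
  V : Type u
  [addCommGroup : AddCommGroup V]
  [module : Module k V]
  [finite : Module.Finite k V]
  [nontrivial : Nontrivial V]
  ψ : G → A →ₐ[k] k
  π : A →ₐ[k] Module.End k V
  faithful : ∀ a, (∀ g, ψ g a = 0) → π a = 0 → a = 0
  full : ∀ (c : G → k) (T : Module.End k V), ∃ a, (∀ g, ψ g a = c g) ∧ π a = T
  ψ_one : ∀ a, ψ 1 a = Coalgebra.counit (R := k) a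
  ψ_mul : ∀ g h a, ψ (g * h) a = ψ h (leftTwist (ψ g) a)
  L : G → V ≃ₗ[k] V
  L_one : L 1 = LinearEquiv.refl k V
  L_π : ∀ g a v, L g (π (leftTwist (ψ g) a) v) = π a (L g v)
  R : G → V ≃ₗ[k] V
  R_one : R 1 = LinearEquiv.refl k V
  R_π : ∀ g a v, R g (π (rightTwist (ψ g) a) v) = π a (R g v)
  B : V ⊗[k] V ≃ₗ[k] (G → k)
  B_π : ∀ a t g, B (HopfRep.diag π π a t) g = ψ g a * B t g

namespace HopfRep

section Simple

variable {k : Type u} [Field k] {A : Type v} [Ring A] [HopfAlgebra k A] {S : Type w} [Fintype S]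
  {d : FusionSymbols k S} (e : HopfRep.{u, v} k A ≌ FusionCat d)

theorem hom_eq_zero_of_iso {s t : S} (h : s ≠ t) {X Y : HopfRep.{u, v} k A} (i : irr e s ≅ X)
    (j : irr e t ≅ Y) (f : X ⟶ Y) : f = 0 := by
  have := irr_hom_eq_zero e h (i.hom ≫ f ≫ j.inv)
  rw [← cancel_epi i.hom, ← cancel_mono j.inv, Category.assoc, this, comp_zero, zero_comp]

theorem leftTwist_counit (χ : A →ₐ[k] k) (h : ∀ a, χ a = Coalgebra.counit (R := k) a) (a : A) :
    leftTwist χ a = a := by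
  have : χ.toLinearMap = Coalgebra.counit (R := k) (A := A) := LinearMap.ext h
  rw [leftTwist_apply, this, Coalgebra.rTensor_counit_comul, TensorProduct.lid_tmul, one_smul]

theorem rightTwist_counit (χ : A →ₐ[k] k) (h : ∀ a, χ a = Coalgebra.counit (R := k) a) (a : A) :
    rightTwist χ a = a := by
  have : χ.toLinearMap = Coalgebra.counit (R := k) (A := A) := LinearMap.ext h
  rw [rightTwist_apply, this, Coalgebra.lTensor_counit_comul, TensorProduct.rid_tmul, one_smul]

/-- The regular representation, on a space in the universe of the field. -/
theorem exists_regular [Module.Finite k A] : ∃ (X : HopfRep.{u, v} k A) (x : X.V),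
    ∀ a, X.ρ a x = 0 → a = 0 := by
  let b := (Module.finBasis k A).equivFun
  refine ⟨⟨Fin (Module.finrank k A) → k,
    (b.conjAlgEquiv k).toAlgHom.comp (Algebra.lmul k A)⟩, b 1, fun a ha => ?_⟩
  change b (a * b.symm (b 1)) = 0 at ha
  rwa [LinearEquiv.symm_apply_apply, mul_one, LinearEquiv.map_eq_zero_iff] at ha

end Simple

section TambaraYamagami

variable {k : Type u} [Field k] [CharZero k] [IsAlgClosed k] {A : Type v} [Ring A]
  [HopfAlgebra k A] [IsSemisimpleRing A] {G : Type w} [CommGroup G] [Fintype G]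

open TYSimple

/-- If `A` is semisimple, characters `ψ g` and a representation `X` that are irreducible and
pairwise non-isomorphic are jointly full, by the double commutant theorem for their direct sum. -/
theorem exists_of_pairwise_hom_zero (ψ : G → A →ₐ[k] k) (X : HopfRep.{u, v} k A)
    (h₁ : ∀ g h, g ≠ h → ∀ f : char (ψ g) ⟶ char (ψ h), f = 0)
    (h₂ : ∀ g (f : char (ψ g) ⟶ X), f = 0) (h₃ : ∀ g (f : X ⟶ char (ψ g)), f = 0)
    (h₄ : ∀ f : X ⟶ X, ∃ c : k, f.toLin = c • LinearMap.id) (c : G → k) (T : Module.End k X.V) :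
    ∃ a, (∀ g, ψ g a = c g) ∧ X.ρ a = T := by
  classical
  let ρ : A →ₐ[k] Module.End k ((G → k) × X.V) := AlgHom.ofLinearMap
    { toFun := fun a => LinearMap.prodMap (LinearMap.pi fun g => ψ g a • LinearMap.proj g) (X.ρ a)
      map_add' := fun a b => by
        ext <;> simp [add_mul]
      map_smul' := fun c a => by
        ext <;> simp [mul_assoc] }
    (by ext <;> simp)
    (fun a b => by ext <;> simp [mul_assoc])
  have hρ : ∀ a x, ρ a x = (fun g => ψ g a * x.1 g, X.ρ a x.2) := fun a x => rfl
  let T' : Module.End k ((G → k) × X.V) :=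
    LinearMap.prodMap (LinearMap.pi fun g => c g • LinearMap.proj g) T
  have hT' : ∀ x, T' x = (fun g => c g * x.1 g, T x.2) := fun x => rfl
  obtain ⟨a, ha⟩ := exists_eq_of_commute ρ T' fun f hf => by
    have hf' : ∀ a x, f (ρ a x) = ρ a (f x) := fun a x => LinearMap.congr_fun (hf a) x
    have e₁ : ∀ g a (t : k), ρ a (Pi.single g t, 0) = (Pi.single g (ψ g a * t), 0) := by
      intro g a t
      rw [hρ]
      refine Prod.ext (funext fun h => ?_) (map_zero _)
      rcases eq_or_ne h g with rfl | hh
      · simp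
      · simp [hh]
    have s₁ : ∀ g (t : k), (f (Pi.single g t, 0)).2 = 0 := fun g t => by
      have := h₂ g ⟨LinearMap.snd k _ _ ∘ₗ f ∘ₗ LinearMap.inl k _ _ ∘ₗ
        LinearMap.single k (fun _ : G => k) g,
        fun a (t : k) => by
          change (f (Pi.single g (ψ g a * t), 0)).2 = X.ρ a (f (Pi.single g t, 0)).2
          rw [← e₁, hf', hρ]⟩
      exact LinearMap.congr_fun (congrArg Hom.toLin this) t
    have s₂ : ∀ g h, g ≠ h → ∀ (t : k), (f (Pi.single g t, 0)).1 h = 0 := fun g h hgh t => by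
      have := h₁ g h hgh ⟨LinearMap.proj h ∘ₗ LinearMap.fst k _ _ ∘ₗ f ∘ₗ
        LinearMap.inl k _ _ ∘ₗ LinearMap.single k (fun _ : G => k) g, fun a (t : k) => by
          change (f (Pi.single g (ψ g a * t), 0)).1 h = ψ h a * (f (Pi.single g t, 0)).1 h
          rw [← e₁, hf', hρ]⟩
      exact LinearMap.congr_fun (congrArg Hom.toLin this) t
    have s₃ : ∀ x, (f (0, x)).1 = 0 := fun x => funext fun h => by
      have := h₃ h ⟨LinearMap.proj h ∘ₗ LinearMap.fst k _ _ ∘ₗ f ∘ₗ LinearMap.inr k _ _,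
        fun a x => by
          change (f (0, X.ρ a x)).1 h = ψ h a * (f (0, x)).1 h
          have : ρ a (0, x) = (0, X.ρ a x) := by
            rw [hρ]
            refine Prod.ext (funext fun h => ?_) rfl
            simp
          rw [← this, hf', hρ]⟩
      exact LinearMap.congr_fun (congrArg Hom.toLin this) x
    obtain ⟨r, hr⟩ := h₄ ⟨LinearMap.snd k _ _ ∘ₗ f ∘ₗ LinearMap.inr k _ _,
        fun a x => by
          change (f (0, X.ρ a x)).2 = X.ρ a (f (0, x)).2
          have : ρ a (0, x) = (0, X.ρ a x) := by
            rw [hρ]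
            refine Prod.ext (funext fun h => ?_) rfl
            simp
          rw [← this, hf', hρ]⟩
    have hr' : ∀ x, (f (0, x)).2 = r • x := fun x => LinearMap.congr_fun hr x
    have s₄ : ∀ g, f (Pi.single g 1, 0) = (Pi.single g ((f (Pi.single g 1, 0)).1 g), 0) := by
      intro g
      refine Prod.ext (funext fun h => ?_) (s₁ g 1)
      rcases eq_or_ne h g with rfl | hh
      · simp
      · rw [s₂ g h hh.symm]
        simp [hh]
    have s₅ : ∀ x, f (0, x) = (0, r • x) := fun x => Prod.ext (s₃ x) (hr' x)
    have e₂ : ∀ g (t : k), T' (Pi.single g t, 0) = c g • (Pi.single g t, 0) := by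
      intro g t
      rw [hT']
      refine Prod.ext (funext fun h => ?_) (by simp)
      rcases eq_or_ne h g with rfl | hh
      · simp
      · simp [hh]
    have e₃ : ∀ x, T' (0, x) = (0, T x) := by
      intro x
      rw [hT']
      refine Prod.ext (funext fun h => ?_) rfl
      simp
    refine LinearMap.prod_ext (LinearMap.pi_ext' fun g => LinearMap.ext_ring ?_)
      (LinearMap.ext fun x => ?_)
    · change f (T' (Pi.single g 1, 0)) = T' (f (Pi.single g 1, 0))
      rw [e₂, map_smul, s₄, e₂]
    · change f (T' (0, x)) = T' (f (0, x))
      rw [e₃, s₅, s₅, e₃, map_smul]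
  refine ⟨a, fun g => ?_, LinearMap.ext fun x => ?_⟩
  · have := congrArg (fun x => x.1 g) (LinearMap.congr_fun ha (fun _ => 1, 0))
    simpa [hρ, hT'] using this
  · exact congrArg Prod.snd (LinearMap.congr_fun ha (0, x))

/-- Only the fusion rules and the existence of isomorphisms `X ⊗ Y ≅ Z` are transported along the
monoidal equivalence; the associativity constraint of the Tambara–Yamagami category plays no role.
-/
theorem nonempty_tambaraYamagamiReps {D : TambaraYamagamiData k G}
    (e : HopfRep.{u, v} k A ≌ TambaraYamagami D) [e.functor.Monoidal] :
    Nonempty (TambaraYamagamiReps k A G) := by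
  classical
  have := finite_of_isSemisimpleRing (k := k) (A := A)
  have hψ : ∀ g : G, ∃ χ : A →ₐ[k] k, Nonempty (irr e (grp g) ≅ char χ) := fun g =>
    exists_irr_iso_char e (b := grp g⁻¹) (by
      rintro (x | _) <;> simp [TambaraYamagamiData.fusionSymbols, Fusion])
  choose ψ I using hψ
  have I := fun g => (I g).some
  let M : HopfRep.{u, v} k A := irr e m
  have hdim : Nontrivial M.V := nontrivial_irr e m
  have h₁ : ∀ g h, g ≠ h → ∀ f : char (ψ g) ⟶ char (ψ h), f = 0 := fun g h hgh f =>
    hom_eq_zero_of_iso e (s := grp g) (t := grp h) (by simpa using hgh) (I g) (I h) f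
  have h₂ : ∀ g (f : char (ψ g) ⟶ M), f = 0 := fun g f =>
    hom_eq_zero_of_iso e (s := grp g) (t := m) (by simp) (I g) (Iso.refl _) f
  have h₃ : ∀ g (f : M ⟶ char (ψ g)), f = 0 := fun g f =>
    hom_eq_zero_of_iso e (s := m) (t := grp g) (by simp) (Iso.refl _) (I g) f
  have full := exists_of_pairwise_hom_zero ψ M h₁ h₂ h₃ fun f => irr_hom_eq_smul e f
  have ψ_one : ∀ a, ψ 1 a = Coalgebra.counit (R := k) a := by
    have i : char (ψ 1) ≅ char (Bialgebra.counitAlgHom k A) :=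
      (I 1).symm ≪≫ (nonempty_irr_one_iso e).some
    exact fun a => AlgHom.congr_fun (char_injective i) a
  have ψ_mul : ∀ g h a, ψ (g * h) a = ψ h (leftTwist (ψ g) a) := by
    intro g h
    obtain ⟨j⟩ := nonempty_irr_tensor_iso e (a := grp g) (b := grp h) (c := grp (g * h)) (by
      rintro (x | _) <;> simp [TambaraYamagamiData.fusionSymbols, Fusion])
    have i : char (ψ (g * h)) ≅ char ((ψ h).comp (leftTwist (ψ g))) :=
      (I (g * h)).symm ≪≫ j.symm ≪≫ (I g ⊗ᵢ I h) ≪≫ charTensorIso (ψ g) (char (ψ h))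
    exact fun a => AlgHom.congr_fun (char_injective i) a
  have hL : ∀ g, Nonempty (M.comap (leftTwist (ψ g)) ≅ M) := by
    intro g
    obtain ⟨j⟩ := nonempty_irr_tensor_iso e (a := grp g) (b := m) (c := m) (by
      rintro (x | _) <;> simp [TambaraYamagamiData.fusionSymbols, Fusion])
    exact ⟨(charTensorIso (ψ g) M).symm ≪≫ whiskerRightIso (I g).symm M ≪≫ j⟩
  have hR : ∀ g, Nonempty (M.comap (rightTwist (ψ g)) ≅ M) := by
    intro g
    obtain ⟨j⟩ := nonempty_irr_tensor_iso e (a := m) (b := grp g) (c := m) (by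
      rintro (x | _) <;> simp [TambaraYamagamiData.fusionSymbols, Fusion])
    exact ⟨(tensorCharIso (ψ g) M).symm ≪≫ whiskerLeftIso M (I g).symm ≪≫ j⟩
  -- The isomorphisms at `g = 1` are normalized to be the identity.
  let L : G → M.V ≃ₗ[k] M.V := fun g => if g = 1 then LinearEquiv.refl k M.V else
    isoLin (X := M.comap (leftTwist (ψ g))) (hL g).some
  let R : G → M.V ≃ₗ[k] M.V := fun g => if g = 1 then LinearEquiv.refl k M.V else
    isoLin (X := M.comap (rightTwist (ψ g))) (hR g).some
  have hp : ∀ g : G, ∃ p : M ⊗ M ⟶ irr e (grp g),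
      p ≠ 0 ∧ ∀ f : M ⊗ M ⟶ irr e (grp g), ∃ θ, f = p ≫ θ := fun g =>
    exists_tensor_proj e (a := m) (b := m) (c := grp g) trivial
  choose p hp0 hp using hp
  let β : ∀ g, M ⊗ M ⟶ char (ψ g) := fun g => p g ≫ (I g).hom
  let B : M.V ⊗[k] M.V →ₗ[k] (G → k) := LinearMap.pi fun g => (β g).toLin
  have hB : ∀ t g, B t g = (β g).toLin t := fun t g => rfl
  have B_π : ∀ a t g, B (diag M.ρ M.ρ a t) g = ψ g a * B t g := fun a t g =>
    (β g).equivariant a t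
  -- A tensor killed by `B` is killed by all morphisms to irreducible representations.
  have hinj : Function.Injective B := by
    refine (injective_iff_map_eq_zero B).2 fun t ht => ?_
    refine eq_zero_of_forall_irr e (X := M ⊗ M) (x := t) fun s f => ?_
    rcases s with g | _
    · obtain ⟨θ, rfl⟩ := hp g f
      have h0 : (p g).toLin t = 0 := by
        apply (isoLin (I g)).injective
        rw [map_zero]
        exact congrFun ht g
      change θ.toLin ((p g).toLin t) = 0
      rw [h0, map_zero]
    · rw [tensor_hom_eq_zero e (a := m) (b := m) (c := m) (fun h : False => h) f]
      rfl
  have hsurj : Function.Surjective B := by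
    have hs : ∀ g, Pi.single g 1 ∈ LinearMap.range B := by
      intro g
      obtain ⟨t, ht⟩ : ∃ t, B t g ≠ 0 := by
        by_contra! h
        apply hp0 g
        apply hom_ext
        refine LinearMap.ext fun t => (isoLin (I g)).injective ?_
        exact (h t).trans (map_zero (isoLin (I g))).symm
      -- An element of `A` that acts on `⊕ ψ h` as a multiple of the projection to `ψ g`.
      obtain ⟨a, ha, -⟩ := full (Pi.single g (B t g)⁻¹) 0
      refine ⟨diag M.ρ M.ρ a t, funext fun h => ?_⟩
      rw [B_π, ha]
      rcases eq_or_ne h g with rfl | hh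
      · simp [ht]
      · simp [hh]
    intro y
    have : y = ∑ g, y g • Pi.single g (1 : k) := by
      ext h
      simp [Finset.sum_apply, Pi.single_apply]
    rw [this]
    exact Submodule.sum_mem _ fun g _ => Submodule.smul_mem _ _ (hs g)
  exact ⟨{
    V := M.V
    ψ := ψ
    π := M.ρ
    faithful := fun a h1 h2 => by
      obtain ⟨X, x, hX⟩ := exists_regular (k := k) (A := A)
      refine hX a (eq_zero_of_forall_irr e fun s f => ?_)
      rw [f.equivariant]
      rcases s with g | _
      · apply (isoLin (I g)).injective
        rw [isoLin_equivariant, map_zero]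
        change ψ g a * _ = 0
        rw [h1, zero_mul]
      · change M.ρ a _ = 0
        rw [h2, LinearMap.zero_apply]
    full := full
    ψ_one := ψ_one
    ψ_mul := ψ_mul
    L := L
    L_one := if_pos rfl
    L_π := fun g a v => by
      by_cases hg : g = 1
      · subst hg
        simp only [L, if_pos, LinearEquiv.refl_apply, leftTwist_counit (ψ 1) ψ_one]
      · simp only [L, if_neg hg]
        exact isoLin_equivariant (hL g).some a v
    R := R
    R_one := if_pos rfl
    R_π := fun g a v => by
      by_cases hg : g = 1
      · subst hg
        simp only [R, if_pos, LinearEquiv.refl_apply, rightTwist_counit (ψ 1) ψ_one]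
      · simp only [R, if_neg hg]
        exact isoLin_equivariant (hR g).some a v
    B := LinearEquiv.ofBijective B ⟨hinj, hsurj⟩
    B_π := B_π }⟩

end TambaraYamagami

end HopfRep

/-! ### Elements that commute up to a scalar -/

/-- The elements `x` and `y` commute up to the scalar `c`. -/
def ScalarCommute {k E : Type*} [Field k] [Ring E] [Algebra k E] (c : kˣ) (x y : E) : Prop :=
  x * y = c • (y * x)

namespace ScalarCommute

variable {k E : Type*} [Field k] [Ring E] [Algebra k E] {c d : kˣ} {x y z : E}

theorem symm (h : ScalarCommute c x y) : ScalarCommute c⁻¹ y x := by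
  rw [ScalarCommute, show x * y = _ from h, inv_smul_smul]

theorem mul_left (h : ScalarCommute c x z) (h' : ScalarCommute d y z) :
    ScalarCommute (c * d) (x * y) z := by
  rw [ScalarCommute, mul_assoc, show y * z = _ from h', mul_smul_comm, ← mul_assoc,
    show x * z = _ from h, smul_mul_assoc, smul_smul, mul_assoc, mul_comm d]

theorem mul_right (h : ScalarCommute c x y) (h' : ScalarCommute d x z) :
    ScalarCommute (c * d) x (y * z) := by
  have := (h.symm.mul_left h'.symm).symm
  rwa [mul_inv, inv_inv, inv_inv] at this

theorem of_smul_left (h : ScalarCommute c (d • x) y) : ScalarCommute c x y := by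
  rw [ScalarCommute, smul_mul_assoc, mul_smul_comm, smul_comm c d] at h
  exact smul_left_cancel d h

theorem of_smul_right (h : ScalarCommute c x (d • y)) : ScalarCommute c x y := by
  have := h.symm.of_smul_left.symm
  rwa [inv_inv] at this

theorem units_inv_right {y : Eˣ} (h : ScalarCommute c x (y : E)) :
    ScalarCommute c⁻¹ x ((y⁻¹ : Eˣ) : E) := by
  have h1 : (y⁻¹ : Eˣ) * (x * y) * (y⁻¹ : Eˣ) = c • (((y⁻¹ : Eˣ) : E) * (y * x) * (y⁻¹ : Eˣ)) := by
    rw [show x * y = _ from h, mul_smul_comm, smul_mul_assoc]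
  rw [Units.inv_mul_cancel_left, ← mul_assoc, Units.mul_inv_cancel_right] at h1
  rw [ScalarCommute, h1, inv_smul_smul]

theorem unique {x y : Eˣ} [Nontrivial E] (h : ScalarCommute c (x : E) y)
    (h' : ScalarCommute d (x : E) y) : c = d := by
  have h1 : c • ((y * x : Eˣ) : E) = d • ((y * x : Eˣ) : E) := by
    rw [Units.val_mul]
    exact Eq.trans (Eq.symm h) h'
  have h2 := congrArg (fun z => z * ((y * x)⁻¹ : Eˣ).val) h1
  simp only [smul_mul_assoc, Units.mul_inv, Units.smul_def] at h2
  exact Units.ext (smul_left_injective k one_ne_zero h2)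

end ScalarCommute

/-! ### Twists of a Hopf algebra by characters -/

section Twist

variable {k : Type*} [Field k] {A : Type*} [Ring A] [HopfAlgebra k A]

open Coalgebra

theorem comul_leftTwist (χ : A →ₐ[k] k) (a : A) :
    comul (R := k) (leftTwist χ a) = (leftTwist χ).toLinearMap.rTensor A (comul (R := k) a) := by
  have h1 : ∀ w : A ⊗[k] A, comul (R := k) (TensorProduct.lid k A (χ.toLinearMap.rTensor A w)) =
      TensorProduct.lid k (A ⊗[k] A) (χ.toLinearMap.rTensor (A ⊗[k] A)
        ((comul (R := k)).lTensor A w)) := by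
    intro w
    induction w with
    | zero => simp
    | add s t hs ht => simp only [map_add, hs, ht]
    | tmul b c => simp
  have h2 : ∀ w : A ⊗[k] A, TensorProduct.lid k (A ⊗[k] A) (χ.toLinearMap.rTensor (A ⊗[k] A)
      (TensorProduct.assoc k A A A ((comul (R := k)).rTensor A w))) =
        (leftTwist χ).toLinearMap.rTensor A w := by
    intro w
    induction w with
    | zero => simp
    | add s t hs ht => simp only [map_add, hs, ht]
    | tmul b c =>
      simp only [LinearMap.rTensor_tmul, AlgHom.toLinearMap_apply, leftTwist_apply χ b]
      induction comul (R := k) b with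
      | zero => simp
      | add s t hs ht => simp only [map_add, add_tmul, hs, ht]
      | tmul p q => simp [TensorProduct.smul_tmul']
  rw [leftTwist_apply χ, h1, ← coassoc_apply, h2]

theorem comul_rightTwist (χ : A →ₐ[k] k) (a : A) :
    comul (R := k) (rightTwist χ a) = (rightTwist χ).toLinearMap.lTensor A (comul (R := k) a) := by
  have h1 : ∀ w : A ⊗[k] A, comul (R := k) (TensorProduct.rid k A (χ.toLinearMap.lTensor A w)) =
      TensorProduct.rid k (A ⊗[k] A) (χ.toLinearMap.lTensor (A ⊗[k] A)
        ((comul (R := k)).rTensor A w)) := by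
    intro w
    induction w with
    | zero => simp
    | add s t hs ht => simp only [map_add, hs, ht]
    | tmul b c => simp
  have h2 : ∀ w : A ⊗[k] A, TensorProduct.rid k (A ⊗[k] A) (χ.toLinearMap.lTensor (A ⊗[k] A)
      ((TensorProduct.assoc k A A A).symm ((comul (R := k)).lTensor A w))) =
        (rightTwist χ).toLinearMap.lTensor A w := by
    intro w
    induction w with
    | zero => simp
    | add s t hs ht => simp only [map_add, hs, ht]
    | tmul b c =>
      simp only [LinearMap.lTensor_tmul, AlgHom.toLinearMap_apply, rightTwist_apply χ c]
      induction comul (R := k) c with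
      | zero => simp
      | add s t hs ht => simp only [map_add, tmul_add, hs, ht]
      | tmul p q => simp
  rw [rightTwist_apply χ, h1, ← coassoc_symm_apply, h2]

/-- Coassociativity: `a₁ χ(a₂) ⊗ a₃ = a₁ ⊗ χ(a₂) a₃`. -/
theorem rTensor_rightTwist_comul (χ : A →ₐ[k] k) (a : A) :
    (rightTwist χ).toLinearMap.rTensor A (comul (R := k) a) =
      (leftTwist χ).toLinearMap.lTensor A (comul (R := k) a) := by
  have h1 : ∀ w : A ⊗[k] A, (leftTwist χ).toLinearMap.lTensor A w =
      (TensorProduct.lid k A ∘ₗ χ.toLinearMap.rTensor A).lTensor A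
        ((comul (R := k)).lTensor A w) := by
    intro w
    rw [← LinearMap.lTensor_comp_apply]
    rfl
  have h2 : ∀ w : A ⊗[k] A, (TensorProduct.lid k A ∘ₗ χ.toLinearMap.rTensor A).lTensor A
        (TensorProduct.assoc k A A A ((comul (R := k)).rTensor A w)) =
      (rightTwist χ).toLinearMap.rTensor A w := by
    intro w
    induction w with
    | zero => simp
    | add s t hs ht => simp only [map_add, hs, ht]
    | tmul b c =>
      simp only [LinearMap.rTensor_tmul, AlgHom.toLinearMap_apply, rightTwist_apply χ b]
      induction comul (R := k) b with
      | zero => simp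
      | add s t hs ht => simp only [map_add, add_tmul, hs, ht]
      | tmul p q => simp [TensorProduct.smul_tmul']
  rw [h1, ← coassoc_apply, h2]

theorem leftTwist_leftTwist (χ χ' : A →ₐ[k] k) (a : A) :
    leftTwist χ' (leftTwist χ a) = leftTwist (χ'.comp (leftTwist χ)) a := by
  rw [leftTwist_apply χ', comul_leftTwist, ← LinearMap.rTensor_comp_apply, leftTwist_apply]
  rfl

theorem rightTwist_rightTwist (χ χ' : A →ₐ[k] k) (a : A) :
    rightTwist χ' (rightTwist χ a) = rightTwist (χ'.comp (rightTwist χ)) a := by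
  rw [rightTwist_apply χ', comul_rightTwist, ← LinearMap.lTensor_comp_apply, rightTwist_apply]
  rfl

theorem leftTwist_rightTwist (χ χ' : A →ₐ[k] k) (a : A) :
    leftTwist χ' (rightTwist χ a) = rightTwist χ (leftTwist χ' a) := by
  have h1 : ∀ w : A ⊗[k] A, TensorProduct.lid k A (χ'.toLinearMap.rTensor A
      ((rightTwist χ).toLinearMap.lTensor A w)) =
        rightTwist χ (TensorProduct.lid k A (χ'.toLinearMap.rTensor A w)) := by
    intro w
    induction w with
    | zero => simp
    | add s t hs ht => simp only [map_add, hs, ht]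
    | tmul b c => simp
  rw [leftTwist_apply χ', comul_rightTwist, h1, ← leftTwist_apply]

theorem apply_rightTwist (χ χ' : A →ₐ[k] k) (a : A) :
    χ (rightTwist χ' a) = χ' (leftTwist χ a) := by
  rw [leftTwist_apply, rightTwist_apply]
  induction comul (R := k) a with
  | zero => simp
  | add s t hs ht => simp only [map_add, hs, ht]
  | tmul p q => simp [mul_comm]

end Twist

/-! ### The projective representations of `G` on `V` -/

namespace TambaraYamagamiReps

attribute [instance] addCommGroup module finite nontrivial

variable {k : Type u} [Field k] {A : Type v} [Ring A] [HopfAlgebra k A] {G : Type w} [CommGroup G]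
  (T : TambaraYamagamiReps k A G)

/-- The isomorphism `L g` as a unit of `End V`. -/
noncomputable def l (g : G) : (Module.End k T.V)ˣ :=
  (LinearMap.GeneralLinearGroup.generalLinearEquiv k T.V).symm (T.L g)

/-- The isomorphism `R g` as a unit of `End V`. -/
noncomputable def r (g : G) : (Module.End k T.V)ˣ :=
  (LinearMap.GeneralLinearGroup.generalLinearEquiv k T.V).symm (T.R g)

theorem coe_r (g : G) : (T.r g : Module.End k T.V) = (T.R g).toLinearMap := rfl

theorem l_one : T.l 1 = 1 := by
  rw [l, T.L_one]
  rfl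

theorem l_mul_π (g : G) (a : A) :
    (T.l g : Module.End k T.V) * T.π (leftTwist (T.ψ g) a) = T.π a * T.l g :=
  LinearMap.ext fun v => T.L_π g a v

theorem r_mul_π (g : G) (a : A) :
    (T.r g : Module.End k T.V) * T.π (rightTwist (T.ψ g) a) = T.π a * T.r g :=
  LinearMap.ext fun v => T.R_π g a v

theorem comp_leftTwist (g h : G) : (T.ψ h).comp (leftTwist (T.ψ g)) = T.ψ (g * h) :=
  AlgHom.ext fun a => (T.ψ_mul g h a).symm

theorem comp_rightTwist (g h : G) : (T.ψ h).comp (rightTwist (T.ψ g)) = T.ψ (g * h) :=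
  AlgHom.ext fun a => by
    rw [AlgHom.comp_apply, apply_rightTwist, ← T.ψ_mul, mul_comm]

theorem leftTwist_mul (g h : G) (a : A) :
    leftTwist (T.ψ h) (leftTwist (T.ψ g) a) = leftTwist (T.ψ (g * h)) a := by
  rw [leftTwist_leftTwist, T.comp_leftTwist]

theorem rightTwist_mul (g h : G) (a : A) :
    rightTwist (T.ψ h) (rightTwist (T.ψ g) a) = rightTwist (T.ψ (g * h)) a := by
  rw [rightTwist_rightTwist, T.comp_rightTwist]

theorem leftTwist_leftTwist_inv (g : G) (a : A) :
    leftTwist (T.ψ g) (leftTwist (T.ψ g⁻¹) a) = a := by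
  rw [leftTwist_mul, inv_mul_cancel, HopfRep.leftTwist_counit _ T.ψ_one]

theorem rightTwist_rightTwist_inv (g : G) (a : A) :
    rightTwist (T.ψ g) (rightTwist (T.ψ g⁻¹) a) = a := by
  rw [rightTwist_mul, inv_mul_cancel, HopfRep.rightTwist_counit _ T.ψ_one]

theorem π_surjective : Function.Surjective T.π := fun X =>
  let ⟨a, ha⟩ := T.full 0 X
  ⟨a, ha.2⟩

theorem exists_eq_smul_one (X : (Module.End k T.V)ˣ)
    (h : ∀ Y : Module.End k T.V, Y * X = X * Y) : ∃ c : kˣ, (X : Module.End k T.V) = c • 1 := by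
  obtain ⟨c, hc⟩ := (Algebra.IsCentral.mem_center_iff k).1
    (Subalgebra.mem_center_iff (R := k).2 h)
  have hc0 : c ≠ 0 := by
    rintro rfl
    rw [map_zero] at hc
    exact X.ne_zero hc
  exact ⟨Units.mk0 c hc0, hc.trans (Algebra.algebraMap_eq_smul_one c)⟩

/-- Schur's lemma: an isomorphism from a twist of `V` to `V` is unique up to a scalar. -/
theorem exists_eq_smul (θ : A → A) (X Y : (Module.End k T.V)ˣ)
    (hX : ∀ a, X * T.π (θ a) = T.π a * X) (hY : ∀ a, Y * T.π (θ a) = T.π a * Y) :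
    ∃ c : kˣ, (X : Module.End k T.V) = c • (Y : Module.End k T.V) := by
  obtain ⟨c, hc⟩ := T.exists_eq_smul_one (X * Y⁻¹) fun Z => by
    obtain ⟨a, rfl⟩ := T.π_surjective Z
    have h1 : T.π a * (X * (Y⁻¹ : (Module.End k T.V)ˣ)) =
        X * T.π (θ a) * (Y⁻¹ : (Module.End k T.V)ˣ) := by
      rw [hX, mul_assoc]
    have h2 : T.π (θ a) * (Y⁻¹ : (Module.End k T.V)ˣ) =
        (Y⁻¹ : (Module.End k T.V)ˣ) * T.π a := by
      rw [Units.mul_inv_eq_iff_eq_mul, mul_assoc, ← hY, Units.inv_mul_cancel_left]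
    rw [Units.val_mul, h1, mul_assoc, h2, mul_assoc]
  refine ⟨c, ?_⟩
  rw [Units.val_mul, Units.mul_inv_eq_iff_eq_mul, smul_mul_assoc, one_mul] at hc
  exact hc

theorem exists_l_mul (g h : G) : ∃ c : kˣ,
    (T.l g * T.l h : Module.End k T.V) = c • (T.l (g * h) : Module.End k T.V) :=
  T.exists_eq_smul (leftTwist (T.ψ (g * h))) (T.l g * T.l h) (T.l (g * h))
    (fun a => by
      rw [← leftTwist_mul, Units.val_mul, mul_assoc, l_mul_π, ← mul_assoc, l_mul_π, mul_assoc])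
    (T.l_mul_π (g * h))

theorem exists_r_mul (g h : G) : ∃ c : kˣ,
    (T.r g * T.r h : Module.End k T.V) = c • (T.r (g * h) : Module.End k T.V) :=
  T.exists_eq_smul (rightTwist (T.ψ (g * h))) (T.r g * T.r h) (T.r (g * h))
    (fun a => by
      rw [← rightTwist_mul, Units.val_mul, mul_assoc, r_mul_π, ← mul_assoc, r_mul_π, mul_assoc])
    (T.r_mul_π (g * h))

theorem exists_l_comm_r (g h : G) : ∃ c : kˣ,
    ScalarCommute c (T.l g : Module.End k T.V) (T.r h : Module.End k T.V) :=
  T.exists_eq_smul (fun a => rightTwist (T.ψ h) (leftTwist (T.ψ g) a)) (T.l g * T.r h)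
    (T.r h * T.l g)
    (fun a => by
      rw [Units.val_mul, mul_assoc, r_mul_π, ← mul_assoc, l_mul_π, mul_assoc])
    (fun a => by
      rw [← leftTwist_rightTwist, Units.val_mul, mul_assoc, l_mul_π, ← mul_assoc, r_mul_π,
        mul_assoc])

theorem exists_l_comm_l (g h : G) : ∃ c : kˣ,
    ScalarCommute c (T.l g : Module.End k T.V) (T.l h : Module.End k T.V) := by
  obtain ⟨c, hc⟩ := T.exists_l_mul g h
  obtain ⟨d, hd⟩ := T.exists_l_mul h g
  refine ⟨c * d⁻¹, ?_⟩
  rw [ScalarCommute, hc, hd, smul_smul, inv_mul_cancel_right, mul_comm]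

/-- The 2-cocycle of the projective representation `l`. -/
noncomputable def cocycle (g h : G) : kˣ := (T.exists_l_mul g h).choose

theorem l_mul (g h : G) : (T.l g * T.l h : Module.End k T.V) =
    T.cocycle g h • (T.l (g * h) : Module.End k T.V) := (T.exists_l_mul g h).choose_spec

/-- The bicharacter given by the commutators of `L` and `R`. -/
noncomputable def c (g h : G) : kˣ := (T.exists_l_comm_r g h).choose

theorem l_comm_r (g h : G) :
    ScalarCommute (T.c g h) (T.l g : Module.End k T.V) (T.r h : Module.End k T.V) :=
  (T.exists_l_comm_r g h).choose_spec

/-- The alternating bicharacter given by the commutators of `L`. -/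
noncomputable def b (g h : G) : kˣ := (T.exists_l_comm_l g h).choose

theorem l_comm_l (g h : G) :
    ScalarCommute (T.b g h) (T.l g : Module.End k T.V) (T.l h : Module.End k T.V) :=
  (T.exists_l_comm_l g h).choose_spec

theorem b_symm (g h : G) : T.b h g = (T.b g h)⁻¹ := (T.l_comm_l h g).unique (T.l_comm_l g h).symm

theorem b_mul_left (g g' h : G) : T.b (g * g') h = T.b g h * T.b g' h := by
  have h1 := (T.l_comm_l g h).mul_left (T.l_comm_l g' h)
  rw [l_mul] at h1
  exact (T.l_comm_l _ _).unique h1.of_smul_left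

theorem b_mul_right (g h h' : G) : T.b g (h * h') = T.b g h * T.b g h' := by
  rw [b_symm, b_mul_left, mul_inv, ← b_symm, ← b_symm]

theorem c_mul_left (g g' h : G) : T.c (g * g') h = T.c g h * T.c g' h := by
  have h1 := (T.l_comm_r g h).mul_left (T.l_comm_r g' h)
  rw [l_mul] at h1
  exact (T.l_comm_r _ _).unique h1.of_smul_left

theorem c_mul_right (g h h' : G) : T.c g (h * h') = T.c g h * T.c g h' := by
  have h1 := (T.l_comm_r g h).mul_right (T.l_comm_r g h')
  obtain ⟨d, hd⟩ := T.exists_r_mul h h'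
  rw [hd] at h1
  exact (T.l_comm_r _ _).unique h1.of_smul_right

theorem c_one_left (h : G) : T.c 1 h = 1 := by
  simpa using T.c_mul_left 1 1 h

theorem c_one_right (g : G) : T.c g 1 = 1 := by
  simpa using T.c_mul_right g 1 1

theorem c_inv_left (g h : G) : T.c g⁻¹ h = (T.c g h)⁻¹ := by
  rw [eq_inv_iff_mul_eq_one, ← c_mul_left, inv_mul_cancel, c_one_left]

theorem b_one_right (g : G) : T.b g 1 = 1 := by
  simpa using T.b_mul_right g 1 1

theorem b_inv_right (g h : G) : T.b g h⁻¹ = (T.b g h)⁻¹ := by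
  rw [eq_inv_iff_mul_eq_one, ← b_mul_right, inv_mul_cancel, b_one_right]

/-! ### The pairings `V ⊗ V → k` -/

/-- If `S₁` and `S₂` intertwine `V`, twisted by `θ₁` and `θ₂`, with `V`, then `S₁ ⊗ S₂`
intertwines the actions of `A ⊗ A` on `V ⊗ V`. -/
theorem act_intertwine (θ₁ θ₂ : A →ₗ[k] A) (S₁ S₂ : T.V ≃ₗ[k] T.V)
    (h₁ : ∀ a v, S₁ (T.π (θ₁ a) v) = T.π a (S₁ v)) (h₂ : ∀ a v, S₂ (T.π (θ₂ a) v) = T.π a (S₂ v))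
    (z : A ⊗[k] A) (t : T.V ⊗[k] T.V) :
    TensorProduct.congr S₁ S₂ (HopfRep.act₂ T.π T.π (TensorProduct.map θ₁ θ₂ z) t) =
      HopfRep.act₂ T.π T.π z (TensorProduct.congr S₁ S₂ t) := by
  induction z with
  | zero => simp
  | add x y hx hy => simp only [map_add, LinearMap.add_apply, hx, hy]
  | tmul x y =>
    induction t with
    | zero => simp
    | add s t hs ht => simp only [map_add, hs, ht]
    | tmul v w => simp [h₁, h₂]

/-- Schur's lemma for pairings: a `ψ x`-equivariant functional on `V ⊗ V` is a multiple of the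
`x`-component of `B`. -/
theorem exists_B_eq (P : T.V ⊗[k] T.V ≃ₗ[k] T.V ⊗[k] T.V) (e x : G)
    (h : ∀ a t, T.B (P (HopfRep.diag T.π T.π a t)) e = T.ψ x a * T.B (P t) e) :
    ∃ c : kˣ, ∀ t, T.B (P t) e = c * T.B t x := by
  classical
  obtain ⟨a, ha, -⟩ := T.full (Pi.single x 1) 0
  have key : ∀ t, T.B (P t) e = T.B (P (T.B.symm (Pi.single x 1))) e * T.B t x := by
    intro t
    have h1 : HopfRep.diag T.π T.π a t = T.B t x • T.B.symm (Pi.single x 1) := by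
      apply T.B.injective
      rw [map_smul, LinearEquiv.apply_symm_apply]
      ext g
      rw [T.B_π, ha]
      rcases eq_or_ne g x with rfl | hg
      · simp
      · simp [hg]
    have h2 := h a t
    rw [ha, Pi.single_eq_same, one_mul, h1, map_smul, map_smul] at h2
    rw [← h2, Pi.smul_apply, smul_eq_mul, mul_comm]
  refine ⟨Units.mk0 _ fun h0 => ?_, key⟩
  have := key (P.symm (T.B.symm (Pi.single e 1)))
  rw [h0, zero_mul] at this
  simp at this

/-- The isomorphism `(ψ g ⊗ V) ⊗ V = ψ g ⊗ (V ⊗ V)`: the operator `L g` permutes the components of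
`B`, up to scalars. -/
theorem exists_B_l (g e : G) : ∃ c : kˣ, ∀ t,
    T.B (TensorProduct.congr (T.L g) (LinearEquiv.refl k T.V) t) e = c * T.B t (g⁻¹ * e) := by
  refine T.exists_B_eq _ e _ fun a t => ?_
  have h1 := T.act_intertwine (leftTwist (T.ψ g)).toLinearMap LinearMap.id (T.L g)
    (LinearEquiv.refl k T.V) (T.L_π g) (fun _ _ => rfl)
    (Coalgebra.comul (R := k) (leftTwist (T.ψ g⁻¹) a)) t
  have h2 := comul_leftTwist (T.ψ g) (leftTwist (T.ψ g⁻¹) a)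
  rw [T.leftTwist_leftTwist_inv] at h2
  rw [HopfRep.diag_apply, h2]
  refine (congrFun (congrArg T.B h1) e).trans ?_
  rw [← HopfRep.diag_apply, T.B_π, T.ψ_mul]

/-- The isomorphism `V ⊗ (V ⊗ ψ g) = (V ⊗ V) ⊗ ψ g`: the operator `R g` permutes the components of
`B`, up to scalars. -/
theorem exists_B_r (g e : G) : ∃ c : kˣ, ∀ t,
    T.B (TensorProduct.congr (LinearEquiv.refl k T.V) (T.R g) t) e = c * T.B t (g⁻¹ * e) := by
  refine T.exists_B_eq _ e _ fun a t => ?_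
  have h1 := T.act_intertwine LinearMap.id (rightTwist (T.ψ g)).toLinearMap
    (LinearEquiv.refl k T.V) (T.R g) (fun _ _ => rfl) (T.R_π g)
    (Coalgebra.comul (R := k) (rightTwist (T.ψ g⁻¹) a)) t
  have h2 := comul_rightTwist (T.ψ g) (rightTwist (T.ψ g⁻¹) a)
  rw [T.rightTwist_rightTwist_inv] at h2
  rw [HopfRep.diag_apply, h2]
  refine (congrFun (congrArg T.B h1) e).trans ?_
  rw [← HopfRep.diag_apply, T.B_π, ← T.comp_rightTwist, AlgHom.comp_apply]

/-- The isomorphism `V ⊗ (ψ ⊗ V) = (V ⊗ ψ) ⊗ V` shows that `L g` is adjoint to `R g` for each of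
the pairings `V ⊗ V → ψ d`, up to a scalar. -/
theorem exists_B_adjoint (g d : G) : ∃ c : kˣ, ∀ t,
    T.B (TensorProduct.congr (LinearEquiv.refl k T.V) (T.L g) t) d =
      c * T.B (TensorProduct.congr (T.R g) (LinearEquiv.refl k T.V) t) d := by
  let P := (TensorProduct.congr (T.R g) (LinearEquiv.refl k T.V)).symm.trans
    (TensorProduct.congr (LinearEquiv.refl k T.V) (T.L g))
  obtain ⟨c, hc⟩ := T.exists_B_eq P d d fun a t => by
    obtain ⟨s, rfl⟩ := (TensorProduct.congr (T.R g) (LinearEquiv.refl k T.V)).surjective t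
    have h1 := T.act_intertwine (rightTwist (T.ψ g)).toLinearMap LinearMap.id (T.R g)
      (LinearEquiv.refl k T.V) (T.R_π g) (fun _ _ => rfl) (Coalgebra.comul (R := k) a) s
    have h2 := T.act_intertwine LinearMap.id (leftTwist (T.ψ g)).toLinearMap
      (LinearEquiv.refl k T.V) (T.L g) (fun _ _ => rfl) (T.L_π g) (Coalgebra.comul (R := k) a) s
    have h3 : TensorProduct.map LinearMap.id (leftTwist (T.ψ g)).toLinearMap
        (Coalgebra.comul (R := k) a) = TensorProduct.map (rightTwist (T.ψ g)).toLinearMap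
          LinearMap.id (Coalgebra.comul (R := k) a) := (rTensor_rightTwist_comul (T.ψ g) a).symm
    rw [h3] at h2
    rw [HopfRep.diag_apply, ← h1, LinearEquiv.trans_apply, LinearEquiv.symm_apply_apply, h2,
      LinearEquiv.trans_apply, LinearEquiv.symm_apply_apply, ← HopfRep.diag_apply, T.B_π]
  refine ⟨c, fun t => ?_⟩
  rw [← hc, LinearEquiv.trans_apply, LinearEquiv.symm_apply_apply]

end TambaraYamagamiReps

/-! ### The duality of `G` -/

namespace TambaraYamagamiReps

variable {k : Type u} [Field k] {A : Type v} [Ring A] [HopfAlgebra k A] {G : Type w} [CommGroup G]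
  (T : TambaraYamagamiReps k A G)

/-- The pairing `v ⊗ w ↦ B(X v ⊗ Y w)_1`. -/
noncomputable def pair (X Y : Module.End k T.V) : T.V ⊗[k] T.V →ₗ[k] k :=
  LinearMap.proj 1 ∘ₗ T.B.toLinearMap ∘ₗ TensorProduct.map X Y

theorem pair_apply (X Y : Module.End k T.V) (t : T.V ⊗[k] T.V) :
    T.pair X Y t = T.B (TensorProduct.map X Y t) 1 := rfl

theorem pair_map (X Y X' Y' : Module.End k T.V) (t : T.V ⊗[k] T.V) :
    T.pair X Y (TensorProduct.map X' Y' t) = T.pair (X * X') (Y * Y') t := by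
  rw [pair_apply, pair_apply, TensorProduct.map_mul]
  rfl

/-- The pairings `pair X 1` as a linear function of `X`. -/
noncomputable def pairHom : Module.End k T.V →ₗ[k] T.V ⊗[k] T.V →ₗ[k] k where
  toFun X := T.pair X 1
  map_add' X Y := LinearMap.ext fun t => by
    rw [LinearMap.add_apply, pair_apply, TensorProduct.map_add_left, LinearMap.add_apply, map_add]
    rfl
  map_smul' c X := LinearMap.ext fun t => by
    rw [LinearMap.smul_apply, pair_apply, TensorProduct.map_smul_left, LinearMap.smul_apply,
      map_smul]
    rfl

theorem pair_smul_left (c : kˣ) (X : Module.End k T.V) (t : T.V ⊗[k] T.V) :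
    T.pair (c • X) 1 t = c * T.pair X 1 t :=
  LinearMap.congr_fun (T.pairHom.map_smul (c : k) X) t

theorem pair_smul_right (c : kˣ) (X : Module.End k T.V) (t : T.V ⊗[k] T.V) :
    T.pair 1 (c • X) t = c * T.pair 1 X t := by
  rw [Units.smul_def, pair_apply, TensorProduct.map_smul_right, LinearMap.smul_apply, map_smul]
  rfl

theorem exists_pair_l (g : G) : ∃ c : kˣ, ∀ t, T.pair (T.l g) 1 t = c * T.B t g⁻¹ := by
  obtain ⟨c, hc⟩ := T.exists_B_l g 1
  rw [mul_one] at hc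
  exact ⟨c, hc⟩

theorem exists_pair_r (g : G) : ∃ c : kˣ, ∀ t, T.pair 1 (T.r g) t = c * T.B t g⁻¹ := by
  obtain ⟨c, hc⟩ := T.exists_B_r g 1
  rw [mul_one] at hc
  exact ⟨c, hc⟩

variable [Fintype G]

theorem pair_sum (a : G → k) (t : T.V ⊗[k] T.V) :
    T.pair (∑ g, a g • (T.l g : Module.End k T.V)) 1 t = ∑ g, a g * T.pair (T.l g) 1 t := by
  refine (LinearMap.congr_fun (map_sum T.pairHom _ _) t).trans ?_
  rw [LinearMap.sum_apply]
  exact Finset.sum_congr rfl fun g _ => LinearMap.congr_fun (T.pairHom.map_smul (a g) _) t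

/-- The pairings `B(L g v ⊗ w)_1` are independent, being proportional to the components of `B`. -/
theorem eq_zero_of_pair_sum (a : G → k)
    (h : ∀ t, T.pair (∑ g, a g • (T.l g : Module.End k T.V)) 1 t = 0) (g : G) : a g = 0 := by
  classical
  obtain ⟨c, hc⟩ := T.exists_pair_l g
  have h1 := h (T.B.symm (Pi.single g⁻¹ 1))
  rw [pair_sum, Finset.sum_eq_single g, hc, LinearEquiv.apply_symm_apply, Pi.single_eq_same,
    mul_one] at h1
  · exact (mul_eq_zero.1 h1).resolve_right c.ne_zero
  · intro x _ hx
    obtain ⟨d, hd⟩ := T.exists_pair_l x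
    rw [hd, LinearEquiv.apply_symm_apply, Pi.single_eq_of_ne (by simpa using hx)]
    simp
  · simp

theorem linearIndependent_l : LinearIndependent k fun g => (T.l g : Module.End k T.V) :=
  Fintype.linearIndependent_iff.2 fun a ha g => T.eq_zero_of_pair_sum a (fun t => by
    rw [ha, pair_apply, TensorProduct.map_zero_left]
    simp) g

theorem finrank_end : Module.finrank k (Module.End k T.V) = Fintype.card G := by
  rw [Module.finrank_linearMap, ← Module.finrank_tensorProduct, T.B.finrank_eq,
    Module.finrank_fintype_fun_eq_card]

/-- The operators `L g` form a basis of `End V`: they are independent since the pairings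
`B(L g v ⊗ w)_1` are proportional to the different components of `B`. -/
noncomputable def lBasis : Module.Basis G k (Module.End k T.V) :=
  basisOfLinearIndependentOfCardEqFinrank T.linearIndependent_l T.finrank_end.symm

theorem lBasis_apply (g : G) : T.lBasis g = T.l g :=
  congrFun (coe_basisOfLinearIndependentOfCardEqFinrank T.linearIndependent_l
    T.finrank_end.symm) g

theorem sum_repr_l (X : Module.End k T.V) :
    ∑ g, T.lBasis.repr X g • (T.l g : Module.End k T.V) = X := by
  have := T.lBasis.sum_repr X
  simpa only [lBasis_apply] using this

theorem eq_zero_of_pair (X : Module.End k T.V) (h : ∀ t, T.pair X 1 t = 0) : X = 0 := by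
  rw [← T.sum_repr_l X] at h ⊢
  exact Finset.sum_eq_zero fun g _ => by rw [T.eq_zero_of_pair_sum _ h g, zero_smul]

/-- The pairing `B(v ⊗ w)_1` is nondegenerate. -/
theorem eq_of_pair {X Y : Module.End k T.V} (h : ∀ t, T.pair X 1 t = T.pair Y 1 t) : X = Y := by
  refine sub_eq_zero.1 (T.eq_zero_of_pair _ fun t => ?_)
  exact (LinearMap.congr_fun (map_sub T.pairHom X Y) t).trans (sub_eq_zero.2 (h t))

theorem eq_of_l_eq_smul {g h : G} {c : kˣ}
    (H : (T.l g : Module.End k T.V) = c • (T.l h : Module.End k T.V)) : g = h := by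
  rw [← lBasis_apply, ← lBasis_apply] at H
  by_contra hgh
  have := congrArg (fun X => T.lBasis.repr X g) H
  simp [Units.smul_def, Ne.symm hgh] at this

/-- The operators `L g` span `End V`, so that an operator commuting with all of them is a scalar.
-/
theorem exists_eq_smul_one_of_l (X : (Module.End k T.V)ˣ)
    (h : ∀ g, ScalarCommute (1 : kˣ) (T.l g : Module.End k T.V) (X : Module.End k T.V)) :
    ∃ c : kˣ, (X : Module.End k T.V) = c • 1 := by
  refine T.exists_eq_smul_one X fun Y => ?_
  rw [← T.sum_repr_l Y, Finset.sum_mul, Finset.mul_sum]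
  refine Finset.sum_congr rfl fun g _ => ?_
  have h1 := h g
  rw [ScalarCommute, one_smul] at h1
  rw [smul_mul_assoc, mul_smul_comm, h1]

/-- Every `R g` is proportional to some `L y`: expand `R g` in the basis `L`; conjugation by `L x`
scales the coefficients at `L y` by `b x y`, and it scales `R g` by `c x g`. -/
theorem exists_r_eq_smul_l (g : G) : ∃ (y : G) (s : kˣ),
    (T.r g : Module.End k T.V) = s • (T.l y : Module.End k T.V) := by
  obtain ⟨y, hy⟩ : ∃ y, T.lBasis.repr (T.r g) y ≠ 0 := by
    by_contra! h
    refine (T.r g).ne_zero (T.lBasis.repr.injective (Finsupp.ext fun y => ?_))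
    rw [h, map_zero, Finsupp.zero_apply]
  have hb : ∀ x, T.b x y = T.c x g := by
    intro x
    have h1 : ∑ z, (T.lBasis.repr (T.r g) z * T.b x z) • (T.l z : Module.End k T.V) =
        ∑ z, (T.c x g * T.lBasis.repr (T.r g) z) • (T.l z : Module.End k T.V) := by
      have h2 : (T.l x : Module.End k T.V) * T.r g = T.c x g • (T.r g * T.l x) := T.l_comm_r x g
      have h3 : ∀ z, (T.l x : Module.End k T.V) * T.l z = T.b x z • (T.l z * T.l x) :=
        T.l_comm_l x
      apply (T.l x).isUnit.mul_left_injective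
      have h4 : (T.l x : Module.End k T.V) * T.r g =
          (∑ z, (T.lBasis.repr (T.r g) z * T.b x z) • (T.l z : Module.End k T.V)) * T.l x := by
        conv_lhs => rw [← T.sum_repr_l (T.r g)]
        rw [Finset.mul_sum, Finset.sum_mul]
        refine Finset.sum_congr rfl fun z _ => ?_
        rw [mul_smul_comm, h3, smul_mul_assoc, mul_smul, Units.smul_def]
      refine h4.symm.trans (h2.trans ?_)
      conv_lhs => rw [← T.sum_repr_l (T.r g)]
      simp only [Finset.sum_mul, Finset.smul_sum, smul_mul_assoc, mul_smul, Units.smul_def]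
    have h5 := Fintype.linearIndependent_iff.1 T.linearIndependent_l
      (fun z => T.lBasis.repr (T.r g) z * T.b x z - T.c x g * T.lBasis.repr (T.r g) z)
      (by simp only [sub_smul, Finset.sum_sub_distrib, h1, sub_self]) y
    rw [sub_eq_zero, mul_comm] at h5
    exact Units.ext (mul_right_cancel₀ hy h5)
  obtain ⟨s, hs⟩ := T.exists_eq_smul_one_of_l (T.r g * (T.l y)⁻¹) fun x => by
    have := (T.l_comm_r x g).mul_right (T.l_comm_l x y).units_inv_right
    rwa [hb, mul_inv_cancel] at this
  refine ⟨y, s, ?_⟩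
  rwa [Units.val_mul, Units.mul_inv_eq_iff_eq_mul, smul_mul_assoc, one_mul] at hs

/-- The map of `G` with `R g` proportional to `L (dual g)`. -/
noncomputable def dual (g : G) : G := (T.exists_r_eq_smul_l g).choose

theorem exists_r_eq (g : G) : ∃ s : kˣ,
    (T.r g : Module.End k T.V) = s • (T.l (T.dual g) : Module.End k T.V) :=
  (T.exists_r_eq_smul_l g).choose_spec

theorem c_eq_b (x g : G) : T.c x g = T.b x (T.dual g) := by
  obtain ⟨s, hs⟩ := T.exists_r_eq g
  have h1 := T.l_comm_r x g
  rw [hs] at h1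
  exact h1.of_smul_right.unique (T.l_comm_l x _)

theorem dual_mul (g h : G) : T.dual (g * h) = T.dual g * T.dual h := by
  obtain ⟨s, hs⟩ := T.exists_r_eq g
  obtain ⟨s', hs'⟩ := T.exists_r_eq h
  obtain ⟨s'', hs''⟩ := T.exists_r_eq (g * h)
  obtain ⟨d, hd⟩ := T.exists_r_mul g h
  rw [hs, hs', hs'', smul_mul_smul_comm, l_mul, smul_smul, smul_smul, eq_comm,
    ← eq_inv_smul_iff, smul_smul] at hd
  exact T.eq_of_l_eq_smul hd

/-- The adjoint of `L g` is proportional to `L (dual g)`. -/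
theorem exists_pair_adjoint (g : G) : ∃ s : kˣ, ∀ t,
    T.pair 1 (T.l g) t = s * T.pair (T.l (T.dual g)) 1 t := by
  obtain ⟨s, hs⟩ := T.exists_B_adjoint g 1
  obtain ⟨s', hs'⟩ := T.exists_r_eq g
  refine ⟨s * s', fun t => (hs t).trans ?_⟩
  have h1 : T.B (TensorProduct.congr (T.R g) (LinearEquiv.refl k T.V) t) 1 =
      T.pair (T.r g) 1 t := rfl
  rw [h1, hs', pair_smul_left, Units.val_mul, mul_assoc]

/-- The pairings `B(L g v ⊗ w)_1` and `B(v ⊗ R g w)_1` are proportional to the same component of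
`B`, and `R g` is proportional to `L (dual g)`, whose adjoint is proportional to `L (dual (dual
g))`. -/
theorem dual_dual (g : G) : T.dual (T.dual g) = g := by
  obtain ⟨c, hc⟩ := T.exists_pair_l g
  obtain ⟨d, hd⟩ := T.exists_pair_r g
  obtain ⟨s, hs⟩ := T.exists_r_eq g
  obtain ⟨s', hs'⟩ := T.exists_pair_adjoint (T.dual g)
  have h1 : ∀ t, T.pair 1 (T.r g) t = s * T.pair 1 (T.l (T.dual g)) t := fun t => by
    rw [hs, pair_smul_right]
  refine (T.eq_of_l_eq_smul (c := c * d⁻¹ * s * s') (T.eq_of_pair fun t => ?_)).symm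
  have h2 : T.B t g⁻¹ = (d⁻¹ : kˣ) * T.pair 1 (T.r g) t := by rw [hd, Units.inv_mul_cancel_left]
  rw [pair_smul_left, hc, h2, h1, hs']
  push_cast
  ring

/-- Passing to adjoints reverses products. -/
theorem b_dual (g x : G) : T.b (T.dual x) (T.dual g) = T.b g x := by
  have key : ∀ g x, ∃ s s' : kˣ, (∀ t, T.pair 1 (T.l g * T.l x) t =
      s * (s' * T.pair (T.l (T.dual x) * T.l (T.dual g)) 1 t)) ∧
      ∀ t, T.pair 1 (T.l x * T.l g) t =
      s * (s' * T.pair (T.l (T.dual g) * T.l (T.dual x)) 1 t) := by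
    intro g x
    obtain ⟨s, hs⟩ := T.exists_pair_adjoint g
    obtain ⟨s', hs'⟩ := T.exists_pair_adjoint x
    have h1 : ∀ (Y : Module.End k T.V) X t, T.pair 1 (Y * X) t =
        T.pair 1 Y (TensorProduct.map 1 X t) := fun Y X t => by rw [pair_map, one_mul]
    have h2 : ∀ (Y : Module.End k T.V) X t, T.pair Y 1 (TensorProduct.map 1 X t) =
        T.pair 1 X (TensorProduct.map Y 1 t) := fun Y X t => by
      rw [pair_map, pair_map, one_mul, mul_one, one_mul, mul_one]
    have h3 : ∀ (Y : Module.End k T.V) X t, T.pair Y 1 (TensorProduct.map X 1 t) =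
        T.pair (Y * X) 1 t := fun Y X t => by rw [pair_map, one_mul]
    refine ⟨s, s', fun t => ?_, fun t => ?_⟩
    · rw [h1, hs, h2, hs', h3]
    · rw [h1, hs', h2, hs, h3, mul_left_comm]
  obtain ⟨s, s', h1, h2⟩ := key g x
  refine (T.l_comm_l (T.dual x) (T.dual g)).unique (T.eq_of_pair fun t => ?_)
  have h4 : T.pair 1 (T.l g * T.l x : Module.End k T.V) t =
      T.b g x * T.pair 1 (T.l x * T.l g : Module.End k T.V) t := by
    rw [show (T.l g * T.l x : Module.End k T.V) = T.b g x • (T.l x * T.l g) from T.l_comm_l g x,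
      pair_smul_right]
  rw [pair_smul_left]
  rw [h1, h2] at h4
  have h5 : (s : k) * s' ≠ 0 := mul_ne_zero s.ne_zero s'.ne_zero
  refine mul_left_cancel₀ h5 ?_
  linear_combination h4

/-- The bicharacter `c` is symmetric, since `c g h = b g (dual h)` and `dual` is an involution. -/
theorem c_symm (g h : G) : T.c g h = T.c h g := by
  rw [c_eq_b, c_eq_b, ← T.b_dual, dual_dual]

/-- The bicharacter `c` is nondegenerate. -/
theorem eq_one_of_c_eq_one {g : G} (h : ∀ x, T.c x g = 1) : g = 1 := by
  have h1 : ∀ x, ScalarCommute (1 : kˣ) (T.l x : Module.End k T.V) (T.l (T.dual g)) := fun x => by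
    have := T.l_comm_l x (T.dual g)
    rwa [← c_eq_b, h] at this
  obtain ⟨s, hs⟩ := T.exists_eq_smul_one_of_l _ h1
  have h2 : T.dual g = 1 := T.eq_of_l_eq_smul (c := s) (by rw [hs, l_one, Units.val_one])
  rw [← T.dual_dual g, h2]
  simpa using T.dual_mul 1 1

theorem dual_inv (g : G) : T.dual g⁻¹ = (T.dual g)⁻¹ := by
  have h1 : T.dual 1 = 1 := by simpa using T.dual_mul 1 1
  rw [eq_inv_iff_mul_eq_one, ← dual_mul, inv_mul_cancel, h1]

/-- The involution `g ↦ dual g⁻¹` of `G`. -/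
noncomputable def star : MulAut G :=
  { toFun := fun g => T.dual g⁻¹
    invFun := fun g => (T.dual g)⁻¹
    left_inv := fun g => by
      change (T.dual (T.dual g⁻¹))⁻¹ = g
      rw [dual_dual, inv_inv]
    right_inv := fun g => by
      change T.dual (T.dual g)⁻¹⁻¹ = g
      rw [inv_inv, dual_dual]
    map_mul' := fun g h => by rw [mul_inv, dual_mul] }

theorem star_apply (g : G) : T.star g = T.dual g⁻¹ := rfl

theorem star_mul_star : T.star * T.star = 1 := MulEquiv.ext fun g => by
  rw [MulAut.mul_apply, star_apply, star_apply, ← dual_inv, inv_inv, dual_dual]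
  rfl

/-- The defining property of the involution `star`: it exchanges `c` and `b`. -/
theorem c_star (x g : G) : T.c x (T.star g) = T.b g x := by
  rw [c_eq_b, star_apply, dual_dual, b_inv_right, ← b_symm]

end TambaraYamagamiReps

/-! ### The lift of `G` to the Hopf algebra -/

namespace TambaraYamagamiReps

variable {k : Type u} [Field k] {A : Type v} [Ring A] [HopfAlgebra k A] {G : Type w} [CommGroup G]
  (T : TambaraYamagamiReps k A G)

open Coalgebra

/-- The isomorphism of `A` with `k^G × End V`. -/
noncomputable def prodEquiv : A ≃ₗ[k] (G → k) × Module.End k T.V :=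
  LinearEquiv.ofBijective ((LinearMap.pi fun g => (T.ψ g).toLinearMap).prod T.π.toLinearMap)
    ⟨(injective_iff_map_eq_zero _).2 fun a ha => T.faithful a
      (fun g => congrFun (congrArg Prod.fst ha) g) (congrArg Prod.snd ha),
    fun x => by
      obtain ⟨a, ha, ha'⟩ := T.full x.1 x.2
      exact ⟨a, Prod.ext (funext ha) ha'⟩⟩

/-- The element of `A` with given values of the characters and of `π`. -/
noncomputable def elem (f : G → k) (X : Module.End k T.V) : A := T.prodEquiv.symm (f, X)

theorem ψ_elem (f : G → k) (X : Module.End k T.V) (g : G) : T.ψ g (T.elem f X) = f g :=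
  congrFun (congrArg Prod.fst (T.prodEquiv.apply_symm_apply (f, X))) g

theorem π_elem (f : G → k) (X : Module.End k T.V) : T.π (T.elem f X) = X :=
  congrArg Prod.snd (T.prodEquiv.apply_symm_apply (f, X))

theorem ext {a b : A} (h : ∀ g, T.ψ g a = T.ψ g b) (h' : T.π a = T.π b) : a = b :=
  T.prodEquiv.injective (Prod.ext (funext h) h')

theorem π_leftTwist (g : G) (a : A) : T.π (leftTwist (T.ψ g) a) =
    ((T.l g)⁻¹ : (Module.End k T.V)ˣ) * (T.π a * T.l g) := by
  rw [← l_mul_π, Units.inv_mul_cancel_left]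

theorem π_rightTwist (g : G) (a : A) : T.π (rightTwist (T.ψ g) a) =
    ((T.r g)⁻¹ : (Module.End k T.V)ˣ) * (T.π a * T.r g) := by
  rw [← r_mul_π, Units.inv_mul_cancel_left]

section Fintype

variable [Fintype G]

theorem sum_elem [DecidableEq G] (a : A) :
    ∑ g, T.ψ g a • T.elem (Pi.single g 1) 0 + T.elem 0 (T.π a) = a := by
  refine T.ext (fun h => ?_) ?_
  · simp [ψ_elem, Pi.single_apply]
  · simp [π_elem]

/-- An element of `A ⊗ M` is determined by its images under the irreducible representations of
`A`. -/
theorem eq_zero_of_rTensor {M : Type*} [AddCommGroup M] [Module k M] (x : A ⊗[k] M)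
    (h : ∀ g, (T.ψ g).toLinearMap.rTensor M x = 0) (h' : T.π.toLinearMap.rTensor M x = 0) :
    x = 0 := by
  classical
  let s : Module.End k T.V →ₗ[k] A := T.prodEquiv.symm.toLinearMap ∘ₗ LinearMap.inr k _ _
  have key : (∑ g, LinearMap.toSpanSingleton k A (T.elem (Pi.single g 1) 0) ∘ₗ
      (T.ψ g).toLinearMap) + s ∘ₗ T.π.toLinearMap = LinearMap.id := by
    refine LinearMap.ext fun a => ?_
    rw [LinearMap.add_apply, LinearMap.sum_apply]
    exact T.sum_elem a
  have h1 := LinearMap.congr_fun (congrArg (LinearMap.rTensor M) key) x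
  rw [LinearMap.rTensor_add, LinearMap.rTensor_id, LinearMap.id_apply] at h1
  rw [← h1, LinearMap.add_apply, LinearMap.rTensor_comp_apply, h', map_zero, add_zero,
    ← LinearMap.coe_rTensorHom, map_sum, LinearMap.sum_apply]
  refine Finset.sum_eq_zero fun g _ => ?_
  rw [LinearMap.coe_rTensorHom, LinearMap.rTensor_comp_apply, h, map_zero]

theorem eq_zero_of_lTensor {M : Type*} [AddCommGroup M] [Module k M] (x : M ⊗[k] A)
    (h : ∀ g, (T.ψ g).toLinearMap.lTensor M x = 0) (h' : T.π.toLinearMap.lTensor M x = 0) :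
    x = 0 := by
  apply (TensorProduct.comm k M A).injective
  rw [map_zero]
  refine T.eq_zero_of_rTensor _ (fun g => ?_) ?_
  · rw [← LinearMap.comm_comp_lTensor_comp_comm_eq]
    simp [h]
  · rw [← LinearMap.comm_comp_lTensor_comp_comm_eq]
    simp [h']

/-- An element of `A ⊗ A` is determined by its actions on the tensor products of the irreducible
representations. -/
theorem ext_tensor {x y : A ⊗[k] A}
    (h₁ : ∀ g, TensorProduct.lid k A ((T.ψ g).toLinearMap.rTensor A x) =
      TensorProduct.lid k A ((T.ψ g).toLinearMap.rTensor A y))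
    (h₂ : ∀ g, T.π (TensorProduct.rid k A ((T.ψ g).toLinearMap.lTensor A x)) =
      T.π (TensorProduct.rid k A ((T.ψ g).toLinearMap.lTensor A y)))
    (h₃ : HopfRep.act₂ T.π T.π x = HopfRep.act₂ T.π T.π y) : x = y := by
  have hπ : ∀ (g : G) (z : A ⊗[k] A), T.π (TensorProduct.rid k A
      ((T.ψ g).toLinearMap.lTensor A z)) = TensorProduct.rid k (Module.End k T.V)
        ((T.ψ g).toLinearMap.lTensor _ (T.π.toLinearMap.rTensor A z)) := by
    intro g z
    induction z with
    | zero => simp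
    | add a b ha hb => simp only [map_add, ha, hb]
    | tmul a b => simp
  have hact : ∀ z : A ⊗[k] A, HopfRep.act₂ T.π T.π z = homTensorHomEquiv k T.V T.V T.V T.V
      (T.π.toLinearMap.lTensor _ (T.π.toLinearMap.rTensor A z)) := by
    intro z
    induction z with
    | zero => simp
    | add a b ha hb => simp only [map_add, ha, hb]
    | tmul a b =>
      rw [homTensorHomEquiv_apply]
      rfl
  rw [← sub_eq_zero]
  refine T.eq_zero_of_rTensor _ (fun g => ?_) (T.eq_zero_of_lTensor _ (fun g => ?_) ?_)
  · apply (TensorProduct.lid k A).injective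
    rw [map_sub, map_sub, h₁, sub_self, map_zero]
  · apply (TensorProduct.rid k (Module.End k T.V)).injective
    rw [← hπ, map_sub, map_sub, map_sub, h₂, sub_self, map_zero]
  · apply (homTensorHomEquiv k T.V T.V T.V T.V).injective
    rw [← hact, map_sub, h₃, sub_self, map_zero]

/-- The components of the pairing `V ⊗ V → k^G` differ by the bicharacter `c`. -/
theorem exists_B_c (g : G) : ∃ f : kˣ, ∀ d t,
    T.B (TensorProduct.map 1 (T.l g : Module.End k T.V) t) d =
      f * T.c d g * T.B (TensorProduct.map (T.r g : Module.End k T.V) 1 t) d := by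
  obtain ⟨f, hf⟩ := T.exists_B_adjoint g 1
  refine ⟨f, fun d t => ?_⟩
  obtain ⟨κ, hκ⟩ := T.exists_B_l d⁻¹ 1
  rw [inv_inv, mul_one] at hκ
  have hκ' : ∀ t, T.pair (T.l d⁻¹) 1 t = κ * T.B t d := hκ
  have hf' : ∀ t, T.pair 1 (T.l g) t = f * T.pair (T.r g) 1 t := hf
  have h1 : (T.r g * T.l d⁻¹ : Module.End k T.V) = T.c d g • (T.l d⁻¹ * T.r g) := by
    have := (T.l_comm_r d⁻¹ g).symm
    rwa [c_inv_left, inv_inv] at this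
  have h2 : T.pair (T.l d⁻¹) 1 (TensorProduct.map 1 (T.l g : Module.End k T.V) t) =
      f * (T.c d g * T.pair (T.l d⁻¹) 1 (TensorProduct.map (T.r g : Module.End k T.V) 1 t)) := by
    have h3 : T.pair (T.l d⁻¹) 1 (TensorProduct.map 1 (T.l g : Module.End k T.V) t) =
        T.pair 1 (T.l g) (TensorProduct.map (T.l d⁻¹ : Module.End k T.V) 1 t) := by
      rw [pair_map, pair_map, one_mul, mul_one, one_mul, mul_one]
    rw [h3, hf', pair_map, h1, one_mul, pair_smul_left, pair_map, one_mul]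
  rw [hκ', hκ'] at h2
  refine mul_left_cancel₀ κ.ne_zero ?_
  linear_combination h2

/-- The operator `L (star g) ⊗ L g` acts on the component `ψ d` of `V ⊗ V` by a multiple of `c d
g`, that is, as `sect g` does: move `L g` across the pairing, where it becomes `R g`, the inverse
of `L (star g)` up to a scalar. -/
theorem exists_B_star (g : G) : ∃ f : kˣ, ∀ d t,
    T.c d g * T.B t d =
      f * T.B (TensorProduct.map (T.l (T.star g) : Module.End k T.V) (T.l g) t) d := by
  obtain ⟨f, hf⟩ := T.exists_B_c g
  obtain ⟨s, hs⟩ := T.exists_r_eq g⁻¹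
  obtain ⟨s', hs'⟩ := T.exists_r_mul g g⁻¹
  have hr1 : (T.r 1 : Module.End k T.V) = 1 := by
    rw [coe_r, T.R_one]
    rfl
  have h1 : (T.r g * T.l (T.star g) : Module.End k T.V) = (s⁻¹ * s') • 1 := by
    rw [hs, mul_inv_cancel, hr1, mul_smul_comm] at hs'
    rw [mul_smul, ← hs', inv_smul_smul]
    rfl
  refine ⟨(f * (s⁻¹ * s'))⁻¹, fun d t => ?_⟩
  have h2 : TensorProduct.map (T.l (T.star g) : Module.End k T.V) (T.l g) t =
      TensorProduct.map (1 : Module.End k T.V) (T.l g : Module.End k T.V)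
        (TensorProduct.map (T.l (T.star g) : Module.End k T.V) (1 : Module.End k T.V) t) := by
    rw [← Module.End.mul_apply, ← TensorProduct.map_mul, one_mul, mul_one]
  have h3 : TensorProduct.map (T.r g : Module.End k T.V) (1 : Module.End k T.V)
      (TensorProduct.map (T.l (T.star g) : Module.End k T.V) (1 : Module.End k T.V) t) =
        ((s⁻¹ * s' : kˣ) : k) • t := by
    rw [← Module.End.mul_apply, ← TensorProduct.map_mul, h1, Units.smul_def,
      TensorProduct.map_smul_left, one_mul, TensorProduct.map_one]
    rfl
  rw [h2, hf, h3, map_smul, Pi.smul_apply, smul_eq_mul]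
  have h4 := Units.inv_mul (f * (s⁻¹ * s'))
  rw [Units.val_mul f] at h4
  linear_combination (-(T.c d g * T.B t d) : k) * h4

/-- The scalar by which the diagonal action of `sect g` on `V ⊗ V` differs from
`L (star g) ⊗ L g`. -/
noncomputable def cochain (g : G) : kˣ := (T.exists_B_star g).choose

/-- The section `G → A`, with `ψ x (sect g) = c x g` and `π (sect g) = L g`. -/
noncomputable def sect (g : G) : A := T.elem (fun x => T.c x g) (T.l g)

theorem ψ_sect (x g : G) : T.ψ x (T.sect g) = T.c x g := T.ψ_elem _ _ _
theorem π_sect (g : G) : T.π (T.sect g) = T.l g := T.π_elem _ _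

/-- The diagonal action of `sect g` on `V ⊗ V`. -/
theorem diag_sect (g : G) : HopfRep.act₂ T.π T.π (comul (R := k) (T.sect g)) =
    T.cochain g • TensorProduct.map (T.l (T.star g) : Module.End k T.V) (T.l g) := by
  refine LinearMap.ext fun t => T.B.injective (funext fun d => ?_)
  rw [← HopfRep.diag_apply, T.B_π, ψ_sect, (T.exists_B_star g).choose_spec d t, Units.smul_def,
    LinearMap.smul_apply, map_smul]
  rfl

theorem π_leftTwist_sect (x g : G) :
    T.π (leftTwist (T.ψ x) (T.sect g)) = T.b g x • (T.l g : Module.End k T.V) := by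
  rw [π_leftTwist, π_sect, show (T.l g * T.l x : Module.End k T.V) = _ from T.l_comm_l g x,
    mul_smul_comm, Units.inv_mul_cancel_left]

theorem π_rightTwist_sect (x g : G) :
    T.π (rightTwist (T.ψ x) (T.sect g)) = T.c g x • (T.l g : Module.End k T.V) := by
  rw [π_rightTwist, π_sect, show (T.l g * T.r x : Module.End k T.V) = _ from T.l_comm_r g x,
    mul_smul_comm, Units.inv_mul_cancel_left]

end Fintype

/-! ### The idempotents -/

/-- The central idempotents of `A` for `k^G` and `End V`, indexed by the group of order two. -/
noncomputable def idem (q : Multiplicative (ZMod 2)) : A :=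
  T.elem (fun _ => if q = 1 then 1 else 0) (if q = 1 then 0 else 1)

theorem ψ_idem (g : G) (q : Multiplicative (ZMod 2)) :
    T.ψ g (T.idem q) = if q = 1 then 1 else 0 := T.ψ_elem _ _ _

theorem π_idem (q : Multiplicative (ZMod 2)) : T.π (T.idem q) = if q = 1 then 0 else 1 :=
  T.π_elem _ _

theorem leftTwist_idem (g : G) (q : Multiplicative (ZMod 2)) :
    leftTwist (T.ψ g) (T.idem q) = T.idem q := by
  refine T.ext (fun h => ?_) ?_
  · rw [← T.ψ_mul, ψ_idem, ψ_idem]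
  · rw [π_leftTwist, π_idem]
    split_ifs <;> simp

theorem π_rightTwist_idem (g : G) (q : Multiplicative (ZMod 2)) :
    T.π (rightTwist (T.ψ g) (T.idem q)) = T.π (T.idem q) := by
  rw [π_rightTwist, π_idem]
  split_ifs <;> simp

theorem diag_idem (q : Multiplicative (ZMod 2)) :
    HopfRep.act₂ T.π T.π (comul (R := k) (T.idem q)) = if q = 1 then 1 else 0 := by
  refine LinearMap.ext fun t => T.B.injective (funext fun d => ?_)
  rw [← HopfRep.diag_apply, T.B_π, ψ_idem]
  split_ifs <;> simp

theorem sum_sign {M : Type*} [AddCommMonoid M] (f : Multiplicative (ZMod 2) → M) :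
    ∑ q, f q = f 1 + f (Multiplicative.ofAdd 1) :=
  Fin.sum_univ_two (fun i : Fin 2 => f (Multiplicative.ofAdd (i : ZMod 2)))

theorem sign_eq (q : Multiplicative (ZMod 2)) : q = 1 ∨ q = Multiplicative.ofAdd 1 := by
  revert q
  decide

end TambaraYamagamiReps

/-! ### The cleft extension -/

namespace TambaraYamagamiReps

variable {k : Type u} [Field k] {A : Type v} [Ring A] [HopfAlgebra k A] {G : Type w} [CommGroup G]
  (T : TambaraYamagamiReps k A G) [Fintype G]

open Coalgebra

/-- The action of the group of order two on `G` by the involution `star`. -/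
noncomputable def starHom : Multiplicative (ZMod 2) →* MulAut G where
  toFun q := if q = 1 then 1 else T.star
  map_one' := if_pos rfl
  map_mul' p q := by
    have h1 : (Multiplicative.ofAdd (1 : ZMod 2)) ≠ 1 := by decide
    have h2 : (Multiplicative.ofAdd (1 : ZMod 2)) * Multiplicative.ofAdd 1 = 1 := by decide
    rcases sign_eq p with rfl | rfl <;> rcases sign_eq q with rfl | rfl <;>
      simp [h1, h2, star_mul_star]

theorem sign_ne : (Multiplicative.ofAdd (1 : ZMod 2)) ≠ 1 := by decide

theorem starHom_sign : T.starHom (Multiplicative.ofAdd 1) = T.star :=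
  if_neg (t := (1 : MulAut G)) sign_ne

/-- On `k^G` the elements `sect g` are the distinct characters `c · g` of `G`, and on `End V` they
are the independent operators `L g`. -/
theorem idem_mul_sect_linearIndependent : LinearIndependent k
    fun p : Multiplicative (ZMod 2) × G => T.idem p.1 * T.sect p.2 := by
  refine Fintype.linearIndependent_iff.2 fun a ha => ?_
  rw [Fintype.sum_prod_type, sum_sign] at ha
  have hψ : ∀ g, a (1, g) = 0 := by
    let χ : G → G →* k := fun g =>
      { toFun := fun x => T.c x g
        map_one' := by rw [c_one_left, Units.val_one]
        map_mul' := fun x y => by rw [c_mul_left, Units.val_mul] }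
    have hχ : Function.Injective χ := by
      intro g h hgh
      have h1 : ∀ x, T.c x g = T.c x h := fun x => Units.ext (DFunLike.congr_fun hgh x)
      rw [← mul_inv_eq_one]
      refine T.eq_one_of_c_eq_one fun x => ?_
      rw [c_mul_right, h1, ← c_mul_right, mul_inv_cancel, c_one_right]
    refine Fintype.linearIndependent_iff.1 ((linearIndependent_monoidHom G k).comp χ hχ)
      (fun g => a (1, g)) (funext fun x => ?_)
    have h1 := congrArg (T.ψ x) ha
    simp only [map_add, map_sum, map_smul, map_mul, ψ_idem, if_pos, if_neg sign_ne, zero_mul,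
      smul_zero, Finset.sum_const_zero, add_zero, one_mul, ψ_sect, map_zero] at h1
    rw [Finset.sum_apply]
    exact h1
  have hπ : ∀ g, a (Multiplicative.ofAdd 1, g) = 0 := by
    refine Fintype.linearIndependent_iff.1 T.linearIndependent_l
      (fun g => a (Multiplicative.ofAdd 1, g)) ?_
    have h1 := congrArg T.π ha
    simpa only [map_add, map_sum, map_smul, map_mul, π_idem, if_pos, if_neg sign_ne, zero_mul,
      smul_zero, Finset.sum_const_zero, zero_add, one_mul, π_sect, map_zero] using h1
  rintro ⟨q, g⟩
  rcases sign_eq q with rfl | rfl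
  · exact hψ g
  · exact hπ g

theorem card_eq_finrank (T : TambaraYamagamiReps k A G) :
    Fintype.card (Multiplicative (ZMod 2) × G) = Module.finrank k A := by
  rw [T.prodEquiv.finrank_eq, Module.finrank_prod, T.finrank_end,
    Module.finrank_fintype_fun_eq_card, Fintype.card_prod]
  change 2 * _ = _
  exact two_mul _

/-- A Hopf algebra with Tambara–Yamagami fusion rules is a cleft extension of `kG` by `k^{ℤ/2}`. -/
noncomputable def cleftData : CleftData k A T.starHom where
  d := T.idem
  u := T.sect
  -- `σ` is trivial on `k^G`, as `c` is a bicharacter, and `τ` is nontrivial only in the component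
  -- of the comultiplication that acts on `V ⊗ V`.
  σ t g h := if t = 1 then 1 else T.cocycle g h
  τ g t s := if t = 1 ∨ s = 1 then 1 else T.cochain g
  d_mul_self t := T.ext (fun g => by rw [map_mul, ψ_idem]; split_ifs <;> simp)
    (by rw [map_mul, π_idem]; split_ifs <;> simp)
  d_mul_ne s t hst := by
    refine T.ext (fun g => ?_) ?_
    · rw [map_mul, ψ_idem, ψ_idem, map_zero]
      rcases sign_eq s with rfl | rfl <;> rcases sign_eq t with rfl | rfl <;>
        simp_all
    · rw [map_mul, π_idem, π_idem, map_zero]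
      rcases sign_eq s with rfl | rfl <;> rcases sign_eq t with rfl | rfl <;>
        simp_all
  sum_d := by
    rw [sum_sign]
    refine T.ext (fun g => ?_) ?_
    · rw [map_add, ψ_idem, ψ_idem, if_pos rfl, if_neg sign_ne, map_one, add_zero]
    · rw [map_add, π_idem, π_idem, if_pos rfl, if_neg sign_ne, map_one, zero_add]
  d_comm t a := by
    refine T.ext (fun g => ?_) ?_
    · rw [map_mul, map_mul, mul_comm]
    · rw [map_mul, map_mul, π_idem]
      split_ifs <;> simp
  u_one := by
    refine T.ext (fun g => ?_) ?_
    · rw [ψ_sect, c_one_right, map_one, Units.val_one]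
    · rw [π_sect, l_one, map_one, Units.val_one]
  u_mul g h := by
    rw [sum_sign]
    refine T.ext (fun x => ?_) ?_
    · simp only [map_add, map_smul, map_mul, ψ_idem, ψ_sect, if_pos, if_neg sign_ne, c_mul_right]
      simp
    · simp only [map_add, map_smul, map_mul, π_idem, π_sect, if_pos, if_neg sign_ne, l_mul]
      simp [Units.smul_def]
  comul_d t := by
    rw [sum_sign]
    refine T.ext_tensor (fun g => ?_) (fun g => ?_) ?_
    · rw [← leftTwist_apply, leftTwist_idem]
      simp [ψ_idem]
    · rw [← rightTwist_apply, π_rightTwist_idem]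
      rcases sign_eq t with rfl | rfl <;> simp [ψ_idem, π_idem]
    · rw [diag_idem]
      refine TensorProduct.ext' fun v w => ?_
      rcases sign_eq t with rfl | rfl <;> simp [π_idem]
  comul_u g := by
    rw [sum_sign, sum_sign, sum_sign, map_one, starHom_sign]
    refine T.ext_tensor (fun x => ?_) (fun x => ?_) ?_
    · rw [← leftTwist_apply]
      refine T.ext (fun y => ?_) ?_
      · rw [← T.ψ_mul, ψ_sect]
        simp [ψ_idem, ψ_sect, c_mul_left]
      · rw [π_leftTwist_sect, ← c_star]
        simp [ψ_idem, π_idem, ψ_sect, π_sect, Units.smul_def]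
    · rw [← rightTwist_apply, π_rightTwist_sect, c_symm]
      simp [ψ_idem, π_idem, ψ_sect, π_sect, Units.smul_def]
    · rw [diag_sect]
      refine TensorProduct.ext' fun v w => ?_
      simp [π_idem, π_sect, Units.smul_def]
  counit_d_one := by rw [← T.ψ_one, ψ_idem, if_pos rfl]
  counit_u g := by rw [← T.ψ_one, ψ_sect, c_one_left, Units.val_one]
  basis := basisOfLinearIndependentOfCardEqFinrank T.idem_mul_sect_linearIndependent
    T.card_eq_finrank
  basis_apply t g := congrFun (coe_basisOfLinearIndependentOfCardEqFinrank
    T.idem_mul_sect_linearIndependent T.card_eq_finrank) (t, g)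

end TambaraYamagamiReps

/-- A cleft extension is group theoretical, for a group `G` in any universe. -/
theorem CleftData.isGroupTheoretical_of_small {k : Type u} [Field k] {A : Type v} [Ring A]
    [HopfAlgebra k A] {Q : Type} {G : Type w} [Group Q] [Fintype Q] [CommGroup G] [Fintype G]
    {φ : Q →* MulAut G} (C : CleftData k A φ) : IsGroupTheoretical k A := by
  have : Small.{0} G := inferInstance
  have : Fintype (Shrink.{0} G) := Fintype.ofEquiv G (equivShrink G)
  exact (C.congr (Shrink.mulEquiv (α := G)).symm).isGroupTheoretical

theorem mainTheorem4 {k : Type u} [Field k] [IsAlgClosed k] [CharZero k]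
    {A : Type v} [Ring A] [HopfAlgebra k A] [IsSemisimpleRing A]
    {G : Type w} [CommGroup G] [Fintype G] (D : TambaraYamagamiData k G)
    (h : MonoidallyEquivalent (HopfRep.{u, v} k A) (TambaraYamagami D)) :
    (∃ (i : FunctionAlgebra k (Multiplicative (ZMod 2)) →ₐc[k] A) (p : A →ₐc[k] MonoidAlgebra k G),
      IsCentralExtension i p) ∧
    IsGroupTheoretical k A := by
  obtain ⟨e, ⟨_⟩⟩ := h
  obtain ⟨T⟩ := HopfRep.nonempty_tambaraYamagamiReps e
  exact ⟨⟨T.cleftData.incl, T.cleftData.proj, T.cleftData.isCentralExtension⟩,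
    T.cleftData.isGroupTheoretical_of_small⟩
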